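/- **Setting.** Let $\mathcal X\subseteq\mathbb R^n$ be closed and convex, let $\mathcal Y\subseteq\mathbb R^d$ be compact and convex with $0\in\mathcal Y$ and diameter $D_{\mathcal Y}>0$, and let $f:\mathbb R^n\times\mathbb R^d\to\mathbb R$ be continuously differentiable, with $f(x,\cdot)$ concave on $\mathcal Y$ for every $x\in\mathcal X$ and, for some $\ell>0$ and all $x,x'\in\mathcal X$, $y,y'\in\mathcal Y$, $$\|\nabla_xf(x,y)-\nabla_xf(x',y')\|\le\ell(\|x-x'\|+\|y-y'\|),\qquad \|\nabla_yf(x,y)-\nabla_yf(x',y')\|\le\ell(\|x-x'\|+\|y-y'\|).$$ Assume that $x\mapsto\max_{y\in\mathcal Y}f(x,y)$ is bounded below on $\mathcal X$. A pair $(x,y)\in\mathcal X\times\mathcal Y$ is an $\epsilon$-GS of $\min_{x\in\mathcal X}\max_{y\in\mathcal Y}f(x,y)$ if $\operatorname{dist}(0,\nabla_xf(x,y)+\partial\iota_{\mathcal X}(x))\le\epsilon$ and $\operatorname{dist}(0,-\nabla_yf(x,y)+\partial\iota_{\mathcal Y}(y))\le\epsilon$. A point $x\in\mathcal X$ is an $\epsilon$-OS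 if $\|\operatorname{prox}_{\Phi/(2\ell)}(x)-x\|\le\epsilon/(2\ell)$, where $\Phi=\max_{y\in\mathcal Y}f(\cdot,y)+\iota_{\mathcal X}$ and $\operatorname{prox}_{\Phi/(2\ell)}(x)=\arg\min_{x'}\{\Phi(x')+\ell\|x'-x\|^2\}$. For $r_x>\ell$ and $r_y>0$ let $\widetilde f(x,y)=f(x,y)-\frac{r_y}2\|y\|^2$, $\ \widetilde F(x,y,z)=\widetilde f(x,y)+\frac{r_x}2\|x-z\|^2$, $\ \widetilde p(z)=\min_{x\in\mathcal X}\max_{y\in\mathcal Y}\widetilde F(x,y,z)$ and $\Delta_{\widetilde p}=\widetilde p(z_0)-\inf_{x\in\mathcal X}\max_{y\in\mathcal Y}\widetilde f(x,y)$. **Perturbed Smoothed FOAM.** From $x_0\in\mathcal X$, $y_0\in\mathcal Y$, $z_0\in\mathbb R^n$, for $t=0,1,\dots$: let $(x_{t+1},y_{t+1})$ be the output of FOAM on $h=\widetilde F(\cdot,\cdot,z_t)$ over $\mathcal X\times\mathcal Y$, started at $(x_t,y_t)$, with moduli $\mu_x=r_x-\ell$, $\mu_y=r_y$, $L=2\ell+\max(r_x,r_y)$,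 and stopped at its first outer iterate that is $\delta$-accurate, i.e. whose squared distance to the saddle point of $h$ on $\mathcal X\times\mathcal Y$ is at most $\delta$; then let $z_{t+1}=z_t+\beta(x_{t+1}-z_t)$. The candidate solution with index $t$ is $$\hat x_t=\operatorname{proj}_{\mathcal X}\bigl(x_{t+1}-\alpha\nabla_x\widetilde F(x_{t+1},y_{t+1},z_t)\bigr),\qquad \hat y_t=\operatorname{proj}_{\mathcal Y}\bigl(y_{t+1}+c\,\nabla_y\widetilde F(x_{t+1},y_{t+1},z_t)\bigr).$$ **FOAM** (the method of Kovalev and Gasnikov) keeps $z^k,z_f^k,x_f^k\in\mathbb R^n$ and $y^k,y_f^k\in\mathbb R^d$; its outer iterate is $(x_f^k,y_f^k)$. Let $(\bar x,\bar y)$ be the initial point, $z^0=z_f^0=-\mu_x\bar x$, $y^0=y_f^0=\bar y$, $x_f^0=\bar x$, and $\bar\alpha=\min\{1,\sqrt{8\mu_y/\mu_x}\}$, $\eta_z=\mu_x/2$, $\eta_y=\min\{\frac1{2\mu_y},\frac4{\bar\alpha\mu_x}\}$, $\gamma=8/\mu_x$, $\lambda=\gamma/(2\sqrt5(1+8L/\mu_x))$,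 $\hat h=h-\frac{\mu_x}2\|x\|^2+\frac{\mu_y}2\|y\|^2$. Outer iteration $k$: put $(z_g,y_g)=\bar\alpha(z^k,y^k)+(1-\bar\alpha)(z_f^k,y_f^k)$, $$a(x,y)=\Bigl(\nabla_x\hat h(x,y)+\tfrac{\mu_x}2(x-\mu_x^{-1}z_g),\ -\nabla_y\hat h(x,y)+\mu_yy+\tfrac{\mu_x}8(y-y_g)\Bigr),$$ $u^{-1}=(-\mu_x^{-1}z_g,y_g)$, and, with $\Pi$ the projection onto $\mathcal X\times\mathcal Y$, $v^0=u^{-1}-\lambda a(u^{-1})$, $u^0=\Pi(v^0)$, $b^0=\lambda^{-1}(v^0-u^0)$. For $s=0,1,\dots$ until $\gamma\|a(u^s)+b^s\|^2\le\gamma^{-1}\|u^s-u^{-1}\|^2$, put $w^s=u^s+\frac2{s+3}(u^0-u^s)$, $u^{s+1/2}=w^s-\lambda(a(u^s)+b^s)$, $v^{s+1}=w^s-\lambda a(u^{s+1/2})$, $u^{s+1}=\Pi(v^{s+1})$, $b^{s+1}=\lambda^{-1}(v^{s+1}-u^{s+1})$. With the final $u^s=(x_f^{k+1},y_f^{k+1})$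 and $b^s=(b_x,b_y)$ put $z_f^{k+1}=\nabla_x\hat h(u^s)+b_x$, $w_f=-\nabla_y\hat h(u^s)+b_y$, $z^{k+1}=z^k+\frac{\eta_z}{\mu_x}(z_f^{k+1}-z^k)-\eta_z(x_f^{k+1}+\mu_x^{-1}z_f^{k+1})$, $y^{k+1}=y^k+\eta_y\mu_y(y_f^{k+1}-y^k)-\eta_y(w_f+\mu_yy_f^{k+1})$. At query points outside $\mathcal X\times\mathcal Y$, $\nabla f$ is evaluated at the projection onto $\mathcal X\times\mathcal Y$. The number of gradient steps is the number of evaluations of $(\nabla_xf,\nabla_yf)$: an outer FOAM iteration with $s$ inner steps costs $2+2s$, and the final projected step costs $1$. **Theorem (iteration complexity of Perturbed Smoothed FOAM).** Fix constants $\kappa,m\in\mathbb R$, $b,K,\theta>0$ and $0<c_1\le c_2$. Consider parameters with $$3\ell<r_x\le\kappa\ell,\quad b\le\beta\le1-b,\quad 0<\delta\le K\frac{r_y^4D_{\mathcal Y}^2}{\ell^4},\quad \log\tfrac1\delta\le m\log\tfrac1\epsilon,\quad \tfrac\theta\ell\le\alpha\le\tfrac1{r_x+\ell},\quad \tfrac\theta\ell\le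 c\le\tfrac1{r_y+\ell}.\tag{$*$}$$ (i) (Game stationarity) If $c_2<1$, there is a constant $C$ depending only on $\kappa,b,K,m,\theta,c_1,c_2$ such that for every problem and every initial point as above, for all sufficiently small $\epsilon>0$ (the threshold may depend on the problem and the initial point), and for all parameters satisfying $(*)$ and $c_1\frac{\epsilon}{D_{\mathcal Y}}\le r_y\le c_2\frac{\epsilon}{D_{\mathcal Y}}$, there is an index $t$ such that $(\hat x_t,\hat y_t)$ is an $\epsilon$-GS and it is computed (all loops terminating) with at most $$C\,\frac{\ell^{1.5}D_{\mathcal Y}^{0.5}\max\{\Delta_{\widetilde p},\epsilon^2/\ell\}}{\epsilon^{2.5}}\log\frac1\epsilon$$ gradient steps in total. (ii) (Optimization stationarity) If $c_2<\frac18$, the same holds with $c_1\frac{\epsilon^2}{\ell D_{\mathcal Y}^2}\le r_y\le c_2\frac{\epsilon^2}{\ell D_{\mathcal Y}^2}$: there is an index $t$ such that $\hat x_t$ is an $\epsilon$-OS and it is computed with at most $$C\,\frac{\ell^{2}D_{\mathcal Y}\max\{\Delta_{\widetilde p},\epsilon^2/\ell\}}{\epsilon^{3}}\log\frac1\epsilon$$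 gradient steps in total. In both cases the maximum equals $\Delta_{\widetilde p}$ as soon as $\epsilon^2\le\ell\Delta_{\widetilde p}$. -/

import Mathlib

open Set

namespace MinimaxFOAM

noncomputable section

/-- Euclidean space of dimension `n`. -/
abbrev E (n : ℕ) := EuclideanSpace ℝ (Fin n)

/-! ### The minimax problem -/

/-- The data of the problem `min_{x ∈ X} max_{y ∈ Y} f x y`, with a smoothness modulus `ell`. -/
structure Problem (n d : ℕ) where
  X : Set (E n)
  Y : Set (E d)
  f : E n → E d → ℝ
  ell : ℝ

/-- Partial gradient in the first variable. -/
def gradX {n d : ℕ} (f : E n → E d → ℝ) (x : E n) (y : E d) : E n :=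
  gradient (fun x' => f x' y) x

/-- Partial gradient in the second variable. -/
def gradY {n d : ℕ} (f : E n → E d → ℝ) (x : E n) (y : E d) : E d :=
  gradient (fun y' => f x y') y

/-- The primal function `x ↦ max_{y ∈ Y} f x y`. -/
def primal {n d : ℕ} (Y : Set (E d)) (f : E n → E d → ℝ) (x : E n) : ℝ :=
  sSup (f x '' Y)

/-- The value `min_{x ∈ X} max_{y ∈ Y} f x y`. -/
def minimaxValue {n d : ℕ} (X : Set (E n)) (Y : Set (E d)) (f : E n → E d → ℝ) : ℝ :=
  sInf (primal Y f '' X)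

/-- The standing assumptions: `X` is closed and convex, `Y` is compact and convex, contains the
origin and has positive diameter, `f` is continuously differentiable with partial gradients that
are `ell`-Lipschitz on `X × Y`, and `f x` is concave on `Y` for each `x ∈ X`. -/
structure Problem.Assumptions {n d : ℕ} (P : Problem n d) : Prop where
  closed_X : IsClosed P.X
  convex_X : Convex ℝ P.X
  compact_Y : IsCompact P.Y
  convex_Y : Convex ℝ P.Y
  zero_mem_Y : (0 : E d) ∈ P.Y
  diam_pos : 0 < Metric.diam P.Y
  ell_pos : 0 < P.ell
  contDiff : ContDiff ℝ 1 (fun p : E n × E d => P.f p.1 p.2)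
  lipschitz_gradX : ∀ x ∈ P.X, ∀ x' ∈ P.X, ∀ y ∈ P.Y, ∀ y' ∈ P.Y,
    ‖gradX P.f x y - gradX P.f x' y'‖ ≤ P.ell * (‖x - x'‖ + ‖y - y'‖)
  lipschitz_gradY : ∀ x ∈ P.X, ∀ x' ∈ P.X, ∀ y ∈ P.Y, ∀ y' ∈ P.Y,
    ‖gradY P.f x y - gradY P.f x' y'‖ ≤ P.ell * (‖x - x'‖ + ‖y - y'‖)
  concave : ∀ x ∈ P.X, ConcaveOn ℝ P.Y (P.f x)

/-- The normal cone of `S` at a point `x ∈ S`, i.e. the subdifferential at `x` of the indicator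
function of `S`. -/
def normalCone {n : ℕ} (S : Set (E n)) (x : E n) : Set (E n) :=
  {v | ∀ x' ∈ S, inner ℝ v (x' - x) ≤ 0}

/-- `ε`-game-stationary pairs. -/
def Problem.IsGS {n d : ℕ} (P : Problem n d) (ε : ℝ) (x : E n) (y : E d) : Prop :=
  x ∈ P.X ∧ y ∈ P.Y ∧
    Metric.infDist 0 ((fun v => gradX P.f x y + v) '' normalCone P.X x) ≤ ε ∧
    Metric.infDist 0 ((fun v => -gradY P.f x y + v) '' normalCone P.Y y) ≤ ε

/-- `p` is a proximal point `prox_{Φ/(2ℓ)}(x)`, where `Φ = max_y f(·, y) + ι_X`, that is, a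
minimizer over `X` of `max_y f(·, y) + ℓ ‖· - x‖²`. -/
def Problem.IsProxPoint {n d : ℕ} (P : Problem n d) (x p : E n) : Prop :=
  p ∈ P.X ∧ IsMinOn (fun x' => primal P.Y P.f x' + P.ell * ‖x' - x‖ ^ 2) P.X p

/-- `ε`-optimization-stationary points. -/
def Problem.IsOS {n d : ℕ} (P : Problem n d) (ε : ℝ) (x : E n) : Prop :=
  x ∈ P.X ∧ ∃ p, P.IsProxPoint x p ∧ ‖p - x‖ ≤ ε / (2 * P.ell)

/-! ### Auxiliary notions for the algorithms -/

/-- The projection onto `S`: a nearest point of `S`, unique if `S` is nonempty, closed, convex. -/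
def proj {n : ℕ} (S : Set (E n)) (x : E n) : E n :=
  Classical.epsilon fun p => p ∈ S ∧ ∀ q ∈ S, ‖x - p‖ ≤ ‖x - q‖

open Classical in
/-- The first index at which `p` holds, and `⊤` if there is none. -/
def firstIndex (p : ℕ → Prop) : ℕ∞ :=
  if h : ∃ k, p k then ((Nat.find h : ℕ) : ℕ∞) else ⊤

/-! ### FOAM

The method of Kovalev and Gasnikov for `min_{x ∈ X} max_{y ∈ Y} h x y`, where `h` is `L`-smooth,
`muX`-strongly convex in `x` and `muY`-strongly concave in `y`. -/

/-- The input of FOAM: the feasible sets, a gradient oracle for `h`, and the moduli. -/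
structure Foam (n d : ℕ) where
  X : Set (E n)
  Y : Set (E d)
  gX : E n → E d → E n
  gY : E n → E d → E d
  muX : ℝ
  muY : ℝ
  L : ℝ

namespace Foam

/-- A state of the inner loop: a feasible pair `(x, y)` with normal vectors `(bX, bY)`. -/
structure Inner (n d : ℕ) where
  x : E n
  y : E d
  bX : E n
  bY : E d

/-- A state of the outer loop: the sequences `z`, `y`, `z_f`, `y_f` and `x_f`. The pair
`(xf, yf)` is the current approximate solution. -/
structure Outer (n d : ℕ) where
  z : E n
  y : E d
  zf : E n
  yf : E d
  xf : E n

variable {n d : ℕ} (A : Foam n d)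

/-- Outer extrapolation parameter. -/
def alpha : ℝ := min 1 (√(8 * A.muY / A.muX))

/-- Outer step size for `z`. -/
def etaZ : ℝ := A.muX / 2

/-- Outer step size for `y`. -/
def etaY : ℝ := min (1 / (2 * A.muY)) (4 / (A.alpha * A.muX))

/-- Scaling of the inner problem. -/
def gamma : ℝ := 8 / A.muX

/-- Step size of the inner loop. -/
def innerStepSize : ℝ := A.gamma * (2 * √5 * (1 + 8 * A.L / A.muX))⁻¹

/-- `x`-gradient of `h - (muX / 2) ‖x‖² + (muY / 2) ‖y‖²`. -/
def hatX (x : E n) (y : E d) : E n := A.gX x y - A.muX • x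

/-- `y`-gradient of `h - (muX / 2) ‖x‖² + (muY / 2) ‖y‖²`. -/
def hatY (x : E n) (y : E d) : E d := A.gY x y + A.muY • y

/-- The `x`-part of the operator of the inner inclusion. -/
def aX (zg : E n) (x : E n) (y : E d) : E n :=
  A.hatX x y + (A.muX / 2) • (x - A.muX⁻¹ • zg)

/-- The `y`-part of the operator of the inner inclusion. -/
def aY (yg : E d) (x : E n) (y : E d) : E d :=
  -A.hatY x y + A.muY • y + (A.muX / 8) • (y - yg)

/-- The state after a forward-backward step to the projections of `vX` and `vY`. -/
def backward (vX : E n) (vY : E d) : Inner n d where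
  x := proj A.X vX
  y := proj A.Y vY
  bX := A.innerStepSize⁻¹ • (vX - proj A.X vX)
  bY := A.innerStepSize⁻¹ • (vY - proj A.Y vY)

/-- The first inner state: a forward-backward step from `(-zg / muX, yg)`. -/
def innerStart (zg : E n) (yg : E d) : Inner n d :=
  let x := -(A.muX⁻¹ • zg)
  A.backward (x - A.innerStepSize • A.aX zg x yg) (yg - A.innerStepSize • A.aY yg x yg)

/-- Step `t` of the inner loop: an extragradient step anchored at the first inner state `s₀`. -/
def innerNext (zg : E n) (yg : E d) (s₀ : Inner n d) (t : ℕ) (s : Inner n d) : Inner n d :=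
  let b : ℝ := 2 / ((t : ℝ) + 3)
  let cX := s.x + b • (s₀.x - s.x)
  let cY := s.y + b • (s₀.y - s.y)
  let xh := cX - A.innerStepSize • (A.aX zg s.x s.y + s.bX)
  let yh := cY - A.innerStepSize • (A.aY yg s.x s.y + s.bY)
  A.backward (cX - A.innerStepSize • A.aX zg xh yh) (cY - A.innerStepSize • A.aY yg xh yh)

/-- The inner iterates. -/
def inner (zg : E n) (yg : E d) : ℕ → Inner n d
  | 0 => A.innerStart zg yg
  | t + 1 => A.innerNext zg yg (A.innerStart zg yg) t (inner zg yg t)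

/-- The stopping test of the inner loop. -/
def InnerStop (zg : E n) (yg : E d) (t : ℕ) : Prop :=
  let s := A.inner zg yg t
  A.gamma * (‖A.aX zg s.x s.y + s.bX‖ ^ 2 + ‖A.aY yg s.x s.y + s.bY‖ ^ 2) ≤
    A.gamma⁻¹ * (‖s.x - -(A.muX⁻¹ • zg)‖ ^ 2 + ‖s.y - yg‖ ^ 2)

/-- The number of steps of the inner loop (`⊤` if it never stops). -/
def innerCount (zg : E n) (yg : E d) : ℕ∞ := firstIndex (A.InnerStop zg yg)

/-- The point `z_g`. -/
def zg (s : Outer n d) : E n := A.alpha • s.z + (1 - A.alpha) • s.zf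

/-- The point `y_g`. -/
def yg (s : Outer n d) : E d := A.alpha • s.y + (1 - A.alpha) • s.yf

/-- One outer iteration. -/
def outerNext (s : Outer n d) : Outer n d :=
  let i := A.inner (A.zg s) (A.yg s) (A.innerCount (A.zg s) (A.yg s)).toNat
  let zf := A.hatX i.x i.y + i.bX
  let wf := -A.hatY i.x i.y + i.bY
  { z := s.z + (A.etaZ * A.muX⁻¹) • (zf - s.z) - A.etaZ • (i.x + A.muX⁻¹ • zf)
    y := s.y + (A.etaY * A.muY) • (i.y - s.y) - A.etaY • (wf + A.muY • i.y)
    zf := zf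
    yf := i.y
    xf := i.x }

/-- The outer iterates from the initial point `(x₀, y₀)`. -/
def outer (x₀ : E n) (y₀ : E d) : ℕ → Outer n d
  | 0 => { z := -(A.muX • x₀), y := y₀, zf := -(A.muX • x₀), yf := y₀, xf := x₀ }
  | k + 1 => A.outerNext (outer x₀ y₀ k)

/-- The number of gradient evaluations in an outer iteration started at `s`: two to set up the
inner loop and two in each of its steps. -/
def iterCost (s : Outer n d) : ℕ∞ := 2 + 2 * A.innerCount (A.zg s) (A.yg s)

/-- The number of outer iterations until the approximate solution passes the test `acc`. -/
def outerCount (acc : E n → E d → Prop) (x₀ : E n) (y₀ : E d) : ℕ∞ :=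
  firstIndex fun k => acc (A.outer x₀ y₀ k).xf (A.outer x₀ y₀ k).yf

/-- The output of FOAM run from `(x₀, y₀)` until the approximate solution passes `acc`. -/
def output (acc : E n → E d → Prop) (x₀ : E n) (y₀ : E d) : E n × E d :=
  let s := A.outer x₀ y₀ (A.outerCount acc x₀ y₀).toNat
  (s.xf, s.yf)

/-- The number of gradient evaluations of that run (`⊤` if it does not terminate). -/
def cost (acc : E n → E d → Prop) (x₀ : E n) (y₀ : E d) : ℕ∞ :=
  if A.outerCount acc x₀ y₀ = ⊤ then ⊤
  else ∑ k ∈ Finset.range (A.outerCount acc x₀ y₀).toNat, A.iterCost (A.outer x₀ y₀ k)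

end Foam

/-! ### Perturbed Smoothed FOAM -/

/-- The parameters `r_x`, `r_y`, `β`, `δ` of the method. -/
structure Params where
  rx : ℝ
  ry : ℝ
  β : ℝ
  δ : ℝ

namespace Problem

variable {n d : ℕ} (P : Problem n d) (q : Params)

/-- The dually perturbed objective. -/
def perturbed (x : E n) (y : E d) : ℝ := P.f x y - q.ry / 2 * ‖y‖ ^ 2

/-- The smoothed and perturbed objective `F(·, ·, z)`. -/
def surrogate (z : E n) (x : E n) (y : E d) : ℝ :=
  P.f x y + q.rx / 2 * ‖x - z‖ ^ 2 - q.ry / 2 * ‖y‖ ^ 2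

/-- The proximal function `z ↦ min_{x ∈ X} max_{y ∈ Y} F(x, y, z)`. -/
def proxValue (z : E n) : ℝ := minimaxValue P.X P.Y (P.surrogate q z)

/-- The initial gap. -/
def gap (z₀ : E n) : ℝ := P.proxValue q z₀ - minimaxValue P.X P.Y (P.perturbed q)

/-- `(x, y)` is a `δ`-accurate solution of `min_{x ∈ X} max_{y ∈ Y} F(x, y, z)`. -/
def IsAccurate (z : E n) (x : E n) (y : E d) : Prop :=
  ∃ xs ∈ P.X, ∃ ys ∈ P.Y, IsSaddlePointOn P.X P.Y (P.surrogate q z) xs ys ∧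
    ‖x - xs‖ ^ 2 + ‖y - ys‖ ^ 2 ≤ q.δ

/-- FOAM for the subproblem at `z`. The gradient of `f`, which is only assumed to be Lipschitz on
`X × Y`, is evaluated at the projection of the query point onto `X × Y`; at a point of `X × Y` the
oracle returns the gradient of `F(·, ·, z)`. -/
def foam (z : E n) : Foam n d where
  X := P.X
  Y := P.Y
  gX x y := gradX P.f (proj P.X x) (proj P.Y y) + q.rx • (x - z)
  gY x y := gradY P.f (proj P.X x) (proj P.Y y) - q.ry • y
  muX := q.rx - P.ell
  muY := q.ry
  L := 2 * P.ell + max q.rx q.ry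

/-- The iterates `(x_t, y_t, z_t)` of Perturbed Smoothed FOAM from `(x₀, y₀, z₀)`. -/
def iter (x₀ : E n) (y₀ : E d) (z₀ : E n) : ℕ → E n × E d × E n
  | 0 => (x₀, y₀, z₀)
  | t + 1 =>
    let s := iter x₀ y₀ z₀ t
    let u := (P.foam q s.2.2).output (P.IsAccurate q s.2.2) s.1 s.2.1
    (u.1, u.2, s.2.2 + q.β • (u.1 - s.2.2))

/-- The number of gradient evaluations in the iteration that computes `(x_{t+1}, y_{t+1})`. -/
def iterCost (x₀ : E n) (y₀ : E d) (z₀ : E n) (t : ℕ) : ℕ∞ :=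
  let s := P.iter q x₀ y₀ z₀ t
  (P.foam q s.2.2).cost (P.IsAccurate q s.2.2) s.1 s.2.1

/-- One projected gradient step on `F(·, ·, z_t)` from `(x_{t+1}, y_{t+1})`, with step sizes
`a` in `x` and `c` in `y`. -/
def candidate (a c : ℝ) (x₀ : E n) (y₀ : E d) (z₀ : E n) (t : ℕ) : E n × E d :=
  let z := (P.iter q x₀ y₀ z₀ t).2.2
  let x := (P.iter q x₀ y₀ z₀ (t + 1)).1
  let y := (P.iter q x₀ y₀ z₀ (t + 1)).2.1
  (proj P.X (x - a • gradX (P.surrogate q z) x y),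
    proj P.Y (y + c • gradY (P.surrogate q z) x y))

/-- The number of gradient evaluations needed to compute the candidate with index `t`: those of the
iterations `0, …, t`, and one for the final projected gradient step. -/
def totalCost (x₀ : E n) (y₀ : E d) (z₀ : E n) (t : ℕ) : ℕ∞ :=
  (∑ s ∈ Finset.range (t + 1), P.iterCost q x₀ y₀ z₀ s) + 1

/-- The parameter conditions at accuracy `ε`, with the constants in `O` and `Θ` written out:
`3ℓ < r_x ≤ κ ℓ`, `b ≤ β ≤ 1 - b`, `δ ≤ K r_y⁴ D² / ℓ⁴`, `log (1/δ) ≤ m log (1/ε)`, and final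
step sizes of order `1/ℓ`. -/
structure ParamCondition (κ b K m θ ε a c : ℝ) : Prop where
  ry_pos : 0 < q.ry
  rx_gt : 3 * P.ell < q.rx
  rx_le : q.rx ≤ κ * P.ell
  le_β : b ≤ q.β
  β_le : q.β ≤ 1 - b
  δ_pos : 0 < q.δ
  δ_le : q.δ ≤ K * (q.ry ^ 4 * Metric.diam P.Y ^ 2 / P.ell ^ 4)
  log_δ : Real.log (1 / q.δ) ≤ m * Real.log (1 / ε)
  le_a : θ / P.ell ≤ a
  a_le : a ≤ 1 / (q.rx + P.ell)
  le_c : θ / P.ell ≤ c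
  c_le : c ≤ 1 / (q.ry + P.ell)

end Problem

end

end MinimaxFOAM

/-! Since `f(·, y)` is `ℓ`-weakly convex on `X`, each surrogate is strongly convex in `x` with
modulus `r_x - ℓ` and strongly concave in `y` with modulus `r_y`. It has a unique saddle point,
whose `x`-part is written `sx z`. With exact saddle points the outer loop is a damped proximal point
method for the perturbed primal function: a step lowers the proximal value `p(z)`, which is bounded
below, by at least `(r_x β / 2) ‖sx z - z‖²`, and `δ`-accuracy costs only `r_x β δ / 2` per step
(`Run.drift`). Averaging over `T` of order `ℓ Δ / ε²` steps yields a `z_t` with `‖sx z_t - z_t‖` of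
order `ε / ℓ` (`Run.exists_small_residual`).

The final projected gradient step supplies explicit normal vectors. For game stationarity the
residuals are then small up to the dual perturbation `r_y D`, which is at most `c₂ ε` (`Run.isGS`).
For optimization stationarity the prox point is compared with `sx z_t`; the perturbation changes the
primal function by at most `r_y D² / 2` (`Run.isOS`).

The cost of a FOAM call comes from two nested rates. Conjugating in `x` turns the saddle problem
into the minimization of a strongly convex function of `(z, y)` (`foamPot`), and the outer FOAM loop
is an accelerated inexact proximal point method for it, contracting a Lyapunov function by `1 - α/2`
with `α` at least of order `√(r_y / ℓ)` (`FoamRegular.lyap_outerNext_le`). Each proximal subproblem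
is a strongly monotone inclusion; anchored extragradient drives its residual to zero like `1/s`, so
the relative stopping test holds after a number of inner steps bounded by an absolute constant
(`AnchoredIteration.stopping_test`, `Run.inner_bound_le`).

The product `T · √(ℓ / r_y) · log(1/ε)` is the claimed bound. Initial distances and other data of
the problem enter only inside the logarithm, where one extra power of `1/ε` absorbs them once `ε` is
small; hence `C` does not depend on the problem (`exists_complexity`). -/

namespace MinimaxFOAM

open scoped InnerProductSpace

/-! ### Anchored extragradient and strongly monotone variational inequalities in a Hilbert space. -/

section Hilbert

variable {H : Type*} [NormedAddCommGroup H] [InnerProductSpace ℝ H]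

/-- `Pi` is the metric projection onto `S`, described by its variational inequality. -/
structure IsProjection (S : Set H) (Pi : H → H) : Prop where
  mem : ∀ v, Pi v ∈ S
  inner_le : ∀ v, ∀ q ∈ S, ⟪v - Pi v, q - Pi v⟫_ℝ ≤ 0

/-- `u` solves the variational inequality for the operator `a` on `S`. -/
def SolvesVI (S : Set H) (a : H → H) (u : H) : Prop :=
  u ∈ S ∧ ∀ q ∈ S, 0 ≤ ⟪a u, q - u⟫_ℝ

theorem inner_le_of_norm_le {x y : H} {a b : ℝ} (hx : ‖x‖ ≤ a) (hy : ‖y‖ ≤ b) :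
    ⟪x, y⟫_ℝ ≤ a * b :=
  (real_inner_le_norm x y).trans
    (mul_le_mul hx hy (norm_nonneg _) ((norm_nonneg _).trans hx))

/-- A point at which the variational inequality of the projection holds is within the distance
of the arguments from any other such point. -/
theorem norm_sub_le_of_inner_le {v w p q : H} (h₁ : ⟪v - p, q - p⟫_ℝ ≤ 0)
    (h₂ : ⟪w - q, p - q⟫_ℝ ≤ 0) : ‖p - q‖ ≤ ‖v - w‖ := by
  have h : ‖p - q‖ ^ 2 ≤ ⟪v - w, p - q⟫_ℝ := by
    rw [← real_inner_self_eq_norm_sq]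
    simp only [inner_sub_left, inner_sub_right] at *
    linarith [real_inner_comm p q, real_inner_comm v p, real_inner_comm w p]
  have h' := h.trans (real_inner_le_norm _ _)
  by_contra hlt
  push Not at hlt
  have hpos : 0 < ‖p - q‖ := (norm_nonneg _).trans_lt hlt
  nlinarith

theorem IsProjection.norm_sub_le {S : Set H} {Pi : H → H} (h : IsProjection S Pi) (v w : H) :
    ‖Pi v - Pi w‖ ≤ ‖v - w‖ :=
  norm_sub_le_of_inner_le (h.inner_le v _ (h.mem w)) (h.inner_le w _ (h.mem v))

/-- One step of the anchored extragradient method decreases its potential. -/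
theorem anchored_step (s : ℕ) {u u' u₀ R S w : H} {lam : ℝ} (hlam : 0 < lam)
    (hu' : u' = u + (2 / ((s : ℝ) + 3)) • (u₀ - u) - lam • w)
    (hmono : 0 ≤ ⟪S - R, u' - u⟫_ℝ) (herr : ‖S - w‖ ^ 2 ≤ 1 / 20 * ‖w - R‖ ^ 2) :
    lam / 4 * (s + 2) * (s + 3) ^ 2 * ‖S‖ ^ 2 + (s + 2) * (s + 3) * ⟪S, u' - u₀⟫_ℝ ≤
      lam / 4 * (s + 1) * (s + 2) ^ 2 * ‖R‖ ^ 2 + (s + 1) * (s + 2) * ⟪R, u - u₀⟫_ℝ := by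
  have hs : (0 : ℝ) ≤ s := s.cast_nonneg
  have h3 : ((s : ℝ) + 3) ≠ 0 := by positivity
  obtain ⟨e, rfl⟩ : ∃ e, u = u₀ + e := ⟨u - u₀, by abel⟩
  have e1 : u' - (u₀ + e) = -(2 / ((s : ℝ) + 3)) • e - lam • w := by
    rw [hu']
    module
  have e2 : u' - u₀ = ((s + 1) / ((s : ℝ) + 3)) • e - lam • w := by
    have : u' - u₀ = (u' - (u₀ + e)) + e := by abel
    rw [this, e1, show ((s + 1) / ((s : ℝ) + 3)) = 1 + -(2 / ((s : ℝ) + 3)) by field_simp; ring,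
      add_smul, one_smul]
    abel
  rw [e1] at hmono
  rw [e2, add_sub_cancel_left]
  -- This completes the square in `w`: once `herr` is inserted, `key` contains `-19/20 (s+3)² ‖w‖²`.
  have hsq := sq_nonneg ‖((s : ℝ) + 3) • w - ((19 * s + 17) / 19 : ℝ) • R‖
  simp only [← real_inner_self_eq_norm_sq, inner_sub_left, inner_sub_right, inner_smul_left,
    inner_smul_right, conj_trivial] at *
  rw [real_inner_comm w R, real_inner_comm w S] at *
  set SS := ⟪S, S⟫_ℝ
  set RR := ⟪R, R⟫_ℝ
  set ww := ⟪w, w⟫_ℝ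
  set Sw := ⟪w, S⟫_ℝ
  set Rw := ⟪w, R⟫_ℝ
  set Se := ⟪S, e⟫_ℝ
  set Re := ⟪R, e⟫_ℝ
  have hRR : 0 ≤ RR := real_inner_self_nonneg
  have hmono' : 2 * (Se - Re) ≤ (s + 3) * lam * (Rw - Sw) := by
    have := mul_nonneg (show (0 : ℝ) ≤ s + 3 by positivity) hmono
    have h2 : ((s : ℝ) + 3) * (-(2 / ((s : ℝ) + 3)) * Se - lam * Sw -
      (-(2 / ((s : ℝ) + 3)) * Re - lam * Rw)) = -2 * (Se - Re) + (s + 3) * lam * (Rw - Sw) := by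
      field_simp; ring
    linarith
  have key : (s + 3) ^ 2 * SS - 2 * (s + 3) ^ 2 * Sw + 2 * (s + 1) * (s + 3) * Rw ≤
      (s + 1) * (s + 2) * RR := by
    have h1 := mul_le_mul_of_nonneg_left herr (sq_nonneg ((s : ℝ) + 3))
    nlinarith [mul_nonneg (by positivity : (0 : ℝ) ≤ s + 1) hRR, mul_nonneg hs hRR]
  have h4 := mul_le_mul_of_nonneg_left key (show 0 ≤ lam * (s + 2) / 4 by positivity)
  have h5 := mul_le_mul_of_nonneg_left hmono' (show (0 : ℝ) ≤ (s + 1) * (s + 2) / 2 by positivity)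
  have h6 : ((s : ℝ) + 2) * (s + 3) * ((s + 1) / (s + 3) * Se - lam * Sw) =
      (s + 1) * (s + 2) * Se - (s + 2) * (s + 3) * lam * Sw := by
    field_simp
  rw [h6]
  linarith

/-- The anchored extragradient method for `0 ∈ a + N_S`, started from a point `um` that need not
belong to `S`. -/
structure AnchoredIteration (S : Set H) (a : H → H) (lam : ℝ) (um : H) (u b : ℕ → H) : Prop where
  mem : ∀ s, u s ∈ S
  normal : ∀ s, ∀ q ∈ S, ⟪b s, q - u s⟫_ℝ ≤ 0
  start : u 0 = um - lam • (a um + b 0)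
  next : ∀ s, u (s + 1) = u s + (2 / ((s : ℝ) + 3)) • (u 0 - u s) - lam •
    (a (u s + (2 / ((s : ℝ) + 3)) • (u 0 - u s) - lam • (a (u s) + b s)) + b (s + 1))

variable {S : Set H} {a : H → H} {lam La : ℝ} {um ustar : H} {u b : ℕ → H}

/-- The normal vector `b (s + 1)` occurs both in the new residual and in the step, so their
difference is only the change of `a` from the half-step point to `u (s + 1)`. These points differ by
`lam` times the difference of step direction and old residual, which gives the factor `(lam * La) ^
2` required by `anchored_step`. -/
theorem AnchoredIteration.potential_le (h : AnchoredIteration S a lam um u b) (hlam : 0 < lam)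
    (hlip : ∀ v w, ‖a v - a w‖ ≤ La * ‖v - w‖) (hk : (lam * La) ^ 2 ≤ 1 / 20)
    (hmono : ∀ v ∈ S, ∀ w ∈ S, 0 ≤ ⟪a v - a w, v - w⟫_ℝ) (s : ℕ) :
    lam / 4 * (s + 1) * (s + 2) ^ 2 * ‖a (u s) + b s‖ ^ 2 +
      (s + 1) * (s + 2) * ⟪a (u s) + b s, u s - u 0⟫_ℝ ≤ lam * ‖a (u 0) + b 0‖ ^ 2 := by
  induction s with
  | zero => simp; linarith
  | succ s ih =>
    refine le_trans (le_of_eq ?_) ((anchored_step s hlam (h.next s) ?_ ?_ (S := a (u (s + 1)) +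
      b (s + 1)) (R := a (u s) + b s)).trans ih)
    · push_cast; ring
    · have h1 := hmono _ (h.mem (s + 1)) _ (h.mem s)
      have h2 := h.normal (s + 1) _ (h.mem s)
      have h3 := h.normal s _ (h.mem (s + 1))
      have : a (u (s + 1)) + b (s + 1) - (a (u s) + b s) =
        (a (u (s + 1)) - a (u s)) + b (s + 1) - b s := by abel
      rw [this, inner_sub_left, inner_add_left]
      have h4 : ⟪b (s + 1), u (s + 1) - u s⟫_ℝ = -⟪b (s + 1), u s - u (s + 1)⟫_ℝ := by
        rw [← inner_neg_right, neg_sub]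
      linarith
    · set c := u s + (2 / ((s : ℝ) + 3)) • (u 0 - u s)
      set uh := c - lam • (a (u s) + b s)
      have e1 : u (s + 1) - uh = -(lam • ((a uh + b (s + 1)) - (a (u s) + b s))) := by
        have hn : u (s + 1) = c - lam • (a uh + b (s + 1)) := h.next s
        have hu : uh = c - lam • (a (u s) + b s) := rfl
        generalize a uh + b (s + 1) = w at *
        rw [hn, hu]
        module
      have e2 : a (u (s + 1)) + b (s + 1) - (a uh + b (s + 1)) = a (u (s + 1)) - a uh := by abel
      rw [e2]
      have h1 := hlip (u (s + 1)) uh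
      rw [e1, norm_neg, norm_smul, Real.norm_eq_abs, abs_of_pos hlam] at h1
      calc ‖a (u (s + 1)) - a uh‖ ^ 2
          ≤ (La * (lam * ‖(a uh + b (s + 1)) - (a (u s) + b s)‖)) ^ 2 := by gcongr
        _ = (lam * La) ^ 2 * ‖(a uh + b (s + 1)) - (a (u s) + b s)‖ ^ 2 := by ring
        _ ≤ _ := by gcongr

/-- Monotonicity at the solution replaces `u s - u 0` in the potential by `ustar - u 0`, whose
length is controlled by `d = ‖um - ustar‖`. The scaled residual `r` then satisfies `r² ≤ 5 r d + 36
d²`, that is `(r - 9 d)(r + 4 d) ≤ 0`. -/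
theorem AnchoredIteration.norm_residual_le (h : AnchoredIteration S a lam um u b) (hlam : 0 < lam)
    (hlip : ∀ v w, ‖a v - a w‖ ≤ La * ‖v - w‖) (hk : (lam * La) ^ 2 ≤ 1 / 20)
    (hmono : ∀ v ∈ S, ∀ w ∈ S, 0 ≤ ⟪a v - a w, v - w⟫_ℝ) (hstar : SolvesVI S a ustar) (s : ℕ) :
    lam * ‖a (u s) + b s‖ * (s + 2) ≤ 9 * ‖um - ustar‖ := by
  have hpot := h.potential_le hlam hlip hk hmono s
  have hs : (0 : ℝ) ≤ s := s.cast_nonneg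
  set d := ‖um - ustar‖ with hd
  have hd0 : 0 ≤ d := norm_nonneg _
  have hk' : lam * La ≤ 1 / 4 := by
    by_contra hlt
    push Not at hlt
    nlinarith
  -- distance of the anchor
  have hanchor : ‖u 0 - ustar‖ ≤ 5 / 4 * d := by
    -- `ustar` is a fixed point of the forward-backward map that produces `u 0` from `um`.
    have h1 : ‖u 0 - ustar‖ ≤ ‖(um - lam • a um) - (ustar - lam • a ustar)‖ := by
      apply norm_sub_le_of_inner_le
      · have := h.normal 0 _ hstar.1
        have e : um - lam • a um - u 0 = lam • b 0 := by rw [h.start, smul_add]; abel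
        rw [e, inner_smul_left, conj_trivial]
        exact mul_nonpos_of_nonneg_of_nonpos hlam.le this
      · have := hstar.2 _ (h.mem 0)
        rw [sub_sub_cancel_left, inner_neg_left, inner_smul_left, conj_trivial]
        have := mul_nonneg hlam.le this
        linarith
    have e : (um - lam • a um) - (ustar - lam • a ustar) =
        (um - ustar) - lam • (a um - a ustar) := by rw [smul_sub]; abel
    rw [e] at h1
    have h2 := norm_sub_le (um - ustar) (lam • (a um - a ustar))
    rw [norm_smul, Real.norm_eq_abs, abs_of_pos hlam] at h2
    have h3 := mul_le_mul_of_nonneg_left (hlip um ustar) hlam.le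
    have h4 := mul_le_mul_of_nonneg_right hk' hd0
    rw [← hd] at h2 h3
    linarith
  -- first residual
  have hfirst : lam * ‖a (u 0) + b 0‖ ≤ 3 * d := by
    have e : lam • (a (u 0) + b 0) = (um - u 0) + lam • (a (u 0) - a um) := by
      have := h.start
      have h2 : lam • (a um + b 0) = um - u 0 := by rw [h.start]; abel
      rw [← h2, ← smul_add]
      congr 1
      abel
    have h1 : lam * ‖a (u 0) + b 0‖ = ‖lam • (a (u 0) + b 0)‖ := by
      rw [norm_smul, Real.norm_eq_abs, abs_of_pos hlam]
    rw [h1, e]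
    have h2 := norm_add_le (um - u 0) (lam • (a (u 0) - a um))
    rw [norm_smul, Real.norm_eq_abs, abs_of_pos hlam] at h2
    have h3 := mul_le_mul_of_nonneg_left (hlip (u 0) um) hlam.le
    have h4 : ‖u 0 - um‖ ≤ 9 / 4 * d := by
      have := norm_sub_le_norm_sub_add_norm_sub (u 0) ustar um
      rw [norm_sub_rev ustar um] at this
      linarith
    have h5 := mul_le_mul hk' h4 (norm_nonneg _) (by norm_num)
    rw [norm_sub_rev um] at h2
    linarith
  -- monotonicity at the solution
  have hmon : 0 ≤ ⟪a (u s) + b s, u s - ustar⟫_ℝ := by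
    have h1 := hmono _ (h.mem s) _ hstar.1
    have h2 := hstar.2 _ (h.mem s)
    have h3 := h.normal s _ hstar.1
    rw [← neg_sub (u s), inner_neg_right] at h3
    rw [inner_sub_left] at h1
    rw [inner_add_left]
    linarith
  set ρ := ‖a (u s) + b s‖
  have hρ : 0 ≤ ρ := norm_nonneg _
  have hin : -(ρ * (5 / 4 * d)) ≤ ⟪a (u s) + b s, u s - u 0⟫_ℝ := by
    have e : u s - u 0 = (u s - ustar) - (u 0 - ustar) := by abel
    rw [e, inner_sub_right]
    have := inner_le_of_norm_le (le_refl ρ) hanchor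
    linarith
  set r0 := ‖a (u 0) + b 0‖
  have hr0 : 0 ≤ r0 := norm_nonneg _
  -- the quadratic inequality for the scaled residual
  have hquad : (lam * ρ * (s + 2)) ^ 2 ≤ 5 * (lam * ρ * (s + 2)) * d + 36 * d ^ 2 := by
    have h1 := mul_le_mul_of_nonneg_left hin (show (0 : ℝ) ≤ (s + 1) * (s + 2) by positivity)
    have h2 : (lam * r0) ^ 2 ≤ (3 * d) ^ 2 := by gcongr
    have h3 : lam / 4 * (s + 1) * (s + 2) ^ 2 * ρ ^ 2 ≤
        (s + 1) * (s + 2) * (ρ * (5 / 4 * d)) + lam * r0 ^ 2 := by linarith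
    have h4 := mul_le_mul_of_nonneg_left h3 hlam.le
    have h5 : (s + 1) * (lam * ρ * (s + 2)) ^ 2 ≤
        (s + 1) * (5 * (lam * ρ * (s + 2)) * d + 36 * d ^ 2) := by
      nlinarith [mul_nonneg hs (sq_nonneg d)]
    exact le_of_mul_le_mul_left h5 (by positivity)
  by_contra hlt
  push Not at hlt
  nlinarith [mul_nonneg hd0 (sub_nonneg.2 hlt.le)]

/-- Under strong monotonicity the relative stopping test holds after boundedly many steps. -/
theorem AnchoredIteration.stopping_test (h : AnchoredIteration S a lam um u b) (hlam : 0 < lam)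
    (hlip : ∀ v w, ‖a v - a w‖ ≤ La * ‖v - w‖) (hk : (lam * La) ^ 2 ≤ 1 / 20)
    {γ : ℝ} (hγ : 0 < γ) (hmono : ∀ v ∈ S, ∀ w ∈ S, γ⁻¹ * ‖v - w‖ ^ 2 ≤ ⟪a v - a w, v - w⟫_ℝ)
    (hstar : SolvesVI S a ustar) {s : ℕ} (hs : 18 * (γ / lam) ≤ s + 2) :
    γ * ‖a (u s) + b s‖ ^ 2 ≤ γ⁻¹ * ‖u s - um‖ ^ 2 := by
  have hres := h.norm_residual_le hlam hlip hk
    (fun v hv w hw => (by positivity : 0 ≤ γ⁻¹ * ‖v - w‖ ^ 2).trans (hmono v hv w hw)) hstar s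
  set ρ := ‖a (u s) + b s‖
  have hρ : 0 ≤ ρ := norm_nonneg _
  -- At this `s` the residual is so small that `2 γ ρ` fits into the initial distance. Strong
  -- monotonicity places `u s` within `γ ρ` of `ustar`, so at least `γ ρ` remains between `u s` and
  -- `um`.
  have h1 : 2 * (γ * ρ) ≤ ‖um - ustar‖ := by
    have h2 : 18 * γ ≤ lam * (s + 2) := by
      rw [← mul_div_assoc, div_le_iff₀ hlam] at hs
      linarith
    have := mul_le_mul_of_nonneg_right h2 hρ
    linarith
  have hdist : ‖u s - ustar‖ ≤ γ * ρ := by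
    have h2 := hmono _ (h.mem s) _ hstar.1
    have h3 := h.normal s _ hstar.1
    have h4 := hstar.2 _ (h.mem s)
    have h5 := real_inner_le_norm (a (u s) + b s) (u s - ustar)
    rw [← neg_sub (u s), inner_neg_right] at h3
    rw [inner_sub_left] at h2
    rw [inner_add_left] at h5
    have h6 : γ⁻¹ * ‖u s - ustar‖ ^ 2 ≤ ρ * ‖u s - ustar‖ := by linarith
    rcases (norm_nonneg (u s - ustar)).eq_or_lt with h0 | h0
    · rw [← h0]; positivity
    · have h7 : γ⁻¹ * ‖u s - ustar‖ ≤ ρ := by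
        refine le_of_mul_le_mul_right ?_ h0
        linarith
      rw [inv_mul_le_iff₀ hγ] at h7
      exact h7
  have h3 : γ * ρ ≤ ‖u s - um‖ := by
    have := norm_sub_le_norm_sub_add_norm_sub um (u s) ustar
    rw [norm_sub_rev um (u s)] at this
    linarith
  calc γ * ρ ^ 2 = γ⁻¹ * (γ * ρ) ^ 2 := by field_simp
    _ ≤ γ⁻¹ * ‖u s - um‖ ^ 2 := by gcongr

/-- A strongly monotone Lipschitz variational inequality on a closed convex set is solvable. -/
theorem exists_solvesVI [CompleteSpace H] (hS : IsClosed S) (hne : S.Nonempty) {Pi : H → H}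
    (hPi : IsProjection S Pi) {m L : ℝ} (hm : 0 < m)
    (hlip : ∀ v ∈ S, ∀ w ∈ S, ‖a v - a w‖ ≤ L * ‖v - w‖)
    (hmono : ∀ v ∈ S, ∀ w ∈ S, m * ‖v - w‖ ^ 2 ≤ ⟪a v - a w, v - w⟫_ℝ) :
    ∃ u, SolvesVI S a u := by
  -- Adding `m` makes `M` positive and at least `m` for every `L`. With `τ = m / M²` the projected
  -- forward step contracts squared distances by `1 - 2 τ m + τ² M² = 1 - m² / M²`.
  set M := |L| + m
  have hM : 0 < M := by positivity
  set τ := m / M ^ 2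
  have hτ : 0 < τ := by positivity
  have hmM : m ≤ M := by simp [M]
  set q2 := 1 - m ^ 2 / M ^ 2
  have hq2 : 0 ≤ q2 := by
    have : m ^ 2 / M ^ 2 ≤ 1 := by
      rw [div_le_one (by positivity)]
      gcongr
    simp only [q2]; linarith
  have hq1 : q2 < 1 := by
    have : 0 < m ^ 2 / M ^ 2 := by positivity
    simp only [q2]; linarith
  have hcontr : ∀ v ∈ S, ∀ w ∈ S, ‖Pi (v - τ • a v) - Pi (w - τ • a w)‖ ≤ √q2 * ‖v - w‖ := by
    intro v hv w hw
    refine (hPi.norm_sub_le _ _).trans ?_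
    have e : v - τ • a v - (w - τ • a w) = (v - w) - τ • (a v - a w) := by rw [smul_sub]; abel
    rw [e, ← Real.sqrt_sq (norm_nonneg (v - w)), ← Real.sqrt_mul hq2]
    apply Real.le_sqrt_of_sq_le
    rw [norm_sub_sq_real, norm_smul, inner_smul_right, Real.norm_eq_abs, abs_of_pos hτ,
      real_inner_comm]
    have h1 : ‖a v - a w‖ ≤ M * ‖v - w‖ := (hlip v hv w hw).trans (by
      gcongr; exact (le_abs_self L).trans (by simp [M, hm.le]))
    have h2 : (τ * ‖a v - a w‖) ^ 2 ≤ (τ * (M * ‖v - w‖)) ^ 2 := by gcongr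
    have h3 := mul_le_mul_of_nonneg_left (hmono v hv w hw) hτ.le
    have e1 : (τ * (M * ‖v - w‖)) ^ 2 = m ^ 2 / M ^ 2 * ‖v - w‖ ^ 2 := by
      simp only [τ]; field_simp
    have e2 : τ * (m * ‖v - w‖ ^ 2) = m ^ 2 / M ^ 2 * ‖v - w‖ ^ 2 := by
      simp only [τ]; field_simp
    simp only [q2]
    linarith
  let T : S → S := fun v => ⟨Pi (v.1 - τ • a v.1), hPi.mem _⟩
  have : CompleteSpace S := hS.completeSpace_coe
  have : Nonempty S := hne.to_subtype
  let k : NNReal := ⟨√q2, Real.sqrt_nonneg _⟩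
  have hT : ContractingWith k T := by
    constructor
    · have hk : (k : ℝ) < 1 := (Real.sqrt_lt' one_pos).2 (by simpa using hq1)
      exact_mod_cast hk
    · refine LipschitzWith.of_dist_le_mul fun v w => ?_
      rw [Subtype.dist_eq, Subtype.dist_eq, dist_eq_norm, dist_eq_norm]
      exact hcontr v.1 v.2 w.1 w.2
  have hfix := hT.fixedPoint_isFixedPt
  set p := ContractingWith.fixedPoint T hT
  refine ⟨p.1, p.2, fun q hq => ?_⟩
  have hp : Pi (p.1 - τ • a p.1) = p.1 := congrArg Subtype.val hfix
  have h := hPi.inner_le (p.1 - τ • a p.1) q hq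
  rw [hp, sub_sub_cancel_left, inner_neg_left, inner_smul_left, conj_trivial] at h
  by_contra hneg
  push Not at hneg
  nlinarith

end Hilbert

/-! ### Projections and the Euclidean product of the two variables. -/

section Proj

variable {n d : ℕ}

theorem isProjection_proj {S : Set (E n)} (hc : IsClosed S) (hconv : Convex ℝ S)
    (hne : S.Nonempty) : IsProjection S (proj S) := by
  have key : ∀ v, proj S v ∈ S ∧ ∀ q ∈ S, ‖v - proj S v‖ ≤ ‖v - q‖ := by
    intro v
    obtain ⟨p, hp, hpe⟩ := exists_norm_eq_iInf_of_complete_convex hne hc.isComplete hconv v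
    refine Classical.epsilon_spec (p := fun p => p ∈ S ∧ ∀ q ∈ S, ‖v - p‖ ≤ ‖v - q‖)
      ⟨p, hp, fun q hq => ?_⟩
    rw [hpe]
    exact ciInf_le ⟨0, Set.forall_mem_range.2 fun _ => norm_nonneg _⟩ (⟨q, hq⟩ : S)
  refine ⟨fun v => (key v).1, fun v => ?_⟩
  rw [← norm_eq_iInf_iff_real_inner_le_zero hconv (key v).1]
  have : Nonempty S := hne.to_subtype
  exact le_antisymm (le_ciInf fun q => (key v).2 q.1 q.2)
    (ciInf_le ⟨0, Set.forall_mem_range.2 fun _ => norm_nonneg _⟩ (⟨proj S v, (key v).1⟩ : S))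

theorem IsProjection.eq_self {S : Set (E n)} {Pi : E n → E n} (h : IsProjection S Pi) {v : E n}
    (hv : v ∈ S) : Pi v = v := by
  have := h.inner_le v v hv
  rw [real_inner_self_eq_norm_sq] at this
  have : ‖v - Pi v‖ = 0 := by
    have h0 := norm_nonneg (v - Pi v)
    nlinarith
  rw [norm_sub_eq_zero_iff] at this
  exact this.symm

/-- The Euclidean product of the spaces of the two variables. -/
abbrev Pair (n d : ℕ) := WithLp 2 (E n × E d)

/-- The pair `(x, y)` in the Euclidean product. -/
def pair (x : E n) (y : E d) : Pair n d := WithLp.toLp 2 (x, y)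

@[simp] theorem pair_fst (x : E n) (y : E d) : (pair x y).fst = x := rfl

@[simp] theorem pair_snd (x : E n) (y : E d) : (pair x y).snd = y := rfl

theorem norm_sq_pair (u : Pair n d) : ‖u‖ ^ 2 = ‖u.fst‖ ^ 2 + ‖u.snd‖ ^ 2 :=
  WithLp.prod_norm_sq_eq_of_L2 u

theorem inner_pair (u v : Pair n d) : ⟪u, v⟫_ℝ = ⟪u.fst, v.fst⟫_ℝ + ⟪u.snd, v.snd⟫_ℝ :=
  WithLp.prod_inner_apply u v

theorem pair_ext {u v : Pair n d} (h₁ : u.fst = v.fst) (h₂ : u.snd = v.snd) : u = v := by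
  apply WithLp.ofLp_injective
  exact Prod.ext h₁ h₂

/-- The product of two sets inside the Euclidean product. -/
def pairSet (X : Set (E n)) (Y : Set (E d)) : Set (Pair n d) := {u | u.fst ∈ X ∧ u.snd ∈ Y}

theorem isProjection_pair {X : Set (E n)} {Y : Set (E d)} {PX : E n → E n} {PY : E d → E d}
    (hX : IsProjection X PX) (hY : IsProjection Y PY) :
    IsProjection (pairSet X Y) fun u => pair (PX u.fst) (PY u.snd) := by
  refine ⟨fun v => ⟨hX.mem _, hY.mem _⟩, fun v q hq => ?_⟩
  rw [inner_pair]
  have h1 := hX.inner_le v.fst _ hq.1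
  have h2 := hY.inner_le v.snd _ hq.2
  simp only [WithLp.sub_fst, WithLp.sub_snd, pair_fst, pair_snd]
  linarith

theorem isClosed_pairSet {X : Set (E n)} {Y : Set (E d)} (hX : IsClosed X) (hY : IsClosed Y) :
    IsClosed (pairSet X Y) :=
  (hX.preimage (WithLp.continuous_fst 2 _ _)).inter (hY.preimage (WithLp.continuous_snd 2 _ _))

end Proj

/-! ### FOAM: the inner operator, termination of the inner loop, and the one-step inequalities. -/

section Foam

variable {n d : ℕ}

theorem firstIndex_of_exists {p : ℕ → Prop} {k : ℕ} (hk : p k) :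
    ∃ N : ℕ, firstIndex p = (N : ℕ∞) ∧ p N ∧ N ≤ k := by
  classical
  have h : ∃ k, p k := ⟨k, hk⟩
  refine ⟨Nat.find h, ?_, Nat.find_spec h, Nat.find_min' h hk⟩
  rw [firstIndex, dif_pos h]

/-- The regularity of the input of FOAM: `φ` is the convex-concave function `h` without its
quadratic parts, and the inner operator is Lipschitz on the whole space. -/
structure FoamRegular (A : Foam n d) (φ : E n → E d → ℝ) : Prop where
  closed_X : IsClosed A.X
  convex_X : Convex ℝ A.X
  nonempty_X : A.X.Nonempty
  closed_Y : IsClosed A.Y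
  convex_Y : Convex ℝ A.Y
  nonempty_Y : A.Y.Nonempty
  muX_pos : 0 < A.muX
  muY_pos : 0 < A.muY
  L_nonneg : 0 ≤ A.L
  le_X : ∀ x ∈ A.X, ∀ x' ∈ A.X, ∀ y ∈ A.Y, φ x y + ⟪A.hatX x y, x' - x⟫_ℝ ≤ φ x' y
  le_Y : ∀ x ∈ A.X, ∀ y ∈ A.Y, ∀ y' ∈ A.Y, φ x y' ≤ φ x y + ⟪A.hatY x y, y' - y⟫_ℝ
  lip : ∀ x x' y y', ‖A.aX 0 x y - A.aX 0 x' y'‖ ^ 2 + ‖A.aY 0 x y - A.aY 0 x' y'‖ ^ 2 ≤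
    (A.L + A.muX / 8) ^ 2 * (‖x - x'‖ ^ 2 + ‖y - y'‖ ^ 2)

variable {A : Foam n d} {φ : E n → E d → ℝ}

/-- The operator of the inner inclusion on the Euclidean product. -/
noncomputable def foamOp (A : Foam n d) (zg : E n) (yg : E d) (u : Pair n d) : Pair n d :=
  pair (A.aX zg u.fst u.snd) (A.aY yg u.fst u.snd)

theorem foam_aX_sub (zg : E n) (x x' : E n) (y y' : E d) :
    A.aX zg x y - A.aX zg x' y' = A.hatX x y - A.hatX x' y' + (A.muX / 2) • (x - x') := by
  simp only [Foam.aX]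
  module

theorem foam_aY_sub (yg : E d) (x x' : E n) (y y' : E d) :
    A.aY yg x y - A.aY yg x' y' =
      -(A.hatY x y - A.hatY x' y') + (A.muY + A.muX / 8) • (y - y') := by
  simp only [Foam.aY]
  module

theorem FoamRegular.norm_op_sub_le (hA : FoamRegular A φ) (zg : E n) (yg : E d)
    (u v : Pair n d) :
    ‖foamOp A zg yg u - foamOp A zg yg v‖ ≤ (A.L + A.muX / 8) * ‖u - v‖ := by
  have h := hA.lip u.fst v.fst u.snd v.snd
  have hpos : 0 ≤ A.L + A.muX / 8 := by
    have := hA.L_nonneg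
    have := hA.muX_pos
    positivity
  refine le_of_sq_le_sq ?_ (by positivity)
  rw [mul_pow, norm_sq_pair, norm_sq_pair]
  simpa only [foamOp, WithLp.sub_fst, WithLp.sub_snd, pair_fst, pair_snd, foam_aX_sub,
    foam_aY_sub] using h

/-- Adding the four convexity and concavity inequalities on the corners of the rectangle spanned by
the two points cancels all values of `φ`. -/
theorem FoamRegular.hat_monotone (hA : FoamRegular A φ) {x x' : E n} {y y' : E d} (hx : x ∈ A.X)
    (hx' : x' ∈ A.X) (hy : y ∈ A.Y) (hy' : y' ∈ A.Y) :
    0 ≤ ⟪A.hatX x y - A.hatX x' y', x - x'⟫_ℝ + ⟪-(A.hatY x y - A.hatY x' y'), y - y'⟫_ℝ := by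
  have h1 := hA.le_X x hx x' hx' y hy
  have h2 := hA.le_X x' hx' x hx y' hy'
  have h3 := hA.le_Y x hx y hy y' hy'
  have h4 := hA.le_Y x' hx' y' hy' y hy
  rw [← neg_sub x x', inner_neg_right] at h1
  rw [← neg_sub y y', inner_neg_right] at h3
  rw [inner_sub_left, inner_neg_left, inner_sub_left]
  linarith

/-- Beyond the monotone part, the quadratic terms contribute `muX / 2` in `x` and `muY + muX / 8` in
`y`; both are at least `muX / 8 = γ⁻¹`. -/
theorem FoamRegular.op_strongly_monotone (hA : FoamRegular A φ) (zg : E n) (yg : E d)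
    {u v : Pair n d} (hu : u ∈ pairSet A.X A.Y) (hv : v ∈ pairSet A.X A.Y) :
    A.gamma⁻¹ * ‖u - v‖ ^ 2 ≤ ⟪foamOp A zg yg u - foamOp A zg yg v, u - v⟫_ℝ := by
  have h := hA.hat_monotone hu.1 hv.1 hu.2 hv.2
  have h1 := hA.muX_pos
  have h2 := hA.muY_pos
  rw [inner_pair, norm_sq_pair]
  simp only [foamOp, WithLp.sub_fst, WithLp.sub_snd, pair_fst, pair_snd, foam_aX_sub, foam_aY_sub,
    inner_add_left, inner_smul_left, conj_trivial, real_inner_self_eq_norm_sq, Foam.gamma, inv_div]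
  nlinarith [mul_nonneg h1.le (sq_nonneg ‖u.fst - v.fst‖),
    mul_nonneg h2.le (sq_nonneg ‖u.snd - v.snd‖)]

theorem FoamRegular.innerStepSize_pos (hA : FoamRegular A φ) : 0 < A.innerStepSize := by
  have := hA.L_nonneg
  have := hA.muX_pos
  simp only [Foam.innerStepSize, Foam.gamma]
  positivity

/-- `L + muX / 8` is the Lipschitz modulus of the inner operator, so the step size is the largest
one admitted by `AnchoredIteration.potential_le`. -/
theorem FoamRegular.innerStepSize_mul_sq (hA : FoamRegular A φ) :
    (A.innerStepSize * (A.L + A.muX / 8)) ^ 2 = 1 / 20 := by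
  have h1 := hA.L_nonneg
  have h2 := hA.muX_pos
  have h3 : A.innerStepSize * (A.L + A.muX / 8) = 1 / (2 * √5) := by
    simp only [Foam.innerStepSize, Foam.gamma]
    have : (0 : ℝ) < 1 + 8 * A.L / A.muX := by positivity
    field_simp
    ring
  rw [h3, div_pow, mul_pow, Real.sq_sqrt (by norm_num)]
  norm_num

theorem FoamRegular.gamma_div_innerStepSize (hA : FoamRegular A φ) :
    A.gamma / A.innerStepSize = 2 * √5 * (1 + 8 * A.L / A.muX) := by
  have h1 := hA.L_nonneg
  have h2 := hA.muX_pos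
  have : (0 : ℝ) < 1 + 8 * A.L / A.muX := by positivity
  simp only [Foam.innerStepSize, Foam.gamma]
  field_simp

theorem FoamRegular.projX (hA : FoamRegular A φ) : IsProjection A.X (proj A.X) :=
  isProjection_proj hA.closed_X hA.convex_X hA.nonempty_X

theorem FoamRegular.projY (hA : FoamRegular A φ) : IsProjection A.Y (proj A.Y) :=
  isProjection_proj hA.closed_Y hA.convex_Y hA.nonempty_Y

theorem foam_inner_eq_backward (A : Foam n d) (zg : E n) (yg : E d) (s : ℕ) :
    ∃ vX vY, A.inner zg yg s = A.backward vX vY := by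
  cases s <;> exact ⟨_, _, rfl⟩

/-- A projection from `v` to `u` with `b = λ⁻¹ (v - u)` is the implicit step `u = v - λ b`. The
starting and half-step points may be infeasible, which is why the operator must be Lipschitz on the
whole space although it is monotone only on the feasible set. -/
theorem FoamRegular.anchored (hA : FoamRegular A φ) (zg : E n) (yg : E d) :
    AnchoredIteration (pairSet A.X A.Y) (foamOp A zg yg) A.innerStepSize
      (pair (-(A.muX⁻¹ • zg)) yg)
      (fun s => pair (A.inner zg yg s).x (A.inner zg yg s).y)
      (fun s => pair (A.inner zg yg s).bX (A.inner zg yg s).bY) := by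
  have hl := hA.innerStepSize_pos
  have back : ∀ {k : ℕ} (p v : E k), p = v - A.innerStepSize • A.innerStepSize⁻¹ • (v - p) := by
    intro k p v
    rw [smul_inv_smul₀ hl.ne']
    abel
  refine ⟨fun s => ?_, fun s q hq => ?_, ?_, fun s => ?_⟩
  · obtain ⟨vX, vY, h⟩ := foam_inner_eq_backward A zg yg s
    rw [h]
    exact ⟨hA.projX.mem _, hA.projY.mem _⟩
  · obtain ⟨vX, vY, h⟩ := foam_inner_eq_backward A zg yg s
    rw [h, inner_pair]
    have h1 := mul_nonpos_of_nonneg_of_nonpos (inv_pos.2 hl).le (hA.projX.inner_le vX _ hq.1)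
    have h2 := mul_nonpos_of_nonneg_of_nonpos (inv_pos.2 hl).le (hA.projY.inner_le vY _ hq.2)
    simp only [Foam.backward, pair_fst, pair_snd, WithLp.sub_fst, WithLp.sub_snd, inner_smul_left,
      conj_trivial]
    linarith
  · apply pair_ext
    · simp only [foamOp, pair_fst, pair_snd, WithLp.sub_fst, WithLp.smul_fst, WithLp.add_fst,
        smul_add, Foam.inner, Foam.innerStart, Foam.backward]
      rw [← sub_sub]
      exact back _ _
    · simp only [foamOp, pair_fst, pair_snd, WithLp.sub_snd, WithLp.smul_snd, WithLp.add_snd,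
        smul_add, Foam.inner, Foam.innerStart, Foam.backward]
      rw [← sub_sub]
      exact back _ _
  · apply pair_ext
    · simp only [foamOp, pair_fst, pair_snd, WithLp.sub_fst, WithLp.smul_fst, WithLp.add_fst,
        WithLp.sub_snd, WithLp.smul_snd, WithLp.add_snd]
      rw [smul_add A.innerStepSize (A.aX _ _ _) (A.inner zg yg (s + 1)).bX, ← sub_sub]
      exact back _ _
    · simp only [foamOp, pair_fst, pair_snd, WithLp.sub_fst, WithLp.smul_fst, WithLp.add_fst,
        WithLp.sub_snd, WithLp.smul_snd, WithLp.add_snd]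
      rw [smul_add A.innerStepSize (A.aY _ _ _) (A.inner zg yg (s + 1)).bY, ← sub_sub]
      exact back _ _

/-- The bound is `18 γ / λ` from `AnchoredIteration.stopping_test`; it is independent of `zg` and
`yg`. -/
theorem FoamRegular.exists_innerCount (hA : FoamRegular A φ) (zg : E n) (yg : E d) :
    ∃ N : ℕ, A.innerCount zg yg = (N : ℕ∞) ∧ A.InnerStop zg yg N ∧
      N ≤ ⌈18 * (2 * √5 * (1 + 8 * A.L / A.muX))⌉₊ := by
  have hg : 0 < A.gamma := by
    have := hA.muX_pos
    simp only [Foam.gamma]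
    positivity
  obtain ⟨ustar, hstar⟩ := exists_solvesVI (a := foamOp A zg yg)
    (isClosed_pairSet hA.closed_X hA.closed_Y)
    (⟨pair hA.nonempty_X.some hA.nonempty_Y.some, hA.nonempty_X.some_mem,
      hA.nonempty_Y.some_mem⟩ : (pairSet A.X A.Y).Nonempty)
    (isProjection_pair hA.projX hA.projY) (inv_pos.2 hg)
    (fun v _ w _ => hA.norm_op_sub_le zg yg v w)
    (fun v hv w hw => hA.op_strongly_monotone zg yg hv hw)
  refine firstIndex_of_exists ?_
  have h := (hA.anchored zg yg).stopping_test hA.innerStepSize_pos (hA.norm_op_sub_le zg yg)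
    hA.innerStepSize_mul_sq.le hg (fun v hv w hw => hA.op_strongly_monotone zg yg hv hw) hstar
    (s := ⌈18 * (2 * √5 * (1 + 8 * A.L / A.muX))⌉₊) (by
      rw [hA.gamma_div_innerStepSize]
      linarith [Nat.le_ceil (18 * (2 * √5 * (1 + 8 * A.L / A.muX)))])
  rw [norm_sq_pair, norm_sq_pair] at h
  exact h

/-! ### The outer loop -/

/-- `z` and `w` are subgradients in `x` and `y` of the constrained convex-concave function. -/
structure FoamGraph (A : Foam n d) (x z : E n) (y w : E d) : Prop where
  mem_X : x ∈ A.X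
  mem_Y : y ∈ A.Y
  normal_X : ∀ x' ∈ A.X, ⟪z - A.hatX x y, x' - x⟫_ℝ ≤ 0
  normal_Y : ∀ y' ∈ A.Y, ⟪w + A.hatY x y, y' - y⟫_ℝ ≤ 0

/-- The value of the strongly convex dual function that the outer loop of FOAM minimizes. -/
noncomputable def foamPot (A : Foam n d) (φ : E n → E d → ℝ) (x z : E n) (y : E d) : ℝ :=
  ⟪x, z⟫_ℝ - φ x y + ‖z‖ ^ 2 / (2 * A.muX) + A.muY / 2 * ‖y‖ ^ 2

theorem half_norm_sq_expand {V : Type*} [NormedAddCommGroup V] [InnerProductSpace ℝ V] (μ : ℝ)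
    (p q : V) :
    μ / 2 * ‖q‖ ^ 2 = μ / 2 * ‖p‖ ^ 2 + μ * ⟪p, q - p⟫_ℝ + μ / 2 * ‖q - p‖ ^ 2 := by
  rw [norm_sub_sq_real, inner_sub_right, real_inner_self_eq_norm_sq, real_inner_comm]
  ring

/-- As `z` is a subgradient in `x`, the term `⟪x, z⟫ - φ x y` is the value at `z` of the convex
conjugate of `φ(·, y)` restricted to `X`. This conjugate is jointly convex in `(z, y)` with
subgradient `(x, w)`, and the quadratic terms make the sum strongly convex with subgradient `(x +
muX⁻¹ z, w + muY y)`. -/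
theorem FoamRegular.foamPot_ge (hA : FoamRegular A φ) {x₁ z₁ x₂ z₂ : E n} {y₁ w₁ y₂ w₂ : E d}
    (h₁ : FoamGraph A x₁ z₁ y₁ w₁) (h₂ : FoamGraph A x₂ z₂ y₂ w₂) :
    foamPot A φ x₁ z₁ y₁ + ⟪x₁ + A.muX⁻¹ • z₁, z₂ - z₁⟫_ℝ + ⟪w₁ + A.muY • y₁, y₂ - y₁⟫_ℝ +
      A.muX⁻¹ / 2 * ‖z₂ - z₁‖ ^ 2 + A.muY / 2 * ‖y₂ - y₁‖ ^ 2 ≤ foamPot A φ x₂ z₂ y₂ := by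
  have e1 := half_norm_sq_expand A.muX⁻¹ z₁ z₂
  have e2 := half_norm_sq_expand A.muY y₁ y₂
  have c1 := hA.le_X _ h₂.mem_X _ h₁.mem_X _ h₂.mem_Y
  have c2 := hA.le_Y _ h₁.mem_X _ h₁.mem_Y _ h₂.mem_Y
  have c3 := h₂.normal_X _ h₁.mem_X
  have c4 := h₁.normal_Y _ h₂.mem_Y
  have h2 := hA.muX_pos
  have e3 : ∀ z : E n, ‖z‖ ^ 2 / (2 * A.muX) = A.muX⁻¹ / 2 * ‖z‖ ^ 2 := by
    intro z; field_simp
  simp only [foamPot, e3, e1, e2, inner_add_left, inner_sub_left, inner_smul_left, conj_trivial] at *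
  have e4 : ⟪z₂, x₁ - x₂⟫_ℝ = ⟪x₁, z₂⟫_ℝ - ⟪x₂, z₂⟫_ℝ := by
    rw [inner_sub_right, real_inner_comm x₁, real_inner_comm x₂]
  have e5 : ⟪x₁, z₂ - z₁⟫_ℝ = ⟪x₁, z₂⟫_ℝ - ⟪x₁, z₁⟫_ℝ := inner_sub_right _ _ _
  linarith

/-- The step of a Nesterov-type method in one block of variables. -/
theorem accelerated_step {V : Type*} [NormedAddCommGroup V] [InnerProductSpace ℝ V] {η μ : ℝ}
    (hη : 0 < η) (hμ : 0 ≤ μ) (hημ : η * μ ≤ 1 / 2) {ζ ζ' ζf ζs g : V}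
    (h : ζ' = ζ + (η * μ) • (ζf - ζ) - η • g) :
    η⁻¹ * ‖ζ' - ζs‖ ^ 2 ≤ (η⁻¹ - μ) * ‖ζ - ζs‖ ^ 2 + μ * ‖ζf - ζs‖ ^ 2 - 2 * ⟪g, ζ - ζs⟫_ℝ +
      2 * η * ‖g‖ ^ 2 := by
  obtain ⟨e, rfl⟩ : ∃ e, ζ = ζs + e := ⟨ζ - ζs, by abel⟩
  obtain ⟨v, rfl⟩ : ∃ v, ζf = ζs + e + v := ⟨ζf - (ζs + e), by abel⟩
  have e1 : ζ' - ζs = e + (η * μ) • v - η • g := by rw [h]; module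
  have e2 : ζs + e + v - ζs = e + v := by abel
  -- The right side minus the left side of the claim is exactly the sum of this quantity and the
  -- next one.
  have hsq : 0 ≤ η * ‖μ • v + g‖ ^ 2 := by positivity
  have hsq2 : 0 ≤ μ * (1 - 2 * (η * μ)) * ‖v‖ ^ 2 := by
    have : 0 ≤ 1 - 2 * (η * μ) := by linarith
    positivity
  rw [e1, e2]
  simp only [add_sub_cancel_left]
  simp only [← real_inner_self_eq_norm_sq, inner_sub_left, inner_sub_right, inner_smul_left,
    inner_smul_right, inner_add_left, inner_add_right, conj_trivial] at *
  have hge : ⟪g, e⟫_ℝ = ⟪e, g⟫_ℝ := real_inner_comm _ _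
  have hgv : ⟪g, v⟫_ℝ = ⟪v, g⟫_ℝ := real_inner_comm _ _
  have hve : ⟪v, e⟫_ℝ = ⟪e, v⟫_ℝ := real_inner_comm _ _
  have hinv : η⁻¹ * η = 1 := inv_mul_cancel₀ hη.ne'
  refine sub_nonneg.1 (le_of_le_of_eq (add_nonneg hsq hsq2) ?_)
  simp only [hge, hgv, hve]
  linear_combination (-2 * μ * ⟪e, v⟫_ℝ + 2 * ⟪e, g⟫_ℝ - (η * μ ^ 2 * ⟪v, v⟫_ℝ -
    2 * η * μ * ⟪v, g⟫_ℝ + η * ⟪g, g⟫_ℝ)) * (-hinv)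

end Foam

/-! ### Contraction of the Lyapunov function in an outer FOAM iteration. -/

section FoamOuter

variable {n d : ℕ} {A : Foam n d} {φ : E n → E d → ℝ}

/-- `H` is the inner stopping test with `D = z_f - z_g`, `e = y_f - y_g` and `(g, h)` the gradient
of the dual function at `(z_f, y_f)`. The `y` terms expand exactly; in the `x` terms a multiple of
`‖D + (3/5) μ g‖²` is dropped. The outer step consumes only `μ ‖g‖²` of the `6/5`, and the surplus
`μ ‖g‖² / 5` is later needed to control `x_f`. -/
theorem relative_error_test {V W : Type*} [NormedAddCommGroup V] [InnerProductSpace ℝ V]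
    [NormedAddCommGroup W] [InnerProductSpace ℝ W] {μ : ℝ} (hμ : 0 < μ) {D g : V} {e h : W}
    (H : 8 / μ * (‖(1 / 2 : ℝ) • D + (μ / 2) • g‖ ^ 2 + ‖h + (μ / 8) • e‖ ^ 2) ≤
      μ / 8 * (‖g - μ⁻¹ • D‖ ^ 2 + ‖e‖ ^ 2)) :
    2 * ⟪g, D⟫_ℝ + 2 * ⟪h, e⟫_ℝ + 6 / 5 * (μ * ‖g‖ ^ 2) + 8 / μ * ‖h‖ ^ 2 ≤ 0 := by
  have hsq : 0 ≤ 15 / 8 * μ⁻¹ * ‖D + (3 / 5 * μ) • g‖ ^ 2 := by positivity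
  simp only [← real_inner_self_eq_norm_sq, inner_sub_left, inner_sub_right, inner_smul_left,
    inner_smul_right, inner_add_left, inner_add_right, conj_trivial] at *
  have c1 : ⟪D, g⟫_ℝ = ⟪g, D⟫_ℝ := real_inner_comm _ _
  have c2 : ⟪e, h⟫_ℝ = ⟪h, e⟫_ℝ := real_inner_comm _ _
  refine le_of_eq_of_le ?_ (add_nonpos (sub_nonpos.2 H) (neg_nonpos.2 hsq))
  simp only [c1, c2]
  field_simp
  ring

/-- The inner loop terminates, so `innerCount` converted by `toNat` is an index at which the test
really holds. These relations are all that the analysis of the outer loop uses. -/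
theorem FoamRegular.outerNext_spec (hA : FoamRegular A φ) (s : Foam.Outer n d) :
    ∃ w, FoamGraph A (A.outerNext s).xf (A.outerNext s).zf (A.outerNext s).yf w ∧
      (A.outerNext s).z = s.z + (A.etaZ * A.muX⁻¹) • ((A.outerNext s).zf - s.z) -
        A.etaZ • ((A.outerNext s).xf + A.muX⁻¹ • (A.outerNext s).zf) ∧
      (A.outerNext s).y = s.y + (A.etaY * A.muY) • ((A.outerNext s).yf - s.y) -
        A.etaY • (w + A.muY • (A.outerNext s).yf) ∧
      2 * ⟪(A.outerNext s).xf + A.muX⁻¹ • (A.outerNext s).zf, (A.outerNext s).zf - A.zg s⟫_ℝ +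
        2 * ⟪w + A.muY • (A.outerNext s).yf, (A.outerNext s).yf - A.yg s⟫_ℝ +
        6 / 5 * (A.muX * ‖(A.outerNext s).xf + A.muX⁻¹ • (A.outerNext s).zf‖ ^ 2) +
        8 / A.muX * ‖w + A.muY • (A.outerNext s).yf‖ ^ 2 ≤ 0 := by
  obtain ⟨N, hN, htol, -⟩ := hA.exists_innerCount (A.zg s) (A.yg s)
  have hanch := hA.anchored (A.zg s) (A.yg s)
  have hμ := hA.muX_pos
  set i := A.inner (A.zg s) (A.yg s) N with hi
  have hxf : (A.outerNext s).xf = i.x := by simp [Foam.outerNext, hN, hi]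
  have hyf : (A.outerNext s).yf = i.y := by simp [Foam.outerNext, hN, hi]
  have hzf : (A.outerNext s).zf = A.hatX i.x i.y + i.bX := by simp [Foam.outerNext, hN, hi]
  have hmem := hanch.mem N
  have hnorm := hanch.normal N
  refine ⟨-A.hatY i.x i.y + i.bY, ⟨hxf ▸ hmem.1, hyf ▸ hmem.2, fun x' hx' => ?_,
    fun y' hy' => ?_⟩, rfl, ?_, ?_⟩
  · have := hnorm (pair x' i.y) ⟨hx', hmem.2⟩
    rw [inner_pair] at this
    simp only [pair_fst, pair_snd, WithLp.sub_fst, WithLp.sub_snd, ← hi, sub_self,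
      inner_zero_right, add_zero] at this
    rwa [hzf, hxf, hyf, add_sub_cancel_left]
  · have := hnorm (pair i.x y') ⟨hmem.1, hy'⟩
    rw [inner_pair] at this
    simp only [pair_fst, pair_snd, WithLp.sub_fst, WithLp.sub_snd, ← hi, sub_self,
      inner_zero_right, zero_add] at this
    rwa [hxf, hyf, neg_add_eq_sub, sub_add_cancel]
  · simp [Foam.outerNext, hN, ← hi]
  · rw [hxf, hyf, hzf]
    apply relative_error_test hμ
    have e1 : (1 / 2 : ℝ) • (A.hatX i.x i.y + i.bX - A.zg s) +
        (A.muX / 2) • (i.x + A.muX⁻¹ • (A.hatX i.x i.y + i.bX)) =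
        A.aX (A.zg s) i.x i.y + i.bX := by
      simp only [Foam.aX, smul_add, smul_sub, smul_smul]
      rw [show A.muX / 2 * A.muX⁻¹ = 1 / 2 by field_simp]
      module
    have e2 : -A.hatY i.x i.y + i.bY + A.muY • i.y + (A.muX / 8) • (i.y - A.yg s) =
        A.aY (A.yg s) i.x i.y + i.bY := by
      simp only [Foam.aY]
      abel
    have e3 : i.x + A.muX⁻¹ • (A.hatX i.x i.y + i.bX) -
        A.muX⁻¹ • (A.hatX i.x i.y + i.bX - A.zg s) = i.x - -(A.muX⁻¹ • A.zg s) := by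
      module
    rw [e1, e2, e3]
    simpa only [Foam.InnerStop, ← hi, Foam.gamma, inv_div] using htol

theorem FoamRegular.alpha_pos (hA : FoamRegular A φ) : 0 < A.alpha := by
  have := hA.muX_pos
  have := hA.muY_pos
  simp only [Foam.alpha]
  positivity

theorem foam_alpha_le_one (A : Foam n d) : A.alpha ≤ 1 := min_le_left _ _

theorem FoamRegular.alpha_sq_le (hA : FoamRegular A φ) : A.alpha ^ 2 ≤ 8 * A.muY / A.muX := by
  have h1 := hA.muX_pos
  have h2 := hA.muY_pos
  have h : A.alpha ≤ √(8 * A.muY / A.muX) := min_le_right _ _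
  calc A.alpha ^ 2 ≤ √(8 * A.muY / A.muX) ^ 2 := by
        have := hA.alpha_pos
        gcongr
    _ = _ := Real.sq_sqrt (by positivity)

theorem FoamRegular.etaY_pos (hA : FoamRegular A φ) : 0 < A.etaY := by
  have := hA.muX_pos
  have := hA.muY_pos
  have := hA.alpha_pos
  simp only [Foam.etaY]
  positivity

theorem FoamRegular.etaY_mul_le (hA : FoamRegular A φ) : A.etaY * A.muY ≤ 1 / 2 := by
  have h2 := hA.muY_pos
  calc A.etaY * A.muY ≤ 1 / (2 * A.muY) * A.muY := by
        gcongr; exact min_le_left _ _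
    _ = 1 / 2 := by field_simp

/-- The two entries of the minimum in `etaY` need `α ≤ 1` and `α² ≤ 8 muY / muX` respectively; this
is what the choice of `α` provides. -/
theorem FoamRegular.le_etaY_mul (hA : FoamRegular A φ) : A.alpha / 2 ≤ A.etaY * A.muY := by
  have h1 := hA.muX_pos
  have h2 := hA.muY_pos
  have h3 := hA.alpha_pos
  have h4 := foam_alpha_le_one A
  have h5 := hA.alpha_sq_le
  rw [← div_le_iff₀ h2, Foam.etaY, le_min_iff]
  constructor
  · rw [div_le_iff₀ h2]
    have : 1 / (2 * A.muY) * A.muY = 1 / 2 := by field_simp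
    rw [this]
    linarith
  · rw [le_div_iff₀ h1] at h5
    rw [div_div, div_le_div_iff₀ (by positivity) (by positivity)]
    nlinarith

/-- The distance of the momentum sequences to the solution. -/
noncomputable def foamDist (A : Foam n d) (s : Foam.Outer n d) (xs : E n) (ys : E d) : ℝ :=
  A.etaZ⁻¹ * ‖s.z - -(A.muX • xs)‖ ^ 2 + A.etaY⁻¹ * ‖s.y - ys‖ ^ 2

/-- The optimality gap of the dual function at the current iterate. -/
noncomputable def foamGap (A : Foam n d) (φ : E n → E d → ℝ) (s : Foam.Outer n d) (xs : E n)
    (ys : E d) : ℝ :=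
  foamPot A φ s.xf s.zf s.yf - foamPot A φ xs (-(A.muX • xs)) ys

/-- `(xs, ys)` is the saddle point, written through its first-order conditions. -/
def FoamSaddle (A : Foam n d) (xs : E n) (ys : E d) : Prop :=
  FoamGraph A xs (-(A.muX • xs)) ys (-(A.muY • ys))

variable {xs : E n} {ys : E d}

/-- Both components of the gradient vanish at the saddle point, so strong convexity leaves quadratic
growth. -/
theorem FoamRegular.gap_ge (hA : FoamRegular A φ) (hs : FoamSaddle A xs ys) {s : Foam.Outer n d}
    {w : E d} (h : FoamGraph A s.xf s.zf s.yf w) :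
    A.muX⁻¹ / 2 * ‖s.zf - -(A.muX • xs)‖ ^ 2 + A.muY / 2 * ‖s.yf - ys‖ ^ 2 ≤
      foamGap A φ s xs ys := by
  have h1 := hA.foamPot_ge hs h
  have e1 : xs + A.muX⁻¹ • -(A.muX • xs) = 0 := by
    rw [smul_neg, inv_smul_smul₀ hA.muX_pos.ne', add_neg_cancel]
  rw [e1, neg_add_cancel, inner_zero_left, inner_zero_left] at h1
  simp only [foamGap]
  linarith

/-- The part of the analysis of an outer step that is common to the first and the later ones. -/
theorem FoamRegular.dist_outerNext_le (hA : FoamRegular A φ) (hs : FoamSaddle A xs ys)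
    {s : Foam.Outer n d} {w : E d}
    (hw : FoamGraph A (A.outerNext s).xf (A.outerNext s).zf (A.outerNext s).yf w)
    (hz : (A.outerNext s).z = s.z + (A.etaZ * A.muX⁻¹) • ((A.outerNext s).zf - s.z) -
        A.etaZ • ((A.outerNext s).xf + A.muX⁻¹ • (A.outerNext s).zf))
    (hy : (A.outerNext s).y = s.y + (A.etaY * A.muY) • ((A.outerNext s).yf - s.y) -
        A.etaY • (w + A.muY • (A.outerNext s).yf)) :
    foamDist A (A.outerNext s) xs ys ≤
      (A.etaZ⁻¹ - A.muX⁻¹) * ‖s.z - -(A.muX • xs)‖ ^ 2 +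
      (A.etaY⁻¹ - A.muY) * ‖s.y - ys‖ ^ 2 - 2 * foamGap A φ (A.outerNext s) xs ys
      - 2 * ⟪(A.outerNext s).xf + A.muX⁻¹ • (A.outerNext s).zf, s.z - (A.outerNext s).zf⟫_ℝ
      - 2 * ⟪w + A.muY • (A.outerNext s).yf, s.y - (A.outerNext s).yf⟫_ℝ
      + A.muX * ‖(A.outerNext s).xf + A.muX⁻¹ • (A.outerNext s).zf‖ ^ 2 +
      2 * A.etaY * ‖w + A.muY • (A.outerNext s).yf‖ ^ 2 := by
  have hμ := hA.muX_pos
  have heZ : 0 < A.etaZ := by simp only [Foam.etaZ]; positivity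
  have h1 := accelerated_step (ζs := -(A.muX • xs)) heZ (inv_pos.2 hμ).le
    (by simp only [Foam.etaZ]; field_simp; norm_num) hz
  have h2 := accelerated_step (ζs := ys) hA.etaY_pos hA.muY_pos.le hA.etaY_mul_le hy
  have h3 := hA.foamPot_ge hw hs
  set s' := A.outerNext s
  set gz := s'.xf + A.muX⁻¹ • s'.zf
  set gy := w + A.muY • s'.yf
  have e1 : ⟪gz, s.z - -(A.muX • xs)⟫_ℝ = ⟪gz, s.z - s'.zf⟫_ℝ - ⟪gz, -(A.muX • xs) - s'.zf⟫_ℝ := by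
    rw [← inner_sub_right]; congr 1; abel
  have e2 : ⟪gy, s.y - ys⟫_ℝ = ⟪gy, s.y - s'.yf⟫_ℝ - ⟪gy, ys - s'.yf⟫_ℝ := by
    rw [← inner_sub_right]; congr 1; abel
  have e3 : 2 * A.etaZ = A.muX := by simp only [Foam.etaZ]; ring
  rw [e1, e3] at h1
  rw [e2] at h2
  rw [norm_sub_rev _ s'.zf, norm_sub_rev _ s'.yf] at h3
  simp only [foamDist, foamGap]
  linarith

/-- The Lyapunov function of the outer loop. -/
noncomputable def foamLyap (A : Foam n d) (φ : E n → E d → ℝ) (s : Foam.Outer n d) (xs : E n)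
    (ys : E d) : ℝ :=
  foamDist A s xs ys + 2 / A.alpha * foamGap A φ s xs ys

/-- Multiply `dist_outerNext_le` by `α`. Since `z_g = α z + (1 - α) z_f`, and likewise for `y_g`,
the inner products split into those of the stopping test, which pay for the squared gradients, and
those bounded by convexity through the decrease of the gap. The weights contract because `etaZ / muX
= 1/2` and `etaY * muY` are both at least `α / 2`. -/
theorem FoamRegular.lyap_outerNext_le (hA : FoamRegular A φ) (hs : FoamSaddle A xs ys)
    {s : Foam.Outer n d} {w₀ : E d} (hw₀ : FoamGraph A s.xf s.zf s.yf w₀) :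
    foamLyap A φ (A.outerNext s) xs ys + A.muX / 5 *
      ‖(A.outerNext s).xf + A.muX⁻¹ • (A.outerNext s).zf‖ ^ 2 ≤
      (1 - A.alpha / 2) * foamLyap A φ s xs ys := by
  obtain ⟨w, hw, hz, hy, htest⟩ := hA.outerNext_spec s
  have hd := hA.dist_outerNext_le hs hw hz hy
  have hpot := hA.foamPot_ge hw hw₀
  have hgap := hA.gap_ge hs hw₀
  have hμ := hA.muX_pos
  have hμY := hA.muY_pos
  have hα := hA.alpha_pos
  have hα1 := foam_alpha_le_one A
  have heY := hA.etaY_pos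
  have heY1 := hA.le_etaY_mul
  have heY2 : A.etaY ≤ 4 / (A.alpha * A.muX) := min_le_right _ _
  set s' := A.outerNext s
  set gz := s'.xf + A.muX⁻¹ • s'.zf
  set gy := w + A.muY • s'.yf
  set α := A.alpha
  have hgap0 : 0 ≤ foamGap A φ s xs ys := le_trans (by positivity) hgap
  -- the momentum point in terms of the extrapolated one
  have e1 : α * ⟪gz, s.z - s'.zf⟫_ℝ = -⟪gz, s'.zf - A.zg s⟫_ℝ - (1 - α) * ⟪gz, s.zf - s'.zf⟫_ℝ := by
    rw [← inner_smul_right, ← inner_smul_right, ← inner_neg_right, ← inner_sub_right]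
    congr 1
    simp only [Foam.zg]
    module
  have e2 : α * ⟪gy, s.y - s'.yf⟫_ℝ = -⟪gy, s'.yf - A.yg s⟫_ℝ - (1 - α) * ⟪gy, s.yf - s'.yf⟫_ℝ := by
    rw [← inner_smul_right, ← inner_smul_right, ← inner_neg_right, ← inner_sub_right]
    congr 1
    simp only [Foam.yg]
    module
  have hpot' : ⟪gz, s.zf - s'.zf⟫_ℝ + ⟪gy, s.yf - s'.yf⟫_ℝ ≤
      foamGap A φ s xs ys - foamGap A φ s' xs ys := by
    have : 0 ≤ A.muX⁻¹ / 2 * ‖s.zf - s'.zf‖ ^ 2 + A.muY / 2 * ‖s.yf - s'.yf‖ ^ 2 := by positivity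
    simp only [foamGap]
    linarith
  have h1 := mul_le_mul_of_nonneg_left hpot' (sub_nonneg.2 hα1)
  have hZ : A.etaZ⁻¹ - A.muX⁻¹ ≤ (1 - α / 2) * A.etaZ⁻¹ := by
    simp only [Foam.etaZ]
    have : (A.muX / 2)⁻¹ = 2 * A.muX⁻¹ := by field_simp
    rw [this]
    nlinarith [inv_pos.2 hμ]
  have hY : A.etaY⁻¹ - A.muY ≤ (1 - α / 2) * A.etaY⁻¹ := by
    have := mul_le_mul_of_nonneg_left heY1 (inv_pos.2 heY).le
    rw [inv_mul_cancel_left₀ heY.ne'] at this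
    linarith
  have h2 := mul_le_mul_of_nonneg_right hZ (sq_nonneg ‖s.z - -(A.muX • xs)‖)
  have h3 := mul_le_mul_of_nonneg_right hY (sq_nonneg ‖s.y - ys‖)
  have h4 : 2 * (α * A.etaY) * ‖gy‖ ^ 2 ≤ 8 / A.muX * ‖gy‖ ^ 2 := by
    refine mul_le_mul_of_nonneg_right ?_ (sq_nonneg _)
    calc 2 * (α * A.etaY) ≤ 2 * (α * (4 / (α * A.muX))) := by gcongr
      _ = 8 / A.muX := by field_simp; norm_num
  have h5 : 0 ≤ A.muX * ‖gz‖ ^ 2 := by positivity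
  have h5' : α * (A.muX * ‖gz‖ ^ 2) ≤ A.muX * ‖gz‖ ^ 2 := mul_le_of_le_one_left h5 hα1
  have e3 : α * (2 / α) = 2 := by field_simp
  refine le_of_mul_le_mul_left ?_ hα
  have e4 : α * (foamLyap A φ s' xs ys + A.muX / 5 * ‖gz‖ ^ 2) =
      α * foamDist A s' xs ys + 2 * foamGap A φ s' xs ys + α * (A.muX * ‖gz‖ ^ 2) / 5 := by
    simp only [foamLyap]
    linear_combination foamGap A φ s' xs ys * e3
  have e5 : α * ((1 - α / 2) * foamLyap A φ s xs ys) =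
      α * ((1 - α / 2) * foamDist A s xs ys) + (2 - α) * foamGap A φ s xs ys := by
    simp only [foamLyap]
    linear_combination (1 - α / 2) * foamGap A φ s xs ys * e3
  rw [e4, e5]
  have hd' := mul_le_mul_of_nonneg_left hd hα.le
  have h6 : α * foamGap A φ s xs ys ≥ 0 := by positivity
  have h7 := mul_le_mul_of_nonneg_left (add_le_add h2 h3) hα.le
  have e6 : α * ((1 - α / 2) * foamDist A s xs ys) =
    α * ((1 - α / 2) * A.etaZ⁻¹ * ‖s.z - -(A.muX • xs)‖ ^ 2 +
    (1 - α / 2) * A.etaY⁻¹ * ‖s.y - ys‖ ^ 2) := by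
    simp only [foamDist]
    ring
  rw [e6]
  linarith

end FoamOuter

/-! ### Linear convergence and gradient complexity of FOAM. -/

section FoamComplexity

variable {n d : ℕ} {A : Foam n d} {φ : E n → E d → ℝ} {xs : E n} {ys : E d}

/-- The first outer step. The initial `z_f` need not be a subgradient, so that the Lyapunov function
is bounded only after this step. -/
theorem FoamRegular.lyap_first_le (hA : FoamRegular A φ) (hs : FoamSaddle A xs ys)
    (hμ : A.muY ≤ A.muX) (x₀ : E n) (y₀ : E d) :
    foamLyap A φ (A.outer x₀ y₀ 1) xs ys ≤
      17 / A.alpha * A.muX * (‖x₀ - xs‖ ^ 2 + ‖y₀ - ys‖ ^ 2) := by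
  obtain ⟨w, hw, hz, hy, htest⟩ := hA.outerNext_spec (A.outer x₀ y₀ 0)
  have hd := hA.dist_outerNext_le hs hw hz hy
  have hpot := hA.foamPot_ge hw hs
  have hgap := hA.gap_ge hs hw
  have hμX := hA.muX_pos
  have hμY := hA.muY_pos
  have hα := hA.alpha_pos
  have hα1 := foam_alpha_le_one A
  have heY := hA.etaY_pos
  have heY1 := hA.le_etaY_mul
  have heY2 : A.etaY ≤ 4 / (A.alpha * A.muX) := min_le_right _ _
  change foamLyap A φ (A.outerNext (A.outer x₀ y₀ 0)) xs ys ≤ _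
  set s := A.outer x₀ y₀ 0 with hs0
  set s' := A.outerNext s
  set gz := s'.xf + A.muX⁻¹ • s'.zf
  set gy := w + A.muY • s'.yf
  set α := A.alpha
  have hsz : s.z = -(A.muX • x₀) := rfl
  have hsy : s.y = y₀ := rfl
  -- At the start the momentum and extrapolated points coincide, so the stopping test cancels the
  -- inner products in `hd` directly and no potential value at `s` is needed.
  have hzg : A.zg s = s.z := by
    have : s.zf = s.z := rfl
    simp only [Foam.zg, this]
    module
  have hyg : A.yg s = s.y := by
    have : s.yf = s.y := rfl
    simp only [Foam.yg, this]
    module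
  rw [hzg, hyg] at htest
  set μ := A.muX
  have hgap0 : 0 ≤ foamGap A φ s' xs ys := le_trans (by positivity) hgap
  have ez : s.z - -(μ • xs) = -(μ • (x₀ - xs)) := by rw [hsz, smul_sub]; abel
  have nz : ‖s.z - -(μ • xs)‖ = μ * ‖x₀ - xs‖ := by
    rw [ez, norm_neg, norm_smul, Real.norm_eq_abs, abs_of_pos hμX]
  set e2 := ‖x₀ - xs‖ ^ 2 + ‖y₀ - ys‖ ^ 2 with he2
  have c1 : ⟪gz, s'.zf - s.z⟫_ℝ = -⟪gz, s.z - s'.zf⟫_ℝ := by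
    rw [← inner_neg_right]; congr 1; abel
  have c2 : ⟪gy, s'.yf - s.y⟫_ℝ = -⟪gy, s.y - s'.yf⟫_ℝ := by
    rw [← inner_neg_right]; congr 1; abel
  have c3 : ⟪gz, -(μ • xs) - s'.zf⟫_ℝ = ⟪gz, s.z - s'.zf⟫_ℝ - ⟪gz, s.z - -(μ • xs)⟫_ℝ := by
    rw [← inner_sub_right]; congr 1; abel
  have c4 : ⟪gy, ys - s'.yf⟫_ℝ = ⟪gy, s.y - s'.yf⟫_ℝ - ⟪gy, s.y - ys⟫_ℝ := by
    rw [← inner_sub_right]; congr 1; abel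
  rw [c1, c2] at htest
  rw [c3, c4] at hpot
  have b1 : ⟪gz, s.z - -(μ • xs)⟫_ℝ ≤ μ * ‖gz‖ ^ 2 / 10 + 5 / 2 * (μ * ‖x₀ - xs‖ ^ 2) := by
    have := real_inner_le_norm gz (s.z - -(μ • xs))
    rw [nz] at this
    nlinarith [mul_nonneg hμX.le (sq_nonneg (‖gz‖ - 5 * ‖x₀ - xs‖))]
  have b2 : ⟪gy, s.y - ys⟫_ℝ ≤ 2 * (‖gy‖ ^ 2 / μ) + μ / 8 * ‖y₀ - ys‖ ^ 2 := by
    have := real_inner_le_norm gy (s.y - ys)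
    rw [hsy] at this ⊢
    have h2 : 0 ≤ 2 / μ * (‖gy‖ - μ / 4 * ‖y₀ - ys‖) ^ 2 := by positivity
    have h3 : 2 / μ * (‖gy‖ - μ / 4 * ‖y₀ - ys‖) ^ 2 =
      2 * (‖gy‖ ^ 2 / μ) - ‖gy‖ * ‖y₀ - ys‖ + μ / 8 * ‖y₀ - ys‖ ^ 2 := by field_simp; ring
    linarith
  have q1 : 0 ≤ μ⁻¹ / 2 * ‖-(μ • xs) - s'.zf‖ ^ 2 + A.muY / 2 * ‖ys - s'.yf‖ ^ 2 := by positivity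
  have q2 : 0 ≤ μ * ‖gz‖ ^ 2 := by positivity
  have q3 : 0 ≤ ‖gy‖ ^ 2 / μ := by positivity
  have e8 : 8 / μ * ‖gy‖ ^ 2 = 8 * (‖gy‖ ^ 2 / μ) := by ring
  rw [e8] at htest
  have hsum : foamGap A φ s' xs ys + μ * ‖gz‖ ^ 2 / 2 + 2 * (‖gy‖ ^ 2 / μ) ≤ 5 / 2 * (μ * e2) := by
    have : foamGap A φ s' xs ys = foamPot A φ s'.xf s'.zf s'.yf -
      foamPot A φ xs (-(μ • xs)) ys := rfl
    have h3 : 0 ≤ μ * ‖y₀ - ys‖ ^ 2 := by positivity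
    rw [he2]
    linarith
  have hge : 2 * A.etaY * ‖gy‖ ^ 2 ≤ 10 / α * μ * e2 := by
    calc 2 * A.etaY * ‖gy‖ ^ 2 ≤ 2 * (4 / (α * μ)) * ‖gy‖ ^ 2 := by gcongr
      _ = 8 / α * (‖gy‖ ^ 2 / μ) := by field_simp; ring
      _ ≤ 8 / α * (5 / 4 * (μ * e2)) := by gcongr; linarith
      _ = _ := by ring
  have hZ : (A.etaZ⁻¹ - μ⁻¹) * ‖s.z - -(μ • xs)‖ ^ 2 ≤ 2 / α * (μ * ‖x₀ - xs‖ ^ 2) := by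
    rw [nz]
    have : (A.etaZ⁻¹ - μ⁻¹) * (μ * ‖x₀ - xs‖) ^ 2 = μ * ‖x₀ - xs‖ ^ 2 := by
      rw [show A.etaZ = μ / 2 from rfl]
      field_simp
      ring
    rw [this]
    refine le_mul_of_one_le_left (by positivity) ?_
    rw [le_div_iff₀ hα]
    linarith
  have hY : (A.etaY⁻¹ - A.muY) * ‖s.y - ys‖ ^ 2 ≤ 2 / α * (μ * ‖y₀ - ys‖ ^ 2) := by
    rw [hsy, ← mul_assoc]
    refine mul_le_mul_of_nonneg_right ?_ (sq_nonneg _)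
    have : A.etaY⁻¹ ≤ 2 / α * A.muY := by
      rw [inv_le_iff_one_le_mul₀ heY]
      have h2 : 2 / α * (α / 2) = 1 := by field_simp
      have h3 := mul_le_mul_of_nonneg_left heY1 (show 0 ≤ 2 / α by positivity)
      linarith
    have h4 : 2 / α * A.muY ≤ 2 / α * μ := by gcongr
    linarith
  have hfin : foamDist A s' xs ys ≤ 12 / α * μ * e2 := by
    have : 12 / α * μ * e2 = 2 / α * (μ * ‖x₀ - xs‖ ^ 2) + 2 / α * (μ * ‖y₀ - ys‖ ^ 2) +
      10 / α * μ * e2 := by rw [he2]; ring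
    rw [this]
    linarith
  have hgap' : 2 / α * foamGap A φ s' xs ys ≤ 5 / α * μ * e2 := by
    calc 2 / α * foamGap A φ s' xs ys ≤ 2 / α * (5 / 2 * (μ * e2)) := by gcongr; linarith
      _ = _ := by ring
  simp only [foamLyap]
  have : 17 / α * μ * e2 = 12 / α * μ * e2 + 5 / α * μ * e2 := by ring
  rw [this]
  linarith

theorem FoamRegular.graph_outer (hA : FoamRegular A φ) (x₀ : E n) (y₀ : E d) (k : ℕ) :
    ∃ w, FoamGraph A (A.outer x₀ y₀ (k + 1)).xf (A.outer x₀ y₀ (k + 1)).zf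
      (A.outer x₀ y₀ (k + 1)).yf w := by
  obtain ⟨w, hw, -⟩ := hA.outerNext_spec (A.outer x₀ y₀ k)
  exact ⟨w, hw⟩

theorem FoamRegular.lyap_nonneg (hA : FoamRegular A φ) (hs : FoamSaddle A xs ys) (x₀ : E n)
    (y₀ : E d) (k : ℕ) : 0 ≤ foamLyap A φ (A.outer x₀ y₀ (k + 1)) xs ys := by
  obtain ⟨w, hw⟩ := hA.graph_outer x₀ y₀ k
  have h := hA.gap_ge hs hw
  have h1 := hA.muX_pos
  have h2 := hA.muY_pos
  have h3 := hA.alpha_pos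
  have h4 := hA.etaY_pos
  have h5 : 0 ≤ foamGap A φ (A.outer x₀ y₀ (k + 1)) xs ys := le_trans (by positivity) h
  simp only [foamLyap, foamDist, Foam.etaZ]
  positivity

theorem FoamRegular.lyap_outer_le (hA : FoamRegular A φ) (hs : FoamSaddle A xs ys)
    (hμ : A.muY ≤ A.muX) (x₀ : E n) (y₀ : E d) (k : ℕ) :
    foamLyap A φ (A.outer x₀ y₀ (k + 1)) xs ys ≤
      (1 - A.alpha / 2) ^ k * (17 / A.alpha * A.muX * (‖x₀ - xs‖ ^ 2 + ‖y₀ - ys‖ ^ 2)) := by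
  induction k with
  | zero => simpa using hA.lyap_first_le hs hμ x₀ y₀
  | succ k ih =>
    obtain ⟨w, hw⟩ := hA.graph_outer x₀ y₀ k
    have h := hA.lyap_outerNext_le hs hw
    have h1 := hA.muX_pos
    have h3 := foam_alpha_le_one A
    have h2 : 0 ≤ A.muX / 5 * ‖(A.outerNext (A.outer x₀ y₀ (k + 1))).xf +
      A.muX⁻¹ • (A.outerNext (A.outer x₀ y₀ (k + 1))).zf‖ ^ 2 := by positivity
    have h4 := mul_le_mul_of_nonneg_left ih (show 0 ≤ 1 - A.alpha / 2 by linarith)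
    rw [← mul_assoc, ← pow_succ'] at h4
    change foamLyap A φ (A.outerNext (A.outer x₀ y₀ (k + 1))) xs ys ≤ _
    linarith

/-- Linear convergence of the outer iterates of FOAM. -/
theorem FoamRegular.dist_sq_outer_le (hA : FoamRegular A φ) (hs : FoamSaddle A xs ys)
    (hμ : A.muY ≤ A.muX) (x₀ : E n) (y₀ : E d) (k : ℕ) :
    ‖(A.outer x₀ y₀ (k + 2)).xf - xs‖ ^ 2 + ‖(A.outer x₀ y₀ (k + 2)).yf - ys‖ ^ 2 ≤
      221 * (A.muX / (A.alpha * A.muY)) * (‖x₀ - xs‖ ^ 2 + ‖y₀ - ys‖ ^ 2) *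
        (1 - A.alpha / 2) ^ k := by
  obtain ⟨w, hw⟩ := hA.graph_outer x₀ y₀ k
  obtain ⟨w', hw'⟩ := hA.graph_outer x₀ y₀ (k + 1)
  have h := hA.lyap_outerNext_le hs hw
  have hgap := hA.gap_ge hs hw'
  have hlyap := hA.lyap_outer_le hs hμ x₀ y₀ k
  have hnonneg := hA.lyap_nonneg hs x₀ y₀ k
  have hnonneg' := hA.lyap_nonneg hs x₀ y₀ (k + 1)
  have hμX := hA.muX_pos
  have hμY := hA.muY_pos
  have hα := hA.alpha_pos
  have hα1 := foam_alpha_le_one A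
  have heY := hA.etaY_pos
  change foamLyap A φ (A.outer x₀ y₀ (k + 2)) xs ys + A.muX / 5 *
    ‖(A.outer x₀ y₀ (k + 2)).xf + A.muX⁻¹ • (A.outer x₀ y₀ (k + 2)).zf‖ ^ 2 ≤ _ at h
  change A.muX⁻¹ / 2 * ‖(A.outer x₀ y₀ (k + 2)).zf - -(A.muX • xs)‖ ^ 2 +
    A.muY / 2 * ‖(A.outer x₀ y₀ (k + 2)).yf - ys‖ ^ 2 ≤ foamGap A φ (A.outer x₀ y₀ (k + 2)) xs ys
    at hgap
  set s' := A.outer x₀ y₀ (k + 2)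
  set Λ := foamLyap A φ (A.outer x₀ y₀ (k + 1)) xs ys
  set gz := s'.xf + A.muX⁻¹ • s'.zf
  set e2 := ‖x₀ - xs‖ ^ 2 + ‖y₀ - ys‖ ^ 2
  have hΛ : (1 - A.alpha / 2) * Λ ≤ Λ := by nlinarith
  have hgz : A.muX * ‖gz‖ ^ 2 ≤ 5 * Λ := by
    have : 0 ≤ foamLyap A φ s' xs ys := hnonneg'
    linarith
  have hD : foamGap A φ s' xs ys ≤ Λ / 2 := by
    have h1 : 2 / A.alpha * foamGap A φ s' xs ys ≤ Λ := by
      have h2 : 0 ≤ foamDist A s' xs ys := by simp only [foamDist, Foam.etaZ]; positivity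
      have h3 : 0 ≤ A.muX / 5 * ‖gz‖ ^ 2 := by positivity
      simp only [foamLyap] at h
      linarith
    have h0 : 0 ≤ foamGap A φ s' xs ys := le_trans (by positivity) hgap
    have h4 : 2 * foamGap A φ s' xs ys ≤ 2 / A.alpha * foamGap A φ s' xs ys := by
      gcongr
      rw [le_div_iff₀ hα]
      linarith
    linarith
  have hy2 : A.muY * ‖s'.yf - ys‖ ^ 2 ≤ Λ := by
    have : 0 ≤ A.muX⁻¹ / 2 * ‖s'.zf - -(A.muX • xs)‖ ^ 2 := by positivity
    linarith
  have hz2 : A.muX⁻¹ * ‖s'.zf - -(A.muX • xs)‖ ^ 2 ≤ Λ := by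
    have : 0 ≤ A.muY / 2 * ‖s'.yf - ys‖ ^ 2 := by positivity
    linarith
  -- `x_f` does not occur in the distance terms; it is recovered from `z_f` and the gradient `gz`,
  -- which the surplus term of `lyap_outerNext_le` controls. The resulting factor `13 = 12 + 1` and
  -- the `17` of the first step give `221`.
  have ex : s'.xf - xs = gz - A.muX⁻¹ • (s'.zf - -(A.muX • xs)) := by
    simp only [gz]
    rw [sub_neg_eq_add, smul_add, inv_smul_smul₀ hμX.ne']
    abel
  have hx2 : A.muX * ‖s'.xf - xs‖ ^ 2 ≤ 12 * Λ := by
    rw [ex]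
    have h1 : ‖gz - A.muX⁻¹ • (s'.zf - -(A.muX • xs))‖ ^ 2 ≤
        2 * ‖gz‖ ^ 2 + 2 * (A.muX⁻¹ * ‖s'.zf - -(A.muX • xs)‖) ^ 2 := by
      have h2 := norm_sub_le gz (A.muX⁻¹ • (s'.zf - -(A.muX • xs)))
      rw [norm_smul, Real.norm_eq_abs, abs_of_pos (inv_pos.2 hμX)] at h2
      calc _ ≤ (‖gz‖ + A.muX⁻¹ * ‖s'.zf - -(A.muX • xs)‖) ^ 2 := by gcongr
        _ ≤ _ := by nlinarith [sq_nonneg (‖gz‖ - A.muX⁻¹ * ‖s'.zf - -(A.muX • xs)‖)]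
    have h3 := mul_le_mul_of_nonneg_left h1 hμX.le
    have h4 : A.muX * (2 * ‖gz‖ ^ 2 + 2 * (A.muX⁻¹ * ‖s'.zf - -(A.muX • xs)‖) ^ 2) =
      2 * (A.muX * ‖gz‖ ^ 2) + 2 * (A.muX⁻¹ * ‖s'.zf - -(A.muX • xs)‖ ^ 2) := by
      field_simp
    linarith
  have htot : A.muY * (‖s'.xf - xs‖ ^ 2 + ‖s'.yf - ys‖ ^ 2) ≤ 13 * Λ := by
    have : A.muY * ‖s'.xf - xs‖ ^ 2 ≤ A.muX * ‖s'.xf - xs‖ ^ 2 := by gcongr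
    linarith
  have hdiv : ‖s'.xf - xs‖ ^ 2 + ‖s'.yf - ys‖ ^ 2 ≤ 13 * Λ / A.muY := by
    rw [le_div_iff₀ hμY]
    linarith
  calc _ ≤ 13 * Λ / A.muY := hdiv
    _ ≤ 13 * ((1 - A.alpha / 2) ^ k * (17 / A.alpha * A.muX * e2)) / A.muY := by gcongr
    _ = _ := by field_simp; ring

theorem FoamRegular.xf_mem (hA : FoamRegular A φ) {x₀ : E n} {y₀ : E d} (hx : x₀ ∈ A.X)
    (hy : y₀ ∈ A.Y) (k : ℕ) : (A.outer x₀ y₀ k).xf ∈ A.X ∧ (A.outer x₀ y₀ k).yf ∈ A.Y := by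
  cases k with
  | zero => exact ⟨hx, hy⟩
  | succ k =>
    obtain ⟨w, hw⟩ := hA.graph_outer x₀ y₀ k
    exact ⟨hw.mem_X, hw.mem_Y⟩

/-- The gradient complexity of FOAM. -/
theorem FoamRegular.exists_cost (hA : FoamRegular A φ) (hs : FoamSaddle A xs ys)
    (hμ : A.muY ≤ A.muX) {x₀ : E n} {y₀ : E d} (hx : x₀ ∈ A.X) (hy : y₀ ∈ A.Y)
    {acc : E n → E d → Prop} {δ Q : ℝ} (hδ : 0 < δ)
    (hacc : ∀ x y, ‖x - xs‖ ^ 2 + ‖y - ys‖ ^ 2 ≤ δ → acc x y) (hQ : 0 < Q)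
    (hQ' : 221 * (A.muX / (A.alpha * A.muY)) * (‖x₀ - xs‖ ^ 2 + ‖y₀ - ys‖ ^ 2) ≤ δ * Q) :
    ∃ N : ℕ, A.cost acc x₀ y₀ = (N : ℕ∞) ∧
      N ≤ (⌈2 / A.alpha * Real.log Q⌉₊ + 2) * (2 + 2 * ⌈18 * (2 * √5 * (1 + 8 * A.L / A.muX))⌉₊) ∧
      acc (A.output acc x₀ y₀).1 (A.output acc x₀ y₀).2 ∧
      (A.output acc x₀ y₀).1 ∈ A.X ∧ (A.output acc x₀ y₀).2 ∈ A.Y := by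
  set k := ⌈2 / A.alpha * Real.log Q⌉₊ with hk
  have hα := hA.alpha_pos
  have hα1 := foam_alpha_le_one A
  -- The contraction starts after the first step, and bounding `x_f` uses one more, hence `k + 2`.
  have hlast : acc (A.outer x₀ y₀ (k + 2)).xf (A.outer x₀ y₀ (k + 2)).yf := by
    apply hacc
    refine (hA.dist_sq_outer_le hs hμ x₀ y₀ k).trans ?_
    have h1 : (1 - A.alpha / 2) ^ k ≤ Q⁻¹ := by
      calc (1 - A.alpha / 2) ^ k ≤ Real.exp (-(A.alpha / 2)) ^ k := by
            have := Real.one_sub_le_exp_neg (A.alpha / 2)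
            gcongr
            linarith
        _ = Real.exp (-(A.alpha / 2 * k)) := by rw [← Real.exp_nat_mul]; congr 1; ring
        _ ≤ Real.exp (-Real.log Q) := by
            apply Real.exp_le_exp.2
            have h2 := Nat.le_ceil (2 / A.alpha * Real.log Q)
            rw [← hk] at h2
            have h3 := mul_le_mul_of_nonneg_left h2 (show 0 ≤ A.alpha / 2 by positivity)
            have h4 : A.alpha / 2 * (2 / A.alpha * Real.log Q) = Real.log Q := by field_simp
            linarith
        _ = Q⁻¹ := by rw [Real.exp_neg, Real.exp_log hQ]
    calc _ ≤ δ * Q * Q⁻¹ := by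
          exact mul_le_mul hQ' h1 (pow_nonneg (by linarith) _) (by positivity)
      _ = δ := by field_simp
  obtain ⟨K, hK, hKacc, hKle⟩ := firstIndex_of_exists
    (p := fun k => acc (A.outer x₀ y₀ k).xf (A.outer x₀ y₀ k).yf) hlast
  have hK' : A.outerCount acc x₀ y₀ = (K : ℕ∞) := hK
  choose Ni hNi _ hNile using fun s : Foam.Outer n d => hA.exists_innerCount (A.zg s) (A.yg s)
  refine ⟨∑ j ∈ Finset.range K, (2 + 2 * Ni (A.outer x₀ y₀ j)), ?_, ?_, ?_⟩
  · simp [Foam.cost, hK', Foam.iterCost, hNi]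
  · refine (Finset.sum_le_card_nsmul _ _ _ fun j _ => Nat.add_le_add_left
      (Nat.mul_le_mul_left 2 (hNile _)) 2).trans ?_
    rw [Finset.card_range, smul_eq_mul]
    exact Nat.mul_le_mul_right _ hKle
  · have ho : A.output acc x₀ y₀ = ((A.outer x₀ y₀ K).xf, (A.outer x₀ y₀ K).yf) := by
      simp [Foam.output, hK']
    rw [ho]
    exact ⟨hKacc, hA.xf_mem hx hy K⟩

end FoamComplexity

/-! ### Existence of the saddle point of the FOAM input. -/

section Saddle

variable {n d : ℕ} {A : Foam n d} {φ : E n → E d → ℝ}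

/-- Adding `muX / 2` times `x` and removing `muX / 8` times `y` turns the inner operator at `zg = yg
= 0` into the saddle operator of `h`, which is strongly monotone with modulus `min muX muY`. -/
theorem FoamRegular.exists_saddle (hA : FoamRegular A φ) : ∃ xs ys, FoamSaddle A xs ys := by
  have hμX := hA.muX_pos
  have hμY := hA.muY_pos
  let a : Pair n d → Pair n d := fun u =>
    foamOp A 0 0 u + pair ((A.muX / 2) • u.fst) (-(A.muX / 8) • u.snd)
  have ha : ∀ u v, a u - a v = foamOp A 0 0 u - foamOp A 0 0 v +
      pair ((A.muX / 2) • (u - v).fst) (-(A.muX / 8) • (u - v).snd) := by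
    intro u v
    apply pair_ext
    · simp only [a, WithLp.add_fst, WithLp.sub_fst, pair_fst]; module
    · simp only [a, WithLp.add_snd, WithLp.sub_snd, pair_snd]; module
  have hlip : ∀ v ∈ pairSet A.X A.Y, ∀ w ∈ pairSet A.X A.Y,
      ‖a v - a w‖ ≤ (A.L + A.muX / 8 + A.muX) * ‖v - w‖ := by
    intro v _ w _
    rw [ha, add_mul]
    refine (norm_add_le _ _).trans (add_le_add (hA.norm_op_sub_le 0 0 v w) ?_)
    refine le_of_sq_le_sq ?_ (by positivity)
    rw [mul_pow, norm_sq_pair, norm_sq_pair, pair_fst, pair_snd, norm_smul, norm_smul, mul_pow,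
      mul_pow, Real.norm_eq_abs, Real.norm_eq_abs, sq_abs, sq_abs, mul_add]
    gcongr ?_ * _ + ?_ * _ <;> nlinarith
  obtain ⟨u, hu, hvi⟩ := exists_solvesVI (a := a) (m := min A.muX A.muY)
    (isClosed_pairSet hA.closed_X hA.closed_Y)
    (⟨pair hA.nonempty_X.some hA.nonempty_Y.some, hA.nonempty_X.some_mem,
      hA.nonempty_Y.some_mem⟩ : (pairSet A.X A.Y).Nonempty)
    (isProjection_pair hA.projX hA.projY) (lt_min hμX hμY) hlip (by
      intro v hv w hw
      have h := hA.hat_monotone hv.1 hw.1 hv.2 hw.2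
      rw [ha, inner_pair, norm_sq_pair, mul_add]
      have h1 := mul_le_mul_of_nonneg_right (min_le_left A.muX A.muY) (sq_nonneg ‖(v - w).fst‖)
      have h2 := mul_le_mul_of_nonneg_right (min_le_right A.muX A.muY) (sq_nonneg ‖(v - w).snd‖)
      simp only [foamOp, WithLp.sub_fst, WithLp.sub_snd, WithLp.add_fst, WithLp.add_snd, pair_fst,
        pair_snd, foam_aX_sub, foam_aY_sub, inner_add_left, inner_smul_left, conj_trivial,
        real_inner_self_eq_norm_sq] at h1 h2 ⊢
      linarith)
  refine ⟨u.fst, u.snd, hu.1, hu.2, fun x' hx' => ?_, fun y' hy' => ?_⟩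
  · have h := hvi (pair x' u.snd) ⟨hx', hu.2⟩
    rw [inner_pair] at h
    simp only [WithLp.sub_fst, WithLp.sub_snd, pair_fst, pair_snd, sub_self, inner_zero_right,
      add_zero, a, foamOp, WithLp.add_fst] at h
    have e : A.aX 0 u.fst u.snd + (A.muX / 2) • u.fst =
        -(-(A.muX • u.fst) - A.hatX u.fst u.snd) := by
      simp only [Foam.aX, smul_zero, sub_zero]
      module
    rw [e, inner_neg_left] at h
    linarith
  · have h := hvi (pair u.fst y') ⟨hu.1, hy'⟩
    rw [inner_pair] at h
    simp only [WithLp.sub_fst, WithLp.sub_snd, pair_fst, pair_snd, sub_self, inner_zero_right,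
      zero_add, a, foamOp, WithLp.add_snd] at h
    have e : A.aY 0 u.fst u.snd + -(A.muX / 8) • u.snd =
        -(-(A.muY • u.snd) + A.hatY u.fst u.snd) := by
      simp only [Foam.aY, sub_zero]
      module
    rw [e, inner_neg_left] at h
    linarith

end Saddle

/-! ### The surrogates: regularity for FOAM, strong saddle points and their values. -/

section Problem

variable {n d : ℕ} {P : Problem n d} {q : Params}

theorem Problem.Assumptions.hasGradientAt_X (hP : P.Assumptions) (x : E n) (y : E d) :
    HasGradientAt (fun x' => P.f x' y) (gradX P.f x y) x := by
  apply DifferentiableAt.hasGradientAt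
  have h : Differentiable ℝ (fun p : E n × E d => P.f p.1 p.2) :=
    hP.contDiff.differentiable one_ne_zero
  exact (h.comp (differentiable_id.prodMk (differentiable_const y))) x

theorem Problem.Assumptions.hasGradientAt_Y (hP : P.Assumptions) (x : E n) (y : E d) :
    HasGradientAt (fun y' => P.f x y') (gradY P.f x y) y := by
  apply DifferentiableAt.hasGradientAt
  have h : Differentiable ℝ (fun p : E n × E d => P.f p.1 p.2) :=
    hP.contDiff.differentiable one_ne_zero
  exact (h.comp ((differentiable_const x).prodMk differentiable_id)) y

theorem hasDerivAt_segment {k : ℕ} {g : E k → ℝ} {g' x v : E k} {t : ℝ}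
    (h : HasGradientAt g g' (x + t • v)) :
    HasDerivAt (fun t : ℝ => g (x + t • v)) ⟪g', v⟫_ℝ t := by
  have h1 : HasDerivAt (fun t : ℝ => x + t • v) v t := by
    simpa using ((hasDerivAt_id t).smul_const v).const_add x
  have h2 := h.hasFDerivAt.comp_hasDerivAt t h1
  exact h2.congr_deriv (by simp)

/-- Along the segment, which stays in `X`, the gradient changes by at most `ell * t * ‖v‖`; the
quadratic term in `ψ` compensates this, so `ψ` is monotone. -/
theorem Problem.Assumptions.weak_convexity (hP : P.Assumptions) {x x' : E n} {y : E d}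
    (hx : x ∈ P.X) (hx' : x' ∈ P.X) (hy : y ∈ P.Y) :
    P.f x y + ⟪gradX P.f x y, x' - x⟫_ℝ ≤ P.f x' y + P.ell / 2 * ‖x' - x‖ ^ 2 := by
  set v := x' - x
  let ψ : ℝ → ℝ := fun t => P.f (x + t • v) y - t * ⟪gradX P.f x y, v⟫_ℝ +
    P.ell / 2 * ‖v‖ ^ 2 * t ^ 2
  have hderiv : ∀ t, HasDerivAt ψ (⟪gradX P.f (x + t • v) y, v⟫_ℝ - ⟪gradX P.f x y, v⟫_ℝ +
      P.ell * ‖v‖ ^ 2 * t) t := by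
    intro t
    have h1 := hasDerivAt_segment (hP.hasGradientAt_X (x + t • v) y)
    have h2 := (hasDerivAt_id t).mul_const ⟪gradX P.f x y, v⟫_ℝ
    have h3 := (hasDerivAt_pow 2 t).const_mul (P.ell / 2 * ‖v‖ ^ 2)
    refine ((h1.sub h2).add h3).congr_deriv ?_
    simp
    ring
  have hmono : MonotoneOn ψ (Icc 0 1) := by
    refine monotoneOn_of_deriv_nonneg (convex_Icc 0 1)
      (fun t _ => (hderiv t).continuousAt.continuousWithinAt)
      (fun t _ => (hderiv t).differentiableAt.differentiableWithinAt) fun t ht => ?_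
    rw [interior_Icc] at ht
    rw [(hderiv t).deriv, ← inner_sub_left]
    have hmem : x + t • v ∈ P.X := hP.convex_X.add_smul_sub_mem hx hx' ⟨ht.1.le, ht.2.le⟩
    have h1 := hP.lipschitz_gradX _ hmem _ hx _ hy _ hy
    rw [sub_self, norm_zero, add_zero, add_sub_cancel_left, norm_smul, Real.norm_eq_abs,
      abs_of_pos ht.1] at h1
    have h2 := neg_le_of_abs_le ((abs_real_inner_le_norm _ _).trans
      (mul_le_mul_of_nonneg_right h1 (norm_nonneg v)))
    linarith
  have h := hmono (left_mem_Icc.2 zero_le_one) (right_mem_Icc.2 zero_le_one) zero_le_one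
  have e : x + v = x' := by simp [v]
  simp only [ψ, zero_smul, add_zero, one_smul, e] at h
  linarith

theorem Problem.Assumptions.concavity (hP : P.Assumptions) {x : E n} {y y' : E d}
    (hx : x ∈ P.X) (hy : y ∈ P.Y) (hy' : y' ∈ P.Y) :
    P.f x y' ≤ P.f x y + ⟪gradY P.f x y, y' - y⟫_ℝ := by
  set v := y' - y
  have hd : HasDerivAt (fun t : ℝ => P.f x (y + t • v)) ⟪gradY P.f x y, v⟫_ℝ 0 := by
    apply hasDerivAt_segment (g := fun y' => P.f x y')
    simpa using hP.hasGradientAt_Y x y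
  have hc : ConcaveOn ℝ (Icc (0 : ℝ) 1) (fun t : ℝ => P.f x (y + t • v)) := by
    refine ⟨convex_Icc 0 1, fun s hs t ht a b ha hb hab => ?_⟩
    have hms := hP.convex_Y.add_smul_sub_mem hy hy' hs
    have hmt := hP.convex_Y.add_smul_sub_mem hy hy' ht
    have h := (hP.concave x hx).2 hms hmt ha hb hab
    have e : a • (y + s • (y' - y)) + b • (y + t • (y' - y)) = y + (a • s + b • t) • v := by
      have : a • y + b • y = y := by rw [← add_smul, hab, one_smul]
      simp only [smul_eq_mul, v]
      calc _ = (a • y + b • y) + (a * s + b * t) • (y' - y) := by module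
        _ = _ := by rw [this]
    rw [e] at h
    exact h
  have h := hc.slope_le_of_hasDerivAt (left_mem_Icc.2 zero_le_one) (right_mem_Icc.2 zero_le_one)
    zero_lt_one hd
  rw [slope_def_field] at h
  have e : y + v = y' := by simp [v]
  simp only [zero_smul, add_zero, one_smul, e, sub_zero, div_one] at h
  linarith

theorem gradient_const_mul_norm_sq {k : ℕ} (c : ℝ) (z x : E k) :
    HasGradientAt (fun x => c / 2 * ‖x - z‖ ^ 2) (c • (x - z)) x := by
  rw [hasGradientAt_iff_hasFDerivAt]
  have h := ((hasFDerivAt_id x).sub_const z).norm_sq.const_mul (c / 2)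
  refine h.congr_fderiv ?_
  ext v
  simp
  ring

theorem Problem.Assumptions.gradX_surrogate (hP : P.Assumptions) (z x : E n) (y : E d) :
    gradX (P.surrogate q z) x y = gradX P.f x y + q.rx • (x - z) := by
  have h := ((hP.hasGradientAt_X x y).hasFDerivAt.add
    (gradient_const_mul_norm_sq q.rx z x).hasFDerivAt).sub_const (q.ry / 2 * ‖y‖ ^ 2)
  rw [← map_add] at h
  exact (hasGradientAt_iff_hasFDerivAt.2 h).gradient

theorem Problem.Assumptions.gradY_surrogate (hP : P.Assumptions) (z x : E n) (y : E d) :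
    gradY (P.surrogate q z) x y = gradY P.f x y - q.ry • y := by
  have h0 := gradient_const_mul_norm_sq q.ry 0 y
  simp only [sub_zero] at h0
  have h := ((hP.hasGradientAt_Y x y).hasFDerivAt.add_const (q.rx / 2 * ‖x - z‖ ^ 2)).sub
    h0.hasFDerivAt
  rw [← map_sub] at h
  exact (hasGradientAt_iff_hasFDerivAt.2 h).gradient

/-- The convex-concave part of the surrogate. -/
noncomputable def Problem.convexPart (P : Problem n d) (q : Params) (z x : E n) (y : E d) : ℝ :=
  P.f x y + P.ell / 2 * ‖x‖ ^ 2 - q.rx * ⟪z, x⟫_ℝ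

theorem Problem.surrogate_eq (P : Problem n d) (q : Params) (z x : E n) (y : E d) :
    P.surrogate q z x y = P.convexPart q z x y + (q.rx - P.ell) / 2 * ‖x‖ ^ 2 -
      q.ry / 2 * ‖y‖ ^ 2 + q.rx / 2 * ‖z‖ ^ 2 := by
  simp only [Problem.surrogate, Problem.convexPart, norm_sub_sq_real, real_inner_comm z x]
  ring

theorem Problem.Assumptions.nonempty_Y (hP : P.Assumptions) : P.Y.Nonempty := ⟨0, hP.zero_mem_Y⟩

theorem Problem.Assumptions.projX (hP : P.Assumptions) (hX : P.X.Nonempty) :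
    IsProjection P.X (proj P.X) :=
  isProjection_proj hP.closed_X hP.convex_X hX

theorem Problem.Assumptions.projY (hP : P.Assumptions) : IsProjection P.Y (proj P.Y) :=
  isProjection_proj hP.compact_Y.isClosed hP.convex_Y hP.nonempty_Y

theorem Problem.Assumptions.foamRegular (hP : P.Assumptions) (hX : P.X.Nonempty)
    (hrx : P.ell < q.rx) (hry : 0 < q.ry) (z : E n) :
    FoamRegular (P.foam q z) (P.convexPart q z) := by
  have hell := hP.ell_pos
  have pX := hP.projX hX
  have pY := hP.projY
  refine ⟨hP.closed_X, hP.convex_X, hX, hP.compact_Y.isClosed, hP.convex_Y, hP.nonempty_Y,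
    sub_pos.2 hrx, hry, ?_, ?_, ?_, ?_⟩
  · have : 0 ≤ max q.rx q.ry := hry.le.trans (le_max_right _ _)
    simp only [Problem.foam]
    positivity
  · intro x hx x' hx' y hy
    have h := hP.weak_convexity hx hx' hy
    have e := half_norm_sq_expand P.ell x x'
    simp only [Foam.hatX, Problem.foam, Problem.convexPart, pX.eq_self hx, pY.eq_self hy]
    have e1 : gradX P.f x y + q.rx • (x - z) - (q.rx - P.ell) • x =
      gradX P.f x y + P.ell • x - q.rx • z := by module
    rw [e1, inner_sub_left, inner_add_left, inner_smul_left, inner_smul_left, conj_trivial,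
      conj_trivial]
    have e2 : ⟪z, x' - x⟫_ℝ = ⟪z, x'⟫_ℝ - ⟪z, x⟫_ℝ := inner_sub_right _ _ _
    rw [e2]
    linarith
  · intro x hx y hy y' hy'
    have h := hP.concavity hx hy hy'
    simp only [Foam.hatY, Problem.foam, Problem.convexPart, pX.eq_self hx, pY.eq_self hy,
      sub_add_cancel]
    linarith
  · intro x x' y y'
    rw [foam_aX_sub, foam_aY_sub]
    simp only [Foam.hatX, Foam.hatY, Problem.foam, sub_add_cancel]
    have hx1 : ‖proj P.X x - proj P.X x'‖ ≤ ‖x - x'‖ := pX.norm_sub_le x x'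
    have hy1 : ‖proj P.Y y - proj P.Y y'‖ ≤ ‖y - y'‖ := pY.norm_sub_le y y'
    have gx := hP.lipschitz_gradX _ (pX.mem x) _ (pX.mem x') _ (pY.mem y) _ (pY.mem y')
    have gy := hP.lipschitz_gradY _ (pX.mem x) _ (pX.mem x') _ (pY.mem y) _ (pY.mem y')
    have hsum := mul_le_mul_of_nonneg_left (add_le_add hx1 hy1) hell.le
    set c := max q.rx q.ry + (q.rx - P.ell) / 8
    have hc1 : P.ell + (q.rx - P.ell) / 2 ≤ c := by
      have := le_max_left q.rx q.ry
      simp only [c]; linarith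
    have hc2 : q.ry + (q.rx - P.ell) / 8 ≤ c := by
      have := le_max_right q.rx q.ry
      simp only [c]; linarith
    have hc0 : 0 ≤ c := by linarith
    have e1 : gradX P.f (proj P.X x) (proj P.Y y) + q.rx • (x - z) - (q.rx - P.ell) • x -
        (gradX P.f (proj P.X x') (proj P.Y y') + q.rx • (x' - z) - (q.rx - P.ell) • x') +
        ((q.rx - P.ell) / 2) • (x - x') =
        (gradX P.f (proj P.X x) (proj P.Y y) - gradX P.f (proj P.X x') (proj P.Y y')) +
        (P.ell + (q.rx - P.ell) / 2) • (x - x') := by module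
    rw [e1]
    have b1 : ‖(gradX P.f (proj P.X x) (proj P.Y y) - gradX P.f (proj P.X x') (proj P.Y y')) +
        (P.ell + (q.rx - P.ell) / 2) • (x - x')‖ ≤
        P.ell * (‖x - x'‖ + ‖y - y'‖) + c * ‖x - x'‖ := by
      refine (norm_add_le _ _).trans (add_le_add (gx.trans hsum) ?_)
      rw [norm_smul, Real.norm_eq_abs, abs_of_pos (by linarith)]
      gcongr
    have b2 : ‖-(gradY P.f (proj P.X x) (proj P.Y y) - gradY P.f (proj P.X x') (proj P.Y y')) +
        (q.ry + (q.rx - P.ell) / 8) • (y - y')‖ ≤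
        P.ell * (‖x - x'‖ + ‖y - y'‖) + c * ‖y - y'‖ := by
      refine (norm_add_le _ _).trans (add_le_add (by rw [norm_neg]; exact gy.trans hsum) ?_)
      rw [norm_smul, Real.norm_eq_abs, abs_of_pos (by linarith)]
      gcongr
    have e2 : 2 * P.ell + max q.rx q.ry + (q.rx - P.ell) / 8 = 2 * P.ell + c := by
      simp only [c]; ring
    rw [e2]
    refine (add_le_add (pow_le_pow_left₀ (norm_nonneg _) b1 2)
      (pow_le_pow_left₀ (norm_nonneg _) b2 2)).trans ?_
    -- The symmetric matrix with diagonal `ℓ + c` and off-diagonal `ℓ` has norm `2ℓ + c`; the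
    -- deficit is `2ℓ(ℓ + c)` times the square of the difference of the two norms.
    nlinarith [mul_nonneg (mul_nonneg hell.le (add_nonneg hell.le hc0))
      (sq_nonneg (‖x - x'‖ - ‖y - y'‖))]

/-- `(xs, ys)` is a saddle point of the surrogate at `z`, with quadratic growth. -/
structure StrongSaddle (P : Problem n d) (q : Params) (z xs : E n) (ys : E d) : Prop where
  mem_X : xs ∈ P.X
  mem_Y : ys ∈ P.Y
  growth_X : ∀ x ∈ P.X, P.surrogate q z xs ys + (q.rx - P.ell) / 2 * ‖x - xs‖ ^ 2 ≤
    P.surrogate q z x ys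
  growth_Y : ∀ y ∈ P.Y, P.surrogate q z xs y + q.ry / 2 * ‖y - ys‖ ^ 2 ≤ P.surrogate q z xs ys

theorem Problem.Assumptions.strongSaddle (hP : P.Assumptions) (hX : P.X.Nonempty)
    (hrx : P.ell < q.rx) (hry : 0 < q.ry) {z xs : E n} {ys : E d}
    (h : FoamSaddle (P.foam q z) xs ys) : StrongSaddle P q z xs ys := by
  have hA := hP.foamRegular hX hrx hry z
  refine ⟨h.mem_X, h.mem_Y, fun x hx => ?_, fun y hy => ?_⟩
  · have h1 := hA.le_X _ h.mem_X _ hx _ h.mem_Y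
    have h2 := h.normal_X _ hx
    have e := half_norm_sq_expand (q.rx - P.ell) xs x
    rw [inner_sub_left, inner_neg_left, inner_smul_left, conj_trivial] at h2
    change -((q.rx - P.ell) * _) - _ ≤ 0 at h2
    rw [Problem.surrogate_eq, Problem.surrogate_eq]
    linarith
  · have h1 := hA.le_Y _ h.mem_X _ h.mem_Y _ hy
    have h2 := h.normal_Y _ hy
    have e := half_norm_sq_expand q.ry ys y
    rw [inner_add_left, inner_neg_left, inner_smul_left, conj_trivial] at h2
    change -(q.ry * _) + _ ≤ 0 at h2
    rw [Problem.surrogate_eq, Problem.surrogate_eq]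
    linarith

theorem StrongSaddle.isSaddlePointOn (hrx : P.ell < q.rx) (hry : 0 < q.ry) {z xs : E n}
    {ys : E d} (h : StrongSaddle P q z xs ys) :
    IsSaddlePointOn P.X P.Y (P.surrogate q z) xs ys := by
  intro x hx y hy
  have h1 := h.growth_X x hx
  have h2 := h.growth_Y y hy
  have h3 : 0 ≤ (q.rx - P.ell) / 2 * ‖x - xs‖ ^ 2 := by
    have := sub_pos.2 hrx
    positivity
  have h4 : 0 ≤ q.ry / 2 * ‖y - ys‖ ^ 2 := by positivity
  linarith

/-- Used to identify the saddle point quantified in `IsAccurate` with the chosen one. -/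
theorem StrongSaddle.eq_of_isSaddlePointOn (hrx : P.ell < q.rx) (hry : 0 < q.ry) {z xs x : E n}
    {ys y : E d} (h : StrongSaddle P q z xs ys) (hx : x ∈ P.X) (hy : y ∈ P.Y)
    (hs : IsSaddlePointOn P.X P.Y (P.surrogate q z) x y) : x = xs ∧ y = ys := by
  have h1 := h.growth_X x hx
  have h2 := h.growth_Y y hy
  have h0 := hs _ h.mem_X _ h.mem_Y
  have hd := sub_pos.2 hrx
  have h3 : 0 ≤ (q.rx - P.ell) / 2 * ‖x - xs‖ ^ 2 := by positivity
  have h4 : 0 ≤ q.ry / 2 * ‖y - ys‖ ^ 2 := by positivity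
  have h5 : (q.rx - P.ell) / 2 * ‖x - xs‖ ^ 2 = 0 := by linarith
  have h6 : q.ry / 2 * ‖y - ys‖ ^ 2 = 0 := by linarith
  have h7 : (q.rx - P.ell) / 2 ≠ 0 := by positivity
  have h8 : q.ry / 2 ≠ 0 := by positivity
  simp only [mul_eq_zero, h7, h8, false_or] at h5 h6
  exact ⟨by simpa [sub_eq_zero] using h5, by simpa [sub_eq_zero] using h6⟩

/-! ### Values -/

theorem bddAbove_image_of_continuous {Y : Set (E d)} (hY : IsCompact Y) {g : E n → E d → ℝ}
    {x : E n} (hg : Continuous (g x)) : BddAbove (g x '' Y) :=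
  (hY.image hg).bddAbove

theorem le_primal {Y : Set (E d)} (hY : IsCompact Y) {g : E n → E d → ℝ} {x : E n}
    (hg : Continuous (g x)) {y : E d} (hy : y ∈ Y) : g x y ≤ primal Y g x :=
  le_csSup (bddAbove_image_of_continuous hY hg) ⟨y, hy, rfl⟩

theorem primal_le {Y : Set (E d)} (hY : Y.Nonempty) {g : E n → E d → ℝ} {x : E n} {c : ℝ}
    (h : ∀ y ∈ Y, g x y ≤ c) : primal Y g x ≤ c :=
  csSup_le (hY.image _) (by rintro _ ⟨y, hy, rfl⟩; exact h y hy)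

theorem Problem.Assumptions.continuous_f (hP : P.Assumptions) (x : E n) : Continuous (P.f x) :=
  hP.contDiff.continuous.comp (Continuous.prodMk_right x)

theorem Problem.Assumptions.continuous_perturbed (hP : P.Assumptions) (x : E n) :
    Continuous (P.perturbed q x) := by
  have := hP.continuous_f x
  unfold Problem.perturbed
  fun_prop

theorem Problem.Assumptions.primal_surrogate (hP : P.Assumptions) (z x : E n) :
    primal P.Y (P.surrogate q z) x = primal P.Y (P.perturbed q) x + q.rx / 2 * ‖x - z‖ ^ 2 := by
  have hc : Continuous (P.surrogate q z x) := by
    have := hP.continuous_f x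
    unfold Problem.surrogate
    fun_prop
  have e : ∀ y, P.surrogate q z x y = P.perturbed q x y + q.rx / 2 * ‖x - z‖ ^ 2 := by
    intro y; simp only [Problem.surrogate, Problem.perturbed]; ring
  refine le_antisymm (primal_le hP.nonempty_Y fun y hy => ?_) ?_
  · rw [e]
    have := le_primal hP.compact_Y (hP.continuous_perturbed (q := q) x) hy
    linarith
  · rw [← le_sub_iff_add_le]
    refine primal_le hP.nonempty_Y fun y hy => ?_
    have := le_primal hP.compact_Y hc hy
    rw [e] at this
    linarith

theorem Problem.Assumptions.norm_le_diam (hP : P.Assumptions) {y : E d} (hy : y ∈ P.Y) :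
    ‖y‖ ≤ Metric.diam P.Y := by
  have := Metric.dist_le_diam_of_mem hP.compact_Y.isBounded hy hP.zero_mem_Y
  rwa [dist_zero_right] at this

theorem Problem.Assumptions.primal_perturbed_le (hP : P.Assumptions) (hry : 0 < q.ry) (x : E n) :
    primal P.Y (P.perturbed q) x ≤ primal P.Y P.f x := by
  refine primal_le hP.nonempty_Y fun y hy => ?_
  have h1 := le_primal hP.compact_Y (hP.continuous_f x) hy
  have h2 : 0 ≤ q.ry / 2 * ‖y‖ ^ 2 := by positivity
  simp only [Problem.perturbed]
  linarith

theorem Problem.Assumptions.primal_le_perturbed (hP : P.Assumptions) (hry : 0 < q.ry) (x : E n) :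
    primal P.Y P.f x ≤ primal P.Y (P.perturbed q) x + q.ry / 2 * Metric.diam P.Y ^ 2 := by
  refine primal_le hP.nonempty_Y fun y hy => ?_
  have h1 := le_primal hP.compact_Y (hP.continuous_perturbed (q := q) x) hy
  have h2 : q.ry / 2 * ‖y‖ ^ 2 ≤ q.ry / 2 * Metric.diam P.Y ^ 2 := by
    have := hP.norm_le_diam hy
    gcongr
  simp only [Problem.perturbed] at h1
  linarith

theorem StrongSaddle.growth (hP : P.Assumptions) {z xs x : E n}
    {ys : E d} (h : StrongSaddle P q z xs ys) (hx : x ∈ P.X) :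
    P.surrogate q z xs ys + (q.rx - P.ell) / 2 * ‖x - xs‖ ^ 2 ≤
      primal P.Y (P.perturbed q) x + q.rx / 2 * ‖x - z‖ ^ 2 := by
  rw [← hP.primal_surrogate]
  have hc : Continuous (P.surrogate q z x) := by
    have := hP.continuous_f x
    unfold Problem.surrogate
    fun_prop
  exact (h.growth_X x hx).trans (le_primal hP.compact_Y hc h.mem_Y)

theorem StrongSaddle.primal_eq (hP : P.Assumptions) (hrx : P.ell < q.rx) (hry : 0 < q.ry)
    {z xs : E n} {ys : E d} (h : StrongSaddle P q z xs ys) :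
    primal P.Y (P.perturbed q) xs + q.rx / 2 * ‖xs - z‖ ^ 2 = P.surrogate q z xs ys := by
  refine le_antisymm ?_ ?_
  · rw [← hP.primal_surrogate]
    refine primal_le hP.nonempty_Y fun y hy => ?_
    exact h.isSaddlePointOn hrx hry _ h.mem_X _ hy
  · have := h.growth hP h.mem_X
    simpa using this

theorem StrongSaddle.proxValue_eq (hP : P.Assumptions) (hrx : P.ell < q.rx) (hry : 0 < q.ry)
    {z xs : E n} {ys : E d} (h : StrongSaddle P q z xs ys) :
    P.proxValue q z = P.surrogate q z xs ys := by
  have hlow : ∀ v ∈ primal P.Y (P.surrogate q z) '' P.X, P.surrogate q z xs ys ≤ v := by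
    rintro _ ⟨x, hx, rfl⟩
    have h1 := h.growth hP hx
    have h3 : 0 ≤ (q.rx - P.ell) / 2 * ‖x - xs‖ ^ 2 := by
      have := sub_pos.2 hrx
      positivity
    rw [hP.primal_surrogate]
    linarith
  have hmem : P.surrogate q z xs ys ∈ primal P.Y (P.surrogate q z) '' P.X :=
    ⟨xs, h.mem_X, by rw [hP.primal_surrogate, h.primal_eq hP hrx hry]⟩
  exact IsLeast.csInf_eq ⟨hmem, hlow⟩

end Problem

/-! ### Descent of the proximal value along Perturbed Smoothed FOAM. -/

section OuterLoop

variable {n d : ℕ} {P : Problem n d} {q : Params}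

theorem StrongSaddle.isAccurate (hrx : P.ell < q.rx) (hry : 0 < q.ry) {z xs x : E n}
    {ys y : E d} (h : StrongSaddle P q z xs ys) (hd : ‖x - xs‖ ^ 2 + ‖y - ys‖ ^ 2 ≤ q.δ) :
    P.IsAccurate q z x y :=
  ⟨xs, h.mem_X, ys, h.mem_Y, h.isSaddlePointOn hrx hry, hd⟩

theorem StrongSaddle.dist_of_isAccurate (hrx : P.ell < q.rx) (hry : 0 < q.ry) {z xs x : E n}
    {ys y : E d} (h : StrongSaddle P q z xs ys) (ha : P.IsAccurate q z x y) :
    ‖x - xs‖ ^ 2 + ‖y - ys‖ ^ 2 ≤ q.δ := by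
  obtain ⟨x', hx', y', hy', hs, hd⟩ := ha
  obtain ⟨rfl, rfl⟩ := h.eq_of_isSaddlePointOn hrx hry hx' hy' hs
  exact hd

/-- A problem with admissible parameters and an initial point. -/
structure Run (P : Problem n d) (q : Params) (x₀ : E n) (y₀ : E d) : Prop where
  assum : P.Assumptions
  bdd : BddBelow (primal P.Y P.f '' P.X)
  memX : x₀ ∈ P.X
  memY : y₀ ∈ P.Y
  rx_gt : 3 * P.ell < q.rx
  ry_pos : 0 < q.ry
  ry_le : q.ry ≤ P.ell
  β_pos : 0 < q.β
  β_lt : q.β < 1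
  δ_pos : 0 < q.δ

variable {x₀ : E n} {y₀ : E d} {z₀ : E n}

theorem Run.ell_lt (h : Run P q x₀ y₀) : P.ell < q.rx := by
  have := h.assum.ell_pos
  have := h.rx_gt
  linarith

theorem Run.regular (h : Run P q x₀ y₀) (z : E n) :
    FoamRegular (P.foam q z) (P.convexPart q z) :=
  h.assum.foamRegular ⟨_, h.memX⟩ h.ell_lt h.ry_pos z

/-- A choice of the saddle points of all the surrogates. -/
def SaddleMap (P : Problem n d) (q : Params) (sx : E n → E n) (sy : E n → E d) : Prop :=
  ∀ z, FoamSaddle (P.foam q z) (sx z) (sy z)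

theorem Run.exists_saddleMap (h : Run P q x₀ y₀) : ∃ sx sy, SaddleMap P q sx sy := by
  choose sx sy hs using fun z => (h.regular z).exists_saddle
  exact ⟨sx, sy, hs⟩

variable {sx : E n → E n} {sy : E n → E d}

theorem Run.strong (h : Run P q x₀ y₀) (hs : SaddleMap P q sx sy) (z : E n) :
    StrongSaddle P q z (sx z) (sy z) :=
  h.assum.strongSaddle ⟨_, h.memX⟩ h.ell_lt h.ry_pos (hs z)

/-- The step parameters and moduli of `P.foam q z` do not depend on `z`, so the bounds are written
at `z = 0` and are uniform over the outer loop. -/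
theorem Run.foam_cost (h : Run P q x₀ y₀) (hs : SaddleMap P q sx sy) (z : E n) {x : E n} {y : E d}
    (hx : x ∈ P.X) (hy : y ∈ P.Y) {Q : ℝ} (hQ : 0 < Q)
    (hQ' : 221 * ((q.rx - P.ell) / ((P.foam q 0).alpha * q.ry)) *
      (‖x - sx z‖ ^ 2 + ‖y - sy z‖ ^ 2) ≤ q.δ * Q) :
    ∃ N : ℕ, (P.foam q z).cost (P.IsAccurate q z) x y = (N : ℕ∞) ∧
      N ≤ (⌈2 / (P.foam q 0).alpha * Real.log Q⌉₊ + 2) *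
        (2 + 2 * ⌈18 * (2 * √5 * (1 + 8 * (P.foam q 0).L / (q.rx - P.ell)))⌉₊) ∧
      P.IsAccurate q z ((P.foam q z).output (P.IsAccurate q z) x y).1
        ((P.foam q z).output (P.IsAccurate q z) x y).2 ∧
      ((P.foam q z).output (P.IsAccurate q z) x y).1 ∈ P.X ∧
      ((P.foam q z).output (P.IsAccurate q z) x y).2 ∈ P.Y := by
  refine (h.regular z).exists_cost (hs z) ?_ hx hy h.δ_pos
    (fun x y => (h.strong hs z).isAccurate h.ell_lt h.ry_pos) hQ hQ'
  have h1 := h.ry_le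
  have h2 := h.rx_gt
  have h3 := h.assum.ell_pos
  simp only [Problem.foam]
  linarith

theorem Run.foam_output (h : Run P q x₀ y₀) (hs : SaddleMap P q sx sy) (z : E n) {x : E n}
    {y : E d} (hx : x ∈ P.X) (hy : y ∈ P.Y) :
    P.IsAccurate q z ((P.foam q z).output (P.IsAccurate q z) x y).1
        ((P.foam q z).output (P.IsAccurate q z) x y).2 ∧
      ((P.foam q z).output (P.IsAccurate q z) x y).1 ∈ P.X ∧
      ((P.foam q z).output (P.IsAccurate q z) x y).2 ∈ P.Y := by
  have hα : 0 < (P.foam q 0).alpha := (h.regular 0).alpha_pos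
  have h1 := sub_pos.2 h.ell_lt
  have h2 := h.ry_pos
  have h3 := h.δ_pos
  set e := 221 * ((q.rx - P.ell) / ((P.foam q 0).alpha * q.ry)) *
      (‖x - sx z‖ ^ 2 + ‖y - sy z‖ ^ 2) with he
  have he0 : 0 ≤ e := by positivity
  obtain ⟨N, -, -, h⟩ := h.foam_cost hs z hx hy (Q := e / q.δ + 1) (by positivity) (by
    rw [← he, mul_add, mul_div_cancel₀ _ h3.ne']
    linarith)
  exact h

theorem Run.iter_mem (h : Run P q x₀ y₀) (hs : SaddleMap P q sx sy) (t : ℕ) :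
    (P.iter q x₀ y₀ z₀ t).1 ∈ P.X ∧ (P.iter q x₀ y₀ z₀ t).2.1 ∈ P.Y := by
  induction t with
  | zero => exact ⟨h.memX, h.memY⟩
  | succ t ih => exact (h.foam_output hs _ ih.1 ih.2).2

theorem Run.iter_accurate (h : Run P q x₀ y₀) (hs : SaddleMap P q sx sy) (t : ℕ) :
    ‖(P.iter q x₀ y₀ z₀ (t + 1)).1 - sx (P.iter q x₀ y₀ z₀ t).2.2‖ ^ 2 +
      ‖(P.iter q x₀ y₀ z₀ (t + 1)).2.1 - sy (P.iter q x₀ y₀ z₀ t).2.2‖ ^ 2 ≤ q.δ := by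
  have hm := h.iter_mem hs (z₀ := z₀) t
  exact (h.strong hs _).dist_of_isAccurate h.ell_lt h.ry_pos (h.foam_output hs _ hm.1 hm.2).1

theorem Run.minimaxValue_le (h : Run P q x₀ y₀) {x : E n} (hx : x ∈ P.X) :
    minimaxValue P.X P.Y (P.perturbed q) ≤ primal P.Y (P.perturbed q) x := by
  refine csInf_le ?_ ⟨x, hx, rfl⟩
  obtain ⟨c, hc⟩ := h.bdd
  refine ⟨c - q.ry / 2 * Metric.diam P.Y ^ 2, ?_⟩
  rintro _ ⟨x, hx, rfl⟩
  have h1 := hc ⟨x, hx, rfl⟩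
  have h2 := h.assum.primal_le_perturbed h.ry_pos x
  linarith

theorem Run.proxValue_eq (h : Run P q x₀ y₀) (hs : SaddleMap P q sx sy) (z : E n) :
    P.proxValue q z = primal P.Y (P.perturbed q) (sx z) + q.rx / 2 * ‖sx z - z‖ ^ 2 := by
  rw [(h.strong hs z).proxValue_eq h.assum h.ell_lt h.ry_pos,
    (h.strong hs z).primal_eq h.assum h.ell_lt h.ry_pos]

theorem Run.proxValue_growth (h : Run P q x₀ y₀) (hs : SaddleMap P q sx sy) (z : E n) {x : E n}
    (hx : x ∈ P.X) : P.proxValue q z + (q.rx - P.ell) / 2 * ‖x - sx z‖ ^ 2 ≤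
      primal P.Y (P.perturbed q) x + q.rx / 2 * ‖x - z‖ ^ 2 := by
  rw [(h.strong hs z).proxValue_eq h.assum h.ell_lt h.ry_pos]
  exact (h.strong hs z).growth h.assum hx

theorem Run.rx_pos (h : Run P q x₀ y₀) : 0 < q.rx := h.assum.ell_pos.trans h.ell_lt

theorem Run.minimaxValue_le_proxValue (h : Run P q x₀ y₀) (hs : SaddleMap P q sx sy) (z : E n) :
    minimaxValue P.X P.Y (P.perturbed q) ≤ P.proxValue q z := by
  rw [h.proxValue_eq hs]
  have h1 := h.minimaxValue_le (h.strong hs z).mem_X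
  have h2 : 0 ≤ q.rx / 2 * ‖sx z - z‖ ^ 2 := by
    have := h.rx_pos
    positivity
  linarith

theorem norm_sq_convex_comb_le {V : Type*} [NormedAddCommGroup V] [InnerProductSpace ℝ V] {β : ℝ}
    (h0 : 0 ≤ β) (h1 : β ≤ 1) (u v : V) :
    ‖(1 - β) • u + β • v‖ ^ 2 ≤ (1 - β) * ‖u‖ ^ 2 + β * ‖v‖ ^ 2 := by
  have h2 : 0 ≤ (1 - β) * β * ‖u - v‖ ^ 2 := by
    have := sub_nonneg.2 h1
    positivity
  simp only [← real_inner_self_eq_norm_sq, inner_sub_left, inner_sub_right, inner_smul_left,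
    inner_smul_right, inner_add_left, inner_add_right, conj_trivial] at *
  linarith [real_inner_comm u v]

/-- The saddle point at `z_t`, tested in the surrogate at `z_{t+1}`. -/
theorem Run.drift (h : Run P q x₀ y₀) (hs : SaddleMap P q sx sy) (t : ℕ) :
    P.proxValue q (P.iter q x₀ y₀ z₀ (t + 1)).2.2 + (q.rx - P.ell) / 2 *
      ‖sx (P.iter q x₀ y₀ z₀ t).2.2 - sx (P.iter q x₀ y₀ z₀ (t + 1)).2.2‖ ^ 2 +
      q.rx * q.β / 2 * ‖sx (P.iter q x₀ y₀ z₀ t).2.2 - (P.iter q x₀ y₀ z₀ t).2.2‖ ^ 2 ≤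
    P.proxValue q (P.iter q x₀ y₀ z₀ t).2.2 + q.rx * q.β / 2 * q.δ := by
  have hacc := h.iter_accurate hs (z₀ := z₀) t
  have hz : (P.iter q x₀ y₀ z₀ (t + 1)).2.2 = (P.iter q x₀ y₀ z₀ t).2.2 +
    q.β • ((P.iter q x₀ y₀ z₀ (t + 1)).1 - (P.iter q x₀ y₀ z₀ t).2.2) := rfl
  set z := (P.iter q x₀ y₀ z₀ t).2.2
  set z' := (P.iter q x₀ y₀ z₀ (t + 1)).2.2
  set x' := (P.iter q x₀ y₀ z₀ (t + 1)).1
  have h1 := h.proxValue_growth hs z' (h.strong hs z).mem_X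
  have h2 := h.proxValue_eq hs z
  have h3 : ‖sx z - z'‖ ^ 2 ≤ (1 - q.β) * ‖sx z - z‖ ^ 2 + q.β * ‖sx z - x'‖ ^ 2 := by
    have e : sx z - z' = (1 - q.β) • (sx z - z) + q.β • (sx z - x') := by rw [hz]; module
    rw [e]
    exact norm_sq_convex_comb_le h.β_pos.le h.β_lt.le _ _
  have h4 : ‖sx z - x'‖ ^ 2 ≤ q.δ := by
    rw [norm_sub_rev]
    exact le_trans (le_add_of_nonneg_right (sq_nonneg _)) hacc
  have h5 := mul_le_mul_of_nonneg_left h4 h.β_pos.le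
  have h6 := mul_le_mul_of_nonneg_left (h3.trans (add_le_add_right h5 _))
    (show 0 ≤ q.rx / 2 by have := h.rx_pos; positivity)
  linarith

theorem Run.proxValue_iter_le (h : Run P q x₀ y₀) (hs : SaddleMap P q sx sy) (T : ℕ) :
    P.proxValue q (P.iter q x₀ y₀ z₀ T).2.2 + q.rx * q.β / 2 * ∑ t ∈ Finset.range T,
      ‖sx (P.iter q x₀ y₀ z₀ t).2.2 - (P.iter q x₀ y₀ z₀ t).2.2‖ ^ 2 ≤
      P.proxValue q z₀ + T * (q.rx * q.β / 2 * q.δ) := by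
  induction T with
  | zero => simp [Problem.iter]
  | succ T ih =>
    have h1 := h.drift hs (z₀ := z₀) T
    have h2 : 0 ≤ (q.rx - P.ell) / 2 *
        ‖sx (P.iter q x₀ y₀ z₀ T).2.2 - sx (P.iter q x₀ y₀ z₀ (T + 1)).2.2‖ ^ 2 := by
      have := sub_pos.2 h.ell_lt
      positivity
    rw [Finset.sum_range_succ]
    push_cast
    linarith

/-- Otherwise the sum of the `T` squared residuals would push the proximal value below the minimax
value. The added `δ` balances exactly the accumulated inexactness. -/
theorem Run.exists_small_residual (h : Run P q x₀ y₀) (hs : SaddleMap P q sx sy) {T : ℕ}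
    (hT : 0 < T) : ∃ t < T,
      ‖sx (P.iter q x₀ y₀ z₀ t).2.2 - (P.iter q x₀ y₀ z₀ t).2.2‖ ^ 2 ≤
        2 * P.gap q z₀ / (q.rx * q.β * T) + q.δ := by
  by_contra! hcon
  have h1 := h.proxValue_iter_le hs (z₀ := z₀) T
  have h2 := h.minimaxValue_le_proxValue hs (P.iter q x₀ y₀ z₀ T).2.2
  have hrβ : 0 < q.rx * q.β := mul_pos h.rx_pos h.β_pos
  have hT' : (0 : ℝ) < T := by exact_mod_cast hT
  have h3 : ∑ t ∈ Finset.range T, (2 * P.gap q z₀ / (q.rx * q.β * T) + q.δ) <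
      ∑ t ∈ Finset.range T,
        ‖sx (P.iter q x₀ y₀ z₀ t).2.2 - (P.iter q x₀ y₀ z₀ t).2.2‖ ^ 2 :=
    Finset.sum_lt_sum_of_nonempty ⟨0, Finset.mem_range.2 hT⟩
      fun t ht => hcon t (Finset.mem_range.1 ht)
  rw [Finset.sum_const, Finset.card_range, nsmul_eq_mul] at h3
  have h4 := mul_lt_mul_of_pos_left h3 (show 0 < q.rx * q.β / 2 by positivity)
  have h5 : q.rx * q.β / 2 * (T * (2 * P.gap q z₀ / (q.rx * q.β * T) + q.δ)) =
      P.gap q z₀ + T * (q.rx * q.β / 2 * q.δ) := by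
    have hr := h.rx_pos.ne'
    have hb := h.β_pos.ne'
    field_simp
  rw [h5] at h4
  simp only [Problem.gap] at h4
  linarith

/-- A bound for the initial error of each call of FOAM. -/
theorem Run.start_dist_le (h : Run P q x₀ y₀) (hs : SaddleMap P q sx sy) (t : ℕ) :
    ‖(P.iter q x₀ y₀ z₀ t).1 - sx (P.iter q x₀ y₀ z₀ t).2.2‖ ^ 2 +
      ‖(P.iter q x₀ y₀ z₀ t).2.1 - sy (P.iter q x₀ y₀ z₀ t).2.2‖ ^ 2 ≤
    Metric.diam P.Y ^ 2 + 2 * q.δ + 4 / (q.rx - P.ell) *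
      (primal P.Y (P.perturbed q) x₀ + q.rx / 2 * ‖x₀ - z₀‖ ^ 2 -
        minimaxValue P.X P.Y (P.perturbed q) + t * (q.rx * q.β / 2 * q.δ)) := by
  have hr := sub_pos.2 h.ell_lt
  have hδ := h.δ_pos
  have hrx := h.rx_pos
  have hβ := h.β_pos
  have hy : ‖(P.iter q x₀ y₀ z₀ t).2.1 - sy (P.iter q x₀ y₀ z₀ t).2.2‖ ^ 2 ≤
      Metric.diam P.Y ^ 2 := by
    have := Metric.dist_le_diam_of_mem h.assum.compact_Y.isBounded
      (h.iter_mem hs (z₀ := z₀) t).2 (h.strong hs (P.iter q x₀ y₀ z₀ t).2.2).mem_Y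
    rw [dist_eq_norm] at this
    gcongr
  have h0 := h.proxValue_growth hs z₀ h.memX
  have hm0 := h.minimaxValue_le_proxValue hs z₀
  have hn0 : 0 ≤ (q.rx - P.ell) / 2 * ‖x₀ - sx z₀‖ ^ 2 := by positivity
  set B := primal P.Y (P.perturbed q) x₀ + q.rx / 2 * ‖x₀ - z₀‖ ^ 2 -
        minimaxValue P.X P.Y (P.perturbed q)
  have hB : (q.rx - P.ell) / 2 * ‖x₀ - sx z₀‖ ^ 2 ≤ B := by simp only [B]; linarith
  have hB0 : 0 ≤ B := hn0.trans hB
  suffices hx : ‖(P.iter q x₀ y₀ z₀ t).1 - sx (P.iter q x₀ y₀ z₀ t).2.2‖ ^ 2 ≤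
      2 * q.δ + 4 / (q.rx - P.ell) * (B + t * (q.rx * q.β / 2 * q.δ)) by linarith
  cases t with
  | zero =>
    change ‖x₀ - sx z₀‖ ^ 2 ≤ _
    have h1 : ‖x₀ - sx z₀‖ ^ 2 ≤ 2 / (q.rx - P.ell) * B := by
      have := mul_le_mul_of_nonneg_left hB (show 0 ≤ 2 / (q.rx - P.ell) by positivity)
      have e : 2 / (q.rx - P.ell) * ((q.rx - P.ell) / 2 * ‖x₀ - sx z₀‖ ^ 2) =
        ‖x₀ - sx z₀‖ ^ 2 := by field_simp
      linarith
    have h2 : 2 / (q.rx - P.ell) * B ≤ 4 / (q.rx - P.ell) * B := by gcongr; norm_num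
    simp only [Nat.cast_zero, zero_mul, add_zero]
    linarith
  | succ t =>
    have h1 := h.drift hs (z₀ := z₀) t
    have h2 := h.proxValue_iter_le hs (z₀ := z₀) t
    have h3 := h.minimaxValue_le_proxValue hs (P.iter q x₀ y₀ z₀ (t + 1)).2.2
    have hacc := h.iter_accurate hs (z₀ := z₀) t
    set z := (P.iter q x₀ y₀ z₀ t).2.2
    set z' := (P.iter q x₀ y₀ z₀ (t + 1)).2.2
    set x' := (P.iter q x₀ y₀ z₀ (t + 1)).1
    have h4 : 0 ≤ q.rx * q.β / 2 * ∑ t ∈ Finset.range t,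
      ‖sx (P.iter q x₀ y₀ z₀ t).2.2 - (P.iter q x₀ y₀ z₀ t).2.2‖ ^ 2 := by positivity
    have h5 : 0 ≤ q.rx * q.β / 2 * ‖sx z - z‖ ^ 2 := by positivity
    -- Warm starts are good because the growth term in `drift` bounds the motion of the saddle point
    -- by the total decrease of the proximal value.
    have h6 : (q.rx - P.ell) / 2 * ‖sx z - sx z'‖ ^ 2 ≤
        B + ((t + 1 : ℕ) : ℝ) * (q.rx * q.β / 2 * q.δ) := by
      push_cast
      simp only [B]
      linarith
    set C := B + ((t + 1 : ℕ) : ℝ) * (q.rx * q.β / 2 * q.δ)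
    have h7 : ‖sx z - sx z'‖ ^ 2 ≤ 2 / (q.rx - P.ell) * C := by
      have := mul_le_mul_of_nonneg_left h6 (show 0 ≤ 2 / (q.rx - P.ell) by positivity)
      have e : 2 / (q.rx - P.ell) * ((q.rx - P.ell) / 2 * ‖sx z - sx z'‖ ^ 2) =
        ‖sx z - sx z'‖ ^ 2 := by field_simp
      linarith
    have h8 : ‖x' - sx z‖ ^ 2 ≤ q.δ := le_trans (le_add_of_nonneg_right (sq_nonneg _)) hacc
    have h9 : ‖x' - sx z'‖ ^ 2 ≤ 2 * ‖x' - sx z‖ ^ 2 + 2 * ‖sx z - sx z'‖ ^ 2 := by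
      have := norm_sub_le_norm_sub_add_norm_sub x' (sx z) (sx z')
      calc _ ≤ (‖x' - sx z‖ + ‖sx z - sx z'‖) ^ 2 := by gcongr
        _ ≤ _ := by nlinarith [sq_nonneg (‖x' - sx z‖ - ‖sx z - sx z'‖)]
    have e : 4 / (q.rx - P.ell) * C = 2 * (2 / (q.rx - P.ell) * C) := by ring
    rw [e]
    linarith

/-- The outer loop: some iterate among the first `T` has a small residual, at bounded cost. -/
theorem Run.exists_iterate (h : Run P q x₀ y₀) (hs : SaddleMap P q sx sy) {T : ℕ} (hT : 0 < T)
    {Q : ℝ} (hQ : 0 < Q)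
    (hQ' : 221 * ((q.rx - P.ell) / ((P.foam q 0).alpha * q.ry)) *
      (Metric.diam P.Y ^ 2 + 2 * q.δ + 4 / (q.rx - P.ell) *
      (primal P.Y (P.perturbed q) x₀ + q.rx / 2 * ‖x₀ - z₀‖ ^ 2 -
        minimaxValue P.X P.Y (P.perturbed q) + T * (q.rx * q.β / 2 * q.δ))) ≤ q.δ * Q) :
    ∃ t N : ℕ, P.totalCost q x₀ y₀ z₀ t = (N : ℕ∞) ∧
      N ≤ T * ((⌈2 / (P.foam q 0).alpha * Real.log Q⌉₊ + 2) *
        (2 + 2 * ⌈18 * (2 * √5 * (1 + 8 * (P.foam q 0).L / (q.rx - P.ell)))⌉₊)) + 1 ∧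
      ‖sx (P.iter q x₀ y₀ z₀ t).2.2 - (P.iter q x₀ y₀ z₀ t).2.2‖ ^ 2 ≤
        2 * P.gap q z₀ / (q.rx * q.β * T) + q.δ := by
  obtain ⟨t, htT, ht⟩ := h.exists_small_residual hs (z₀ := z₀) hT
  have hcost : ∀ s, s ≤ t → ∃ N : ℕ, P.iterCost q x₀ y₀ z₀ s = (N : ℕ∞) ∧
      N ≤ (⌈2 / (P.foam q 0).alpha * Real.log Q⌉₊ + 2) *
        (2 + 2 * ⌈18 * (2 * √5 * (1 + 8 * (P.foam q 0).L / (q.rx - P.ell)))⌉₊) := by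
    intro s hst
    have hm := h.iter_mem hs (z₀ := z₀) s
    obtain ⟨N, hN, hNle, -⟩ := h.foam_cost hs (P.iter q x₀ y₀ z₀ s).2.2 hm.1 hm.2 hQ (by
      refine le_trans ?_ hQ'
      have hα : 0 < (P.foam q 0).alpha := (h.regular 0).alpha_pos
      have hr := sub_pos.2 h.ell_lt
      have hry := h.ry_pos
      have hrx := h.rx_pos
      have hβ := h.β_pos
      have hδ := h.δ_pos
      have hsT : (s : ℝ) ≤ T := by exact_mod_cast hst.trans htT.le
      refine mul_le_mul_of_nonneg_left ((h.start_dist_le hs s).trans ?_) (by positivity)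
      gcongr)
    exact ⟨N, hN, hNle⟩
  have hcost' : ∀ s, ∃ N : ℕ, s ≤ t → P.iterCost q x₀ y₀ z₀ s = (N : ℕ∞) ∧
      N ≤ (⌈2 / (P.foam q 0).alpha * Real.log Q⌉₊ + 2) *
        (2 + 2 * ⌈18 * (2 * √5 * (1 + 8 * (P.foam q 0).L / (q.rx - P.ell)))⌉₊) := by
    intro s
    by_cases hst : s ≤ t
    · obtain ⟨N, hN⟩ := hcost s hst
      exact ⟨N, fun _ => hN⟩
    · exact ⟨0, fun h => absurd h hst⟩
  choose Ns hNs using hcost'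
  refine ⟨t, ∑ s ∈ Finset.range (t + 1), Ns s + 1, ?_, ?_, ht⟩
  · rw [Problem.totalCost, Finset.sum_congr rfl fun s hs' =>
      (hNs s (Nat.lt_succ_iff.1 (Finset.mem_range.1 hs'))).1]
    push_cast
    rfl
  · refine Nat.add_le_add_right ((Finset.sum_le_card_nsmul _ _ _ fun s hs' =>
      (hNs s (Nat.lt_succ_iff.1 (Finset.mem_range.1 hs'))).2).trans ?_) 1
    rw [Finset.card_range, smul_eq_mul]
    exact Nat.mul_le_mul_right _ htT

end OuterLoop

/-! ### From a small proximal residual to stationarity of the candidate. -/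

section Stationarity

variable {n d : ℕ} {P : Problem n d} {q : Params} {x₀ : E n} {y₀ : E d} {z₀ : E n}
  {sx : E n → E n} {sy : E n → E d}

/-- A projected gradient step from a point near a solution of the variational inequality stays near
the solution, and its residual is a normal vector. -/
theorem projected_step {k : ℕ} {S : Set (E k)} {Pi : E k → E k} (hPi : IsProjection S Pi)
    {a η : ℝ} (ha : 0 < a) {x g xs gs : E k} (hxs : xs ∈ S)
    (hvi : ∀ x' ∈ S, 0 ≤ ⟪gs, x' - xs⟫_ℝ) (hg : a * ‖g - gs‖ ≤ 2 * η) (hx : ‖x - xs‖ ≤ η) :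
    ‖Pi (x - a • g) - xs‖ ≤ 3 * η ∧ ‖x - Pi (x - a • g)‖ ≤ 4 * η ∧
      a⁻¹ • (x - Pi (x - a • g)) - g ∈ normalCone S (Pi (x - a • g)) := by
  have h1 : ‖Pi (x - a • g) - xs‖ ≤ ‖x - a • g - (xs - a • gs)‖ := by
    apply norm_sub_le_of_inner_le (hPi.inner_le _ _ hxs)
    have := mul_nonneg ha.le (hvi _ (hPi.mem (x - a • g)))
    rw [sub_sub_cancel_left, inner_neg_left, inner_smul_left, conj_trivial]
    linarith
  have h2 : ‖x - a • g - (xs - a • gs)‖ ≤ ‖x - xs‖ + a * ‖g - gs‖ := by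
    have e : x - a • g - (xs - a • gs) = (x - xs) - a • (g - gs) := by module
    rw [e]
    refine (norm_sub_le _ _).trans ?_
    rw [norm_smul, Real.norm_eq_abs, abs_of_pos ha]
  have h3 : ‖Pi (x - a • g) - xs‖ ≤ 3 * η := by linarith
  refine ⟨h3, ?_, fun x' hx' => ?_⟩
  · have := norm_sub_le_norm_sub_add_norm_sub x xs (Pi (x - a • g))
    rw [norm_sub_rev xs] at this
    linarith
  · have h4 := mul_nonpos_of_nonneg_of_nonpos (inv_pos.2 ha).le (hPi.inner_le (x - a • g) _ hx')
    have e : a⁻¹ • (x - Pi (x - a • g)) - g = a⁻¹ • (x - a • g - Pi (x - a • g)) := by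
      have : a⁻¹ • a • g = g := inv_smul_smul₀ ha.ne' g
      rw [smul_sub, smul_sub, smul_sub, this]
      abel
    rw [e, inner_smul_left, conj_trivial]
    exact h4

/-- The estimates for the candidate with index `t`, where `η` bounds the error of the subproblem. -/
theorem Run.candidate_spec (h : Run P q x₀ y₀) (hs : SaddleMap P q sx sy) {a c : ℝ}
    (ha : 0 < a) (ha' : a ≤ 1 / (q.rx + P.ell)) (hc : 0 < c) (hc' : c ≤ 1 / (q.ry + P.ell))
    (t : ℕ) :
    ‖(P.candidate q a c x₀ y₀ z₀ t).1 - sx (P.iter q x₀ y₀ z₀ t).2.2‖ ≤ 3 * √q.δ ∧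
    ‖(P.iter q x₀ y₀ z₀ (t + 1)).1 - (P.candidate q a c x₀ y₀ z₀ t).1‖ ≤ 4 * √q.δ ∧
    ‖(P.iter q x₀ y₀ z₀ (t + 1)).2.1 - (P.candidate q a c x₀ y₀ z₀ t).2‖ ≤ 4 * √q.δ ∧
    a⁻¹ • ((P.iter q x₀ y₀ z₀ (t + 1)).1 - (P.candidate q a c x₀ y₀ z₀ t).1) -
      (gradX P.f (P.iter q x₀ y₀ z₀ (t + 1)).1 (P.iter q x₀ y₀ z₀ (t + 1)).2.1 +
        q.rx • ((P.iter q x₀ y₀ z₀ (t + 1)).1 - (P.iter q x₀ y₀ z₀ t).2.2)) ∈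
      normalCone P.X (P.candidate q a c x₀ y₀ z₀ t).1 ∧
    c⁻¹ • ((P.iter q x₀ y₀ z₀ (t + 1)).2.1 - (P.candidate q a c x₀ y₀ z₀ t).2) -
      -(gradY P.f (P.iter q x₀ y₀ z₀ (t + 1)).1 (P.iter q x₀ y₀ z₀ (t + 1)).2.1 -
        q.ry • (P.iter q x₀ y₀ z₀ (t + 1)).2.1) ∈
      normalCone P.Y (P.candidate q a c x₀ y₀ z₀ t).2 := by
  have hacc := h.iter_accurate hs (z₀ := z₀) t
  have hm := h.iter_mem hs (z₀ := z₀) (t + 1)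
  have hsad := hs (P.iter q x₀ y₀ z₀ t).2.2
  have hcand : P.candidate q a c x₀ y₀ z₀ t =
      (proj P.X ((P.iter q x₀ y₀ z₀ (t + 1)).1 - a • (gradX P.f (P.iter q x₀ y₀ z₀ (t + 1)).1
        (P.iter q x₀ y₀ z₀ (t + 1)).2.1 + q.rx • ((P.iter q x₀ y₀ z₀ (t + 1)).1 -
          (P.iter q x₀ y₀ z₀ t).2.2))),
       proj P.Y ((P.iter q x₀ y₀ z₀ (t + 1)).2.1 - c • -(gradY P.f (P.iter q x₀ y₀ z₀ (t + 1)).1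
        (P.iter q x₀ y₀ z₀ (t + 1)).2.1 - q.ry • (P.iter q x₀ y₀ z₀ (t + 1)).2.1))) := by
    simp only [Problem.candidate, h.assum.gradX_surrogate, h.assum.gradY_surrogate, smul_neg,
      sub_neg_eq_add]
  set z := (P.iter q x₀ y₀ z₀ t).2.2
  set x := (P.iter q x₀ y₀ z₀ (t + 1)).1
  set y := (P.iter q x₀ y₀ z₀ (t + 1)).2.1
  have hell := h.assum.ell_pos
  have hrx := h.rx_pos
  have hry := h.ry_pos
  have hδ := h.δ_pos
  have pX := h.assum.projX ⟨_, h.memX⟩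
  have pY := h.assum.projY
  have hx : ‖x - sx z‖ ≤ √q.δ :=
    Real.le_sqrt_of_sq_le ((le_add_of_nonneg_right (sq_nonneg _)).trans hacc)
  have hy : ‖y - sy z‖ ≤ √q.δ :=
    Real.le_sqrt_of_sq_le ((le_add_of_nonneg_left (sq_nonneg _)).trans hacc)
  set σ := √q.δ
  have hσ : 0 ≤ σ := Real.sqrt_nonneg _
  have lx := h.assum.lipschitz_gradX _ hm.1 _ hsad.mem_X _ hm.2 _ hsad.mem_Y
  have ly := h.assum.lipschitz_gradY _ hm.1 _ hsad.mem_X _ hm.2 _ hsad.mem_Y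
  have hsum : P.ell * (‖x - sx z‖ + ‖y - sy z‖) ≤ P.ell * (2 * σ) := by gcongr; linarith
  have stepX := projected_step pX ha (x := x) (g := gradX P.f x y + q.rx • (x - z))
    (gs := gradX P.f (sx z) (sy z) + q.rx • (sx z - z)) hsad.mem_X (fun x' hx' => by
      have := hsad.normal_X x' hx'
      simp only [Foam.hatX, Problem.foam, pX.eq_self hsad.mem_X, pY.eq_self hsad.mem_Y] at this
      have e : -((q.rx - P.ell) • sx z) - (gradX P.f (sx z) (sy z) + q.rx • (sx z - z) -
        (q.rx - P.ell) • sx z) = -(gradX P.f (sx z) (sy z) + q.rx • (sx z - z)) := by abel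
      rw [e, inner_neg_left] at this
      linarith) (η := σ) (by
      have e : gradX P.f x y + q.rx • (x - z) - (gradX P.f (sx z) (sy z) + q.rx • (sx z - z)) =
        (gradX P.f x y - gradX P.f (sx z) (sy z)) + q.rx • (x - sx z) := by module
      rw [e]
      have h1 := norm_add_le (gradX P.f x y - gradX P.f (sx z) (sy z)) (q.rx • (x - sx z))
      rw [norm_smul, Real.norm_eq_abs, abs_of_pos hrx] at h1
      have h2 : q.rx * ‖x - sx z‖ ≤ q.rx * σ := by gcongr
      have h3 : ‖gradX P.f x y - gradX P.f (sx z) (sy z) + q.rx • (x - sx z)‖ ≤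
        (q.rx + P.ell) * (2 * σ) := by nlinarith
      calc _ ≤ 1 / (q.rx + P.ell) * ((q.rx + P.ell) * (2 * σ)) := by gcongr
        _ = 2 * σ := by field_simp) hx
  have stepY := projected_step pY hc (x := y) (g := -(gradY P.f x y - q.ry • y))
    (gs := -(gradY P.f (sx z) (sy z) - q.ry • sy z)) hsad.mem_Y (fun y' hy' => by
      have := hsad.normal_Y y' hy'
      simp only [Foam.hatY, Problem.foam, pX.eq_self hsad.mem_X, pY.eq_self hsad.mem_Y] at this
      have e : -(q.ry • sy z) + (gradY P.f (sx z) (sy z) - q.ry • sy z + q.ry • sy z) =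
        -(-(gradY P.f (sx z) (sy z) - q.ry • sy z)) := by abel
      rw [e, inner_neg_left] at this
      linarith) (η := σ) (by
      have e : -(gradY P.f x y - q.ry • y) - -(gradY P.f (sx z) (sy z) - q.ry • sy z) =
        q.ry • (y - sy z) - (gradY P.f x y - gradY P.f (sx z) (sy z)) := by module
      rw [e]
      have h1 := norm_sub_le (q.ry • (y - sy z)) (gradY P.f x y - gradY P.f (sx z) (sy z))
      rw [norm_smul, Real.norm_eq_abs, abs_of_pos hry] at h1
      have h2 : q.ry * ‖y - sy z‖ ≤ q.ry * σ := by gcongr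
      have h3 : ‖q.ry • (y - sy z) - (gradY P.f x y - gradY P.f (sx z) (sy z))‖ ≤
        (q.ry + P.ell) * (2 * σ) := by nlinarith
      calc _ ≤ 1 / (q.ry + P.ell) * ((q.ry + P.ell) * (2 * σ)) := by gcongr
        _ = 2 * σ := by field_simp) hy
  rw [hcand]
  exact ⟨stepX.1, stepX.2.1, stepY.2.1, stepX.2.2, stepY.2.2⟩

theorem Run.candidate_mem (h : Run P q x₀ y₀) (a c : ℝ) (t : ℕ) :
    (P.candidate q a c x₀ y₀ z₀ t).1 ∈ P.X ∧ (P.candidate q a c x₀ y₀ z₀ t).2 ∈ P.Y :=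
  ⟨(h.assum.projX ⟨_, h.memX⟩).mem _, h.assum.projY.mem _⟩

/-- The `8` accounts for the change of the gradient of `f` between iterate and candidate, which are
`4√δ` apart in each variable; `4 / θ` is the projected step divided by its step size. What remains
is `r_x (x - z)` in the first variable and the perturbation gradient `r_y y` in the second. -/
theorem Run.isGS (h : Run P q x₀ y₀) (hs : SaddleMap P q sx sy) {a c ε θ : ℝ} (hθ : 0 < θ)
    (ha : θ / P.ell ≤ a) (ha' : a ≤ 1 / (q.rx + P.ell)) (hc : θ / P.ell ≤ c)
    (hc' : c ≤ 1 / (q.ry + P.ell)) (t : ℕ)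
    (h₁ : (8 + 4 / θ) * (P.ell * √q.δ) + q.rx * (√q.δ +
      ‖sx (P.iter q x₀ y₀ z₀ t).2.2 - (P.iter q x₀ y₀ z₀ t).2.2‖) ≤ ε)
    (h₂ : (8 + 4 / θ) * (P.ell * √q.δ) + q.ry * Metric.diam P.Y ≤ ε) :
    P.IsGS ε (P.candidate q a c x₀ y₀ z₀ t).1 (P.candidate q a c x₀ y₀ z₀ t).2 := by
  have hell := h.assum.ell_pos
  have ha0 : 0 < a := lt_of_lt_of_le (by positivity) ha
  have hc0 : 0 < c := lt_of_lt_of_le (by positivity) hc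
  obtain ⟨-, b2, b3, b4, b5⟩ := h.candidate_spec hs (z₀ := z₀) ha0 ha' hc0 hc' t
  have hacc := h.iter_accurate hs (z₀ := z₀) t
  have hm := h.iter_mem hs (z₀ := z₀) (t + 1)
  have hcm := h.candidate_mem (z₀ := z₀) a c t
  have hrx := h.rx_pos
  have hry := h.ry_pos
  set xh := (P.candidate q a c x₀ y₀ z₀ t).1
  set yh := (P.candidate q a c x₀ y₀ z₀ t).2
  set z := (P.iter q x₀ y₀ z₀ t).2.2
  set x := (P.iter q x₀ y₀ z₀ (t + 1)).1
  set y := (P.iter q x₀ y₀ z₀ (t + 1)).2.1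
  have hx : ‖x - sx z‖ ≤ √q.δ :=
    Real.le_sqrt_of_sq_le ((le_add_of_nonneg_right (sq_nonneg _)).trans hacc)
  set σ := √q.δ
  have hσ : 0 ≤ σ := Real.sqrt_nonneg _
  have inv_le : ∀ {r : ℝ}, θ / P.ell ≤ r → 0 < r → r⁻¹ * (4 * σ) ≤ 4 / θ * (P.ell * σ) := by
    intro r hr hr0
    have : r⁻¹ ≤ P.ell / θ := by
      rw [inv_le_iff_one_le_mul₀ hr0]
      calc (1 : ℝ) = P.ell / θ * (θ / P.ell) := by field_simp
        _ ≤ P.ell / θ * r := by gcongr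
    calc r⁻¹ * (4 * σ) ≤ P.ell / θ * (4 * σ) := by gcongr
      _ = _ := by ring
  have hsum : P.ell * (‖xh - x‖ + ‖yh - y‖) ≤ 8 * (P.ell * σ) := by
    rw [norm_sub_rev xh, norm_sub_rev yh]
    nlinarith
  refine ⟨hcm.1, hcm.2, ?_, ?_⟩
  · refine (Metric.infDist_le_dist_of_mem (mem_image_of_mem _ b4)).trans ?_
    rw [dist_zero_left]
    have e : gradX P.f xh yh + (a⁻¹ • (x - xh) - (gradX P.f x y + q.rx • (x - z))) =
        (gradX P.f xh yh - gradX P.f x y) + a⁻¹ • (x - xh) - q.rx • ((x - sx z) + (sx z - z)) := by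
      module
    rw [e]
    have n1 := h.assum.lipschitz_gradX _ hcm.1 _ hm.1 _ hcm.2 _ hm.2
    have n2 : ‖a⁻¹ • (x - xh)‖ ≤ 4 / θ * (P.ell * σ) := by
      rw [norm_smul, Real.norm_eq_abs, abs_of_pos (inv_pos.2 ha0)]
      exact (mul_le_mul_of_nonneg_left b2 (inv_pos.2 ha0).le).trans (inv_le ha ha0)
    have n3 : ‖q.rx • ((x - sx z) + (sx z - z))‖ ≤ q.rx * (σ + ‖sx z - z‖) := by
      rw [norm_smul, Real.norm_eq_abs, abs_of_pos hrx]
      gcongr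
      exact (norm_add_le _ _).trans (by gcongr)
    have n4 := norm_sub_le ((gradX P.f xh yh - gradX P.f x y) + a⁻¹ • (x - xh))
      (q.rx • ((x - sx z) + (sx z - z)))
    have n5 := norm_add_le (gradX P.f xh yh - gradX P.f x y) (a⁻¹ • (x - xh))
    linarith
  · refine (Metric.infDist_le_dist_of_mem (mem_image_of_mem _ b5)).trans ?_
    rw [dist_zero_left]
    have e : -gradY P.f xh yh + (c⁻¹ • (y - yh) - -(gradY P.f x y - q.ry • y)) =
        c⁻¹ • (y - yh) - (gradY P.f xh yh - gradY P.f x y) - q.ry • y := by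
      module
    rw [e]
    have n1 := h.assum.lipschitz_gradY _ hcm.1 _ hm.1 _ hcm.2 _ hm.2
    have n2 : ‖c⁻¹ • (y - yh)‖ ≤ 4 / θ * (P.ell * σ) := by
      rw [norm_smul, Real.norm_eq_abs, abs_of_pos (inv_pos.2 hc0)]
      exact (mul_le_mul_of_nonneg_left b3 (inv_pos.2 hc0).le).trans (inv_le hc hc0)
    have n3 : ‖q.ry • y‖ ≤ q.ry * Metric.diam P.Y := by
      rw [norm_smul, Real.norm_eq_abs, abs_of_pos hry]
      gcongr
      exact h.assum.norm_le_diam hm.2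
    have n4 := norm_sub_le (c⁻¹ • (y - yh) - (gradY P.f xh yh - gradY P.f x y)) (q.ry • y)
    have n5 := norm_sub_le (c⁻¹ • (y - yh)) (gradY P.f xh yh - gradY P.f x y)
    linarith

/-- Outside the ball of radius `R`, with `ℓ R²` the excess of the primal value at `x` over the lower
bound `m`, the objective exceeds its value at `x`; inside, compactness applies. -/
theorem Problem.Assumptions.exists_isProxPoint (hP : P.Assumptions)
    (hbdd : BddBelow (primal P.Y P.f '' P.X)) {x : E n} (hx : x ∈ P.X) :
    ∃ p, P.IsProxPoint x p := by
  obtain ⟨m, hm⟩ := hbdd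
  have hell := hP.ell_pos
  have hcont : Continuous (primal P.Y P.f) :=
    hP.compact_Y.continuous_sSup (f := P.f) hP.contDiff.continuous
  have hmx : m ≤ primal P.Y P.f x := hm ⟨x, hx, rfl⟩
  set R := √((primal P.Y P.f x - m) / P.ell)
  have hK : IsCompact (P.X ∩ Metric.closedBall x R) :=
    (isCompact_closedBall x R).inter_left hP.closed_X
  have hxK : x ∈ P.X ∩ Metric.closedBall x R :=
    ⟨hx, Metric.mem_closedBall_self (Real.sqrt_nonneg _)⟩
  obtain ⟨p, hp, hmin⟩ := hK.exists_isMinOn ⟨x, hxK⟩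
    (f := fun x' => primal P.Y P.f x' + P.ell * ‖x' - x‖ ^ 2) (by fun_prop)
  refine ⟨p, hp.1, fun x' hx' => ?_⟩
  by_cases hin : x' ∈ Metric.closedBall x R
  · exact hmin ⟨hx', hin⟩
  · have h1 := hmin hxK
    simp only [mem_ofPred_eq, sub_self, norm_zero] at h1 ⊢
    rw [Metric.mem_closedBall, not_le, dist_eq_norm] at hin
    have h2 := (Real.sqrt_lt' ((Real.sqrt_nonneg _).trans_lt hin)).1 hin
    rw [div_lt_iff₀ hell] at h2
    have h3 := hm ⟨x', hx', rfl⟩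
    nlinarith

/-- Minimality of `p` is tested at `sx z`, and the quadratic growth of the surrogate around `sx z`
is tested at `p`. In the sum the primal values cancel up to the perturbation, and of the quadratic
terms in `‖p - sx z‖` only `ℓ/2` survives, against `ℓ ‖p - x̂‖²`. -/
theorem Run.isOS (h : Run P q x₀ y₀) (hs : SaddleMap P q sx sy) {a c ε κ : ℝ}
    (ha : 0 < a) (ha' : a ≤ 1 / (q.rx + P.ell)) (hc : 0 < c) (hc' : c ≤ 1 / (q.ry + P.ell))
    (hκ : 3 ≤ κ) (hrx : q.rx ≤ κ * P.ell) (hε : 0 < ε) (t : ℕ)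
    (h₁ : 20 * κ * ‖sx (P.iter q x₀ y₀ z₀ t).2.2 - (P.iter q x₀ y₀ z₀ t).2.2‖ ≤ ε / (2 * P.ell))
    (h₂ : 60 * κ * √q.δ ≤ ε / (2 * P.ell))
    (h₃ : q.ry * Metric.diam P.Y ^ 2 ≤ P.ell / 2 * (ε / (2 * P.ell)) ^ 2) :
    P.IsOS ε (P.candidate q a c x₀ y₀ z₀ t).1 := by
  have hell := h.assum.ell_pos
  have hrx0 := h.rx_pos
  obtain ⟨b1, -⟩ := h.candidate_spec hs (z₀ := z₀) ha ha' hc hc' t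
  have hcm := h.candidate_mem (z₀ := z₀) a c t
  refine ⟨hcm.1, ?_⟩
  obtain ⟨p, hp⟩ := h.assum.exists_isProxPoint h.bdd hcm.1
  refine ⟨p, hp, ?_⟩
  set xh := (P.candidate q a c x₀ y₀ z₀ t).1
  set z := (P.iter q x₀ y₀ z₀ t).2.2
  set V := ε / (2 * P.ell)
  have hV : 0 < V := by positivity
  have hmem := (h.strong hs z).mem_X
  have g1 := h.proxValue_growth hs z hp.1
  have g2 := h.proxValue_eq hs z
  have g3 := h.assum.primal_perturbed_le h.ry_pos p
  have g4 := h.assum.primal_le_perturbed h.ry_pos (sx z)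
  have g5 := hp.2 hmem
  simp only [mem_ofPred_eq] at g5
  have g6 : ‖p - z‖ ≤ ‖p - sx z‖ + ‖sx z - z‖ := norm_sub_le_norm_sub_add_norm_sub _ _ _
  have g7 : ‖p - sx z‖ ≤ ‖p - xh‖ + ‖sx z - xh‖ := by
    rw [norm_sub_rev (sx z)]
    exact norm_sub_le_norm_sub_add_norm_sub _ _ _
  rw [norm_sub_rev] at b1
  set u := ‖p - sx z‖
  set v := ‖p - xh‖
  set s := ‖sx z - xh‖
  set G := ‖sx z - z‖
  have hu : 0 ≤ u := norm_nonneg _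
  have hs0 : 0 ≤ s := norm_nonneg _
  have hG : 0 ≤ G := norm_nonneg _
  have g8 : ‖p - z‖ ^ 2 ≤ (u + G) ^ 2 := by gcongr
  have g9 := mul_le_mul_of_nonneg_left g8 (show 0 ≤ q.rx / 2 by positivity)
  have g10 : q.rx * (G * u) ≤ κ * P.ell * (G * u) := by gcongr
  have main : P.ell * v ^ 2 ≤ q.ry / 2 * Metric.diam P.Y ^ 2 + P.ell * s ^ 2 +
      κ * P.ell * (G * u) + P.ell / 2 * u ^ 2 := by nlinarith
  by_contra hlt
  push Not at hlt
  -- If `v > V`, the four terms on the right of `main` are at most `1/4`, `1/3600`, `61/1200` and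
  -- `(61/60)² / 2` times `ℓ v²`, and these factors sum to less than `1`.
  have hs1 : s ≤ V / 60 := by nlinarith
  have hG1 : κ * G ≤ V / 20 := by linarith
  have hu1 : u ≤ 61 / 60 * v := by linarith
  have k1 : κ * P.ell * (G * u) ≤ P.ell * (v / 20 * (61 / 60 * v)) := by
    have : κ * G * u ≤ v / 20 * (61 / 60 * v) := by gcongr; linarith
    nlinarith
  have k2 : P.ell / 2 * u ^ 2 ≤ P.ell / 2 * (61 / 60 * v) ^ 2 := by gcongr
  have k3 : P.ell * s ^ 2 ≤ P.ell * (v / 60) ^ 2 := by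
    have : s ≤ v / 60 := by linarith
    gcongr
  have k4 : P.ell / 2 * V ^ 2 ≤ P.ell / 2 * v ^ 2 := by gcongr
  have k5 : 0 < P.ell * v ^ 2 := by
    have := hV.trans hlt
    positivity
  linarith

end Stationarity

/-! ### Assembling the complexity with constants independent of the problem. -/

section Complexity

variable {n d : ℕ} {P : Problem n d} {q : Params} {x₀ : E n} {y₀ : E d} {z₀ : E n}

theorem Run.sqrt_le_alpha (h : Run P q x₀ y₀) {κ : ℝ} (hκ : 3 ≤ κ) (hrx : q.rx ≤ κ * P.ell) :
    √(q.ry / (κ * P.ell)) ≤ (P.foam q 0).alpha := by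
  have hell := h.assum.ell_pos
  have hry := h.ry_pos
  have hr := sub_pos.2 h.ell_lt
  have hle := h.ry_le
  refine le_min ?_ (Real.sqrt_le_sqrt ?_)
  · rw [Real.sqrt_le_one, div_le_one (by positivity)]
    nlinarith
  · change q.ry / (κ * P.ell) ≤ 8 * q.ry / (q.rx - P.ell)
    rw [div_le_div_iff₀ (by positivity) hr]
    nlinarith [mul_pos hry hell]

/-- Here `r_x > 3ℓ` enters: `8(2ℓ + r_x) ≤ 20(r_x - ℓ)` is equivalent to `3ℓ ≤ r_x`. -/
theorem Run.inner_bound_le (h : Run P q x₀ y₀) :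
    ⌈18 * (2 * √5 * (1 + 8 * (P.foam q 0).L / (q.rx - P.ell)))⌉₊ ≤ ⌈18 * (2 * √5 * 21)⌉₊ := by
  have hell := h.assum.ell_pos
  have hr := sub_pos.2 h.ell_lt
  have hrx := h.rx_gt
  apply Nat.ceil_mono
  have h1 : (P.foam q 0).L = 2 * P.ell + q.rx := by
    change 2 * P.ell + max q.rx q.ry = _
    rw [max_eq_left]
    linarith [h.ry_le]
  have h2 : 8 * (P.foam q 0).L / (q.rx - P.ell) ≤ 20 := by
    rw [h1, div_le_iff₀ hr]
    linarith
  have h3 : 1 + 8 * (P.foam q 0).L / (q.rx - P.ell) ≤ 21 := by linarith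
  gcongr

/-- The factors `U`, `√(ell / ry)` and `W` are all at least `1`, so roundings and additive constants
are absorbed into the leading product. -/
theorem cost_arith {N T I J : ℕ} {A U κ ell ry α r W lQ : ℝ} (hA : 0 < A) (hU : 1 ≤ U)
    (hW : 1 ≤ W) (hκ : 0 < κ) (hell : 0 < ell) (hry : 0 < ry) (hrl : ry ≤ ell) (hr : 0 ≤ r)
    (hα : √(ry / (κ * ell)) ≤ α) (hlQ : lQ ≤ r * W) (hI : I ≤ J) (hT : (T : ℝ) ≤ (A + 1) * U)
    (hN : N ≤ T * ((⌈2 / α * lQ⌉₊ + 2) * (2 + 2 * I)) + 1) :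
    (N : ℝ) ≤ ((A + 1) * (2 * √κ * r + 3) * (2 + 2 * J) + 1) * (U * √(ell / ry) * W) := by
  have hα0 : 0 < √(ry / (κ * ell)) := Real.sqrt_pos.2 (by positivity)
  have hR : 1 ≤ √(ell / ry) := by
    rw [Real.one_le_sqrt, one_le_div hry]
    exact hrl
  have h1 : 2 / α * lQ ≤ 2 * √κ * r * (√(ell / ry) * W) := by
    have h2 : (√(ry / (κ * ell)))⁻¹ = √κ * √(ell / ry) := by
      rw [← Real.sqrt_inv, ← Real.sqrt_mul hκ.le]
      congr 1
      field_simp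
    calc 2 / α * lQ ≤ 2 / α * (r * W) := by
          gcongr
          exact div_nonneg zero_le_two (hα0.le.trans hα)
      _ ≤ 2 / √(ry / (κ * ell)) * (r * W) := by gcongr
      _ = 2 * (√(ry / (κ * ell)))⁻¹ * (r * W) := by rw [div_eq_mul_inv]
      _ = _ := by rw [h2]; ring
  have hRW : 1 ≤ √(ell / ry) * W := one_le_mul_of_one_le_of_one_le hR hW
  have h3 : ((⌈2 / α * lQ⌉₊ : ℕ) : ℝ) + 2 ≤ (2 * √κ * r + 3) * (√(ell / ry) * W) := by
    have h4 : ((⌈2 / α * lQ⌉₊ : ℕ) : ℝ) ≤ 2 * √κ * r * (√(ell / ry) * W) + 1 := by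
      refine (Nat.cast_le.2 (Nat.ceil_mono h1)).trans ?_
      exact (Nat.ceil_lt_add_one (by positivity)).le
    linarith
  have h5 : (N : ℝ) ≤ T * ((((⌈2 / α * lQ⌉₊ : ℕ) : ℝ) + 2) * (2 + 2 * I)) + 1 := by
    exact_mod_cast hN
  have hI' : (I : ℝ) ≤ J := by exact_mod_cast hI
  have hone : 1 ≤ U * √(ell / ry) * W := by
    rw [mul_assoc]
    exact one_le_mul_of_one_le_of_one_le hU hRW
  calc (N : ℝ) ≤ T * ((((⌈2 / α * lQ⌉₊ : ℕ) : ℝ) + 2) * (2 + 2 * I)) + 1 := h5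
    _ ≤ (A + 1) * U * (((2 * √κ * r + 3) * (√(ell / ry) * W)) * (2 + 2 * J)) +
        U * √(ell / ry) * W := by gcongr
    _ = _ := by ring

theorem Run.gap_le (h : Run P q x₀ y₀) {sx : E n → E n} {sy : E n → E d}
    (hs : SaddleMap P q sx sy) :
    P.gap q z₀ ≤ primal P.Y (P.perturbed q) x₀ + q.rx / 2 * ‖x₀ - z₀‖ ^ 2 -
        minimaxValue P.X P.Y (P.perturbed q) := by
  have h0 := h.proxValue_growth hs z₀ h.memX
  have h1 : 0 ≤ (q.rx - P.ell) / 2 * ‖x₀ - sx z₀‖ ^ 2 := by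
    have := sub_pos.2 h.ell_lt
    positivity
  simp only [Problem.gap]
  linarith

theorem Run.initial_le (h : Run P q x₀ y₀) {κ cΦ : ℝ} (hrx : q.rx ≤ κ * P.ell)
    (hcΦ : cΦ ∈ lowerBounds (primal P.Y P.f '' P.X)) :
    primal P.Y (P.perturbed q) x₀ + q.rx / 2 * ‖x₀ - z₀‖ ^ 2 -
        minimaxValue P.X P.Y (P.perturbed q) ≤
      primal P.Y P.f x₀ + κ * P.ell / 2 * ‖x₀ - z₀‖ ^ 2 - cΦ +
        P.ell / 2 * Metric.diam P.Y ^ 2 := by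
  have h1 := h.assum.primal_perturbed_le h.ry_pos x₀
  have h2 : q.rx / 2 * ‖x₀ - z₀‖ ^ 2 ≤ κ * P.ell / 2 * ‖x₀ - z₀‖ ^ 2 := by gcongr
  have h3 : cΦ - P.ell / 2 * Metric.diam P.Y ^ 2 ≤
      minimaxValue P.X P.Y (P.perturbed q) := by
    refine le_csInf ⟨_, x₀, h.memX, rfl⟩ ?_
    rintro _ ⟨x, hx, rfl⟩
    have h4 := hcΦ ⟨x, hx, rfl⟩
    have h5 := h.assum.primal_le_perturbed h.ry_pos x
    have h6 : q.ry / 2 * Metric.diam P.Y ^ 2 ≤ P.ell / 2 * Metric.diam P.Y ^ 2 := by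
      have := h.ry_le
      gcongr
    linarith
  linarith

/-- The constant that bounds, up to a power of the accuracy, the initial errors of the calls of
FOAM relative to their target. -/
noncomputable def errorScale (κ A D ell ρ δ₁ B : ℝ) : ℝ :=
  221 * (κ ^ 2 * ell ^ 2 / ρ ^ 2) * (D ^ 2 + 2 * δ₁ + 2 / ell * (|B| + κ * ell / 2 *
    ((A + 1) * (ell * (|B| + 1 / ell)) * δ₁)))

/-- The estimate is used only inside a logarithm, so any power of `1/ε` suffices. Hence `α` is
bounded below by `r_y / (κ ℓ)` rather than by its square root, and `T δ` stays bounded because `T`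
is of order at most `ε⁻²` and `δ` at most `ε⁴`. -/
theorem Run.error_le (h : Run P q x₀ y₀) {κ A ρ δ₁ B ε : ℝ} {T : ℕ} (hκ : 3 ≤ κ)
    (hrx : q.rx ≤ κ * P.ell) (hA : 0 < A) (hε : 0 < ε) (hε1 : ε ≤ 1) (hρ : 0 < ρ)
    (hry : ρ * ε ^ 2 ≤ q.ry) (hδ : q.δ ≤ δ₁ * ε ^ 4)
    (hB : primal P.Y (P.perturbed q) x₀ + q.rx / 2 * ‖x₀ - z₀‖ ^ 2 -
        minimaxValue P.X P.Y (P.perturbed q) ≤ B)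
    (hT : (T : ℝ) ≤ (A + 1) * (P.ell * max (P.gap q z₀) (ε ^ 2 / P.ell) / ε ^ 2))
    (hgap : P.gap q z₀ ≤ B) :
    221 * ((q.rx - P.ell) / ((P.foam q 0).alpha * q.ry)) *
      (Metric.diam P.Y ^ 2 + 2 * q.δ + 4 / (q.rx - P.ell) *
      (primal P.Y (P.perturbed q) x₀ + q.rx / 2 * ‖x₀ - z₀‖ ^ 2 -
        minimaxValue P.X P.Y (P.perturbed q) + T * (q.rx * q.β / 2 * q.δ))) ≤
      errorScale κ A (Metric.diam P.Y) P.ell ρ δ₁ B / ε ^ 4 := by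
  have hell := h.assum.ell_pos
  have hry0 := h.ry_pos
  have hr := sub_pos.2 h.ell_lt
  have hrx0 := h.rx_pos
  have hrle := h.ry_le
  have hδ0 := h.δ_pos
  have hβ0 := h.β_pos
  have hβ1 := h.β_lt
  have hα := h.sqrt_le_alpha hκ hrx
  have hδ₁ : 0 < δ₁ := by
    have := hδ0.trans_le hδ
    exact pos_of_mul_pos_left this (by positivity)
  have hδ' : q.δ ≤ δ₁ := hδ.trans (mul_le_of_le_one_right hδ₁.le (pow_le_one₀ hε.le hε1))
  have hα' : q.ry / (κ * P.ell) ≤ (P.foam q 0).alpha := by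
    refine le_trans ?_ hα
    have h1 : q.ry / (κ * P.ell) ≤ 1 := by
      rw [div_le_one (by positivity)]
      nlinarith
    apply Real.le_sqrt_of_sq_le
    rw [sq]
    exact mul_le_of_le_one_left (by positivity) h1
  have f1 : (q.rx - P.ell) / ((P.foam q 0).alpha * q.ry) ≤
      κ ^ 2 * P.ell ^ 2 / ρ ^ 2 / ε ^ 4 := by
    calc (q.rx - P.ell) / ((P.foam q 0).alpha * q.ry)
        ≤ κ * P.ell / (q.ry / (κ * P.ell) * q.ry) := by
          gcongr
          linarith
      _ = κ ^ 2 * P.ell ^ 2 / q.ry ^ 2 := by field_simp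
      _ ≤ κ ^ 2 * P.ell ^ 2 / (ρ * ε ^ 2) ^ 2 := by gcongr
      _ = _ := by field_simp
  have f2 : T * (q.rx * q.β / 2 * q.δ) ≤
      κ * P.ell / 2 * ((A + 1) * (P.ell * (|B| + 1 / P.ell)) * δ₁) := by
    have hM : max (P.gap q z₀) (ε ^ 2 / P.ell) ≤ |B| + 1 / P.ell := by
      refine max_le (hgap.trans ((le_abs_self B).trans (by simp [hell.le]))) ?_
      have : ε ^ 2 / P.ell ≤ 1 / P.ell := by
        gcongr
        exact pow_le_one₀ hε.le hε1
      linarith [abs_nonneg B]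
    have hTδ : T * q.δ ≤ (A + 1) * (P.ell * (|B| + 1 / P.ell)) * δ₁ := by
      calc T * q.δ ≤ (A + 1) * (P.ell * (|B| + 1 / P.ell) / ε ^ 2) * (δ₁ * ε ^ 4) := by
            gcongr
            exact hT.trans (by gcongr)
        _ = (A + 1) * (P.ell * (|B| + 1 / P.ell)) * δ₁ * ε ^ 2 := by field_simp
        _ ≤ _ := mul_le_of_le_one_right (by positivity) (pow_le_one₀ hε.le hε1)
    have hrβ : q.rx * q.β ≤ κ * P.ell := (mul_le_of_le_one_right hrx0.le hβ1.le).trans hrx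
    calc T * (q.rx * q.β / 2 * q.δ) = q.rx * q.β / 2 * (T * q.δ) := by ring
      _ ≤ κ * P.ell / 2 * (T * q.δ) := mul_le_mul_of_nonneg_right (by linarith) (by positivity)
      _ ≤ _ := by gcongr
  have f3 : 4 / (q.rx - P.ell) ≤ 2 / P.ell := by
    rw [div_le_div_iff₀ hr hell]
    linarith [h.rx_gt]
  have hB' := hB.trans (le_abs_self B)
  have hE : 0 ≤ κ * P.ell / 2 * ((A + 1) * (P.ell * (|B| + 1 / P.ell)) * δ₁) := by positivity
  have f4 : 4 / (q.rx - P.ell) * (primal P.Y (P.perturbed q) x₀ + q.rx / 2 * ‖x₀ - z₀‖ ^ 2 -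
        minimaxValue P.X P.Y (P.perturbed q) + T * (q.rx * q.β / 2 * q.δ)) ≤
      2 / P.ell * (|B| + κ * P.ell / 2 * ((A + 1) * (P.ell * (|B| + 1 / P.ell)) * δ₁)) := by
    calc _ ≤ 4 / (q.rx - P.ell) *
          (|B| + κ * P.ell / 2 * ((A + 1) * (P.ell * (|B| + 1 / P.ell)) * δ₁)) := by gcongr
      _ ≤ _ := by gcongr
  calc _ ≤ 221 * (κ ^ 2 * P.ell ^ 2 / ρ ^ 2 / ε ^ 4) * (Metric.diam P.Y ^ 2 + 2 * δ₁ +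
        2 / P.ell * (|B| + κ * P.ell / 2 * ((A + 1) * (P.ell * (|B| + 1 / P.ell)) * δ₁))) := by
        have hα0 : 0 < (P.foam q 0).alpha := (h.regular 0).alpha_pos
        refine (mul_le_mul_of_nonneg_left (add_le_add (add_le_add_right
          (mul_le_mul_of_nonneg_left hδ' zero_le_two) _) f4) (by positivity)).trans ?_
        gcongr
    _ = _ := by
        simp only [errorScale]
        ring

/-- The complexity of finding an iterate with a small residual. -/
theorem exists_complexity (κ K m : ℝ) {b g : ℝ} (hb : 0 < b) (hK : 0 < K) (hg : 0 < g) :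
    ∃ C : ℝ, 0 < C ∧ ∀ (n d : ℕ) (P : Problem n d), P.Assumptions →
      BddBelow (primal P.Y P.f '' P.X) → ∀ x₀ ∈ P.X, ∀ y₀ ∈ P.Y, ∀ z₀ : E n,
      ∀ ρ ρ' : ℝ, 0 < ρ → 0 < ρ' → ∃ ε₀ : ℝ, 0 < ε₀ ∧ ∀ ε : ℝ, 0 < ε → ε < ε₀ →
        ∀ (q : Params) (θ a c : ℝ), P.ParamCondition q κ b K m θ ε a c →
          ρ * ε ^ 2 ≤ q.ry → q.ry ≤ ρ' * ε →
          Run P q x₀ y₀ ∧ √q.δ ≤ g * (ε / P.ell) ∧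
          ∀ (sx : E n → E n) (sy : E n → E d), SaddleMap P q sx sy →
            ∃ t N : ℕ, P.totalCost q x₀ y₀ z₀ t = (N : ℕ∞) ∧
              (N : ℝ) ≤ C * (P.ell * max (P.gap q z₀) (ε ^ 2 / P.ell) / ε ^ 2 *
                √(P.ell / q.ry) * Real.log (1 / ε)) ∧
              ‖sx (P.iter q x₀ y₀ z₀ t).2.2 - (P.iter q x₀ y₀ z₀ t).2.2‖ ≤ g * (ε / P.ell) := by
  -- With `T ≥ A U` the averaged gap contributes at most half of `(g ε / ℓ)²`, and `δ` at most a
  -- quarter.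
  set A := 4 / (3 * b * g ^ 2) with hA_def
  have hA : 0 < A := by positivity
  refine ⟨(A + 1) * (2 * √κ * (5 + |m|) + 3) * (2 + 2 * (⌈18 * (2 * √5 * 21)⌉₊ : ℕ)) + 1,
    by positivity, ?_⟩
  intro n d P hP hbdd x₀ hx₀ y₀ hy₀ z₀ ρ ρ' hρ hρ'
  have hell := hP.ell_pos
  have hD := hP.diam_pos
  obtain ⟨cΦ, hcΦ⟩ := hbdd
  set D := Metric.diam P.Y
  set B := primal P.Y P.f x₀ + κ * P.ell / 2 * ‖x₀ - z₀‖ ^ 2 - cΦ + P.ell / 2 * D ^ 2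
  set δ₁ := K * (ρ' ^ 4 * D ^ 2 / P.ell ^ 4) with hδ₁_def
  have hδ₁ : 0 < δ₁ := by positivity
  set S := |errorScale κ A D P.ell ρ δ₁ B|
  have hS : 0 ≤ S := abs_nonneg _
  -- The four thresholds give, in order, `log (1/ε) ≥ 1`, absorption of `S` into one factor `1/ε`,
  -- `r_y ≤ ℓ`, and `√δ ≤ (g/2) ε / ℓ`.
  refine ⟨min (min (Real.exp (-1)) (1 / (S + 1))) (min (P.ell / ρ') (g / (2 * P.ell * √δ₁))),
    by have := Real.exp_pos (-1); positivity, ?_⟩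
  intro ε hε hεlt q θ a c hq hry hry'
  simp only [lt_min_iff] at hεlt
  obtain ⟨⟨hε1, hε2⟩, hε3, hε4⟩ := hεlt
  have hεone : ε < 1 := hε1.trans (by rw [Real.exp_lt_one_iff]; norm_num)
  have hκ : 3 < κ := by
    have := hq.rx_gt.trans_le hq.rx_le
    exact lt_of_mul_lt_mul_right this hell.le
  have hrun : Run P q x₀ y₀ := by
    refine ⟨hP, ⟨cΦ, hcΦ⟩, hx₀, hy₀, hq.rx_gt, hq.ry_pos, ?_, hb.trans_le hq.le_β, ?_, hq.δ_pos⟩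
    · rw [lt_div_iff₀ hρ'] at hε3
      linarith
    · linarith [hq.β_le]
  have hδ : q.δ ≤ δ₁ * ε ^ 4 := by
    have h0 := hq.ry_pos
    calc q.δ ≤ K * (q.ry ^ 4 * D ^ 2 / P.ell ^ 4) := hq.δ_le
      _ ≤ K * ((ρ' * ε) ^ 4 * D ^ 2 / P.ell ^ 4) := by gcongr
      _ = _ := by rw [hδ₁_def]; ring
  have hσ : √q.δ ≤ g / 2 * (ε / P.ell) := by
    have h1 : √q.δ ≤ √δ₁ * ε ^ 2 := by
      calc √q.δ ≤ √(δ₁ * ε ^ 4) := Real.sqrt_le_sqrt hδ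
        _ = √δ₁ * ε ^ 2 := by
          rw [Real.sqrt_mul hδ₁.le, show ε ^ 4 = (ε ^ 2) ^ 2 by ring,
            Real.sqrt_sq (by positivity)]
    refine h1.trans ?_
    have hs1 : 0 < √δ₁ := Real.sqrt_pos.2 hδ₁
    rw [lt_div_iff₀ (by positivity)] at hε4
    rw [← mul_div_assoc, le_div_iff₀ hell]
    nlinarith
  refine ⟨hrun, hσ.trans ?_, fun sx sy hs => ?_⟩
  · gcongr
    linarith
  set M := max (P.gap q z₀) (ε ^ 2 / P.ell) with hM_def
  set U := P.ell * M / ε ^ 2 with hU_def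
  have hM0 : ε ^ 2 / P.ell ≤ M := le_max_right _ _
  -- This is the purpose of the maximum with `ε² / ℓ`: rounding up to an integer `T` costs at most a
  -- constant factor.
  have hU : 1 ≤ U := by
    rw [hU_def, one_le_div (by positivity)]
    rw [div_le_iff₀ hell] at hM0
    linarith
  have hM : 0 < M := lt_of_lt_of_le (by positivity) hM0
  set T := ⌈A * U⌉₊ with hT_def
  have hTpos : 0 < T := Nat.ceil_pos.2 (by positivity)
  have hTge : A * U ≤ T := Nat.le_ceil _
  have hTle : (T : ℝ) ≤ (A + 1) * U := by
    have := (Nat.ceil_lt_add_one (show 0 ≤ A * U by positivity)).le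
    rw [← hT_def] at this
    linarith
  have hinit := hrun.initial_le (z₀ := z₀) hq.rx_le hcΦ
  have herr := hrun.error_le hκ.le hq.rx_le hA hε hεone.le hρ hry hδ hinit hTle
    ((hrun.gap_le hs).trans hinit)
  -- Take `Q = δ⁻¹ ε⁻⁵`: four powers of `1/ε` come from `error_le`, and the fifth dominates `S`.
  -- Then `log Q ≤ (5 + |m|) log (1/ε)` involves no data of the problem.
  have hQpos : 0 < 1 / q.δ * (1 / ε) ^ 5 := by
    have := hq.δ_pos
    positivity
  have hQ : errorScale κ A D P.ell ρ δ₁ B / ε ^ 4 ≤ q.δ * (1 / q.δ * (1 / ε) ^ 5) := by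
    have h1 : q.δ * (1 / q.δ * (1 / ε) ^ 5) = 1 / ε / ε ^ 4 := by
      have := hq.δ_pos
      field_simp
    rw [h1]
    gcongr
    refine (le_abs_self _).trans ?_
    rw [lt_div_iff₀ (by positivity)] at hε2
    rw [le_div_iff₀ hε]
    change S * ε ≤ 1
    linarith
  obtain ⟨t, N, hN, hNle, hres⟩ := hrun.exists_iterate hs hTpos hQpos (herr.trans hQ)
  have hW : 1 ≤ Real.log (1 / ε) := by
    rw [one_div, Real.log_inv]
    have := Real.log_lt_log hε hε1
    rw [Real.log_exp] at this
    linarith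
  have hlogQ : Real.log (1 / q.δ * (1 / ε) ^ 5) ≤ (5 + |m|) * Real.log (1 / ε) := by
    have h0 := hq.δ_pos
    rw [Real.log_mul (by positivity) (by positivity), Real.log_pow]
    have h1 := hq.log_δ
    have h2 := mul_le_mul_of_nonneg_right (le_abs_self m) (zero_le_one.trans hW)
    push_cast
    linarith
  refine ⟨t, N, hN, ?_, ?_⟩
  · exact cost_arith hA hU hW (by linarith) hell hq.ry_pos hrun.ry_le (by positivity)
      (hrun.sqrt_le_alpha hκ.le hq.rx_le) hlogQ hrun.inner_bound_le hTle hNle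
  · refine le_of_sq_le_sq (hres.trans ?_) (by positivity)
    have hrx := hq.rx_gt
    have hβ := hq.le_β
    have hδ2 : q.δ ≤ 1 / 4 * (g * (ε / P.ell)) ^ 2 := by
      calc q.δ = √q.δ ^ 2 := (Real.sq_sqrt hq.δ_pos.le).symm
        _ ≤ (g / 2 * (ε / P.ell)) ^ 2 := by gcongr
        _ = _ := by ring
    have hgapT : 2 * P.gap q z₀ / (q.rx * q.β * T) ≤ 1 / 2 * (g * (ε / P.ell)) ^ 2 := by
      have hrx0 := hrun.rx_pos
      have hβ0 := hrun.β_pos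
      calc 2 * P.gap q z₀ / (q.rx * q.β * T) ≤ 2 * M / (q.rx * q.β * T) := by
            gcongr
            exact le_max_left _ _
        _ ≤ 2 * M / (3 * P.ell * b * (A * U)) := by gcongr
        _ = _ := by rw [hU_def, hA_def]; field_simp; norm_num
    linarith [sq_nonneg (g * (ε / P.ell))]

end Complexity

/-! ### The two choices of the dual perturbation. -/

section Main

theorem foam_gs_complexity (κ K m : ℝ) {b θ c₁ c₂ : ℝ} (hb : 0 < b) (hK : 0 < K) (hθ : 0 < θ)
    (hc₁ : 0 < c₁) (hc₂ : c₁ ≤ c₂) (hlt : c₂ < 1) :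
    ∃ C : ℝ, 0 < C ∧ ∀ (n d : ℕ) (P : Problem n d), P.Assumptions →
      BddBelow (primal P.Y P.f '' P.X) → ∀ x₀ ∈ P.X, ∀ y₀ ∈ P.Y, ∀ z₀ : E n,
      ∃ ε₀ : ℝ, 0 < ε₀ ∧ ∀ ε : ℝ, 0 < ε → ε < ε₀ →
        ∀ (q : Params) (a c : ℝ), P.ParamCondition q κ b K m θ ε a c →
          c₁ * (ε / Metric.diam P.Y) ≤ q.ry → q.ry ≤ c₂ * (ε / Metric.diam P.Y) →
          ∃ t N : ℕ, P.totalCost q x₀ y₀ z₀ t = (N : ℕ∞) ∧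
            (N : ℝ) ≤ C * (P.ell ^ (3 / 2 : ℝ) * Metric.diam P.Y ^ (1 / 2 : ℝ)
              * max (P.gap q z₀) (ε ^ 2 / P.ell) / ε ^ (5 / 2 : ℝ) * Real.log (1 / ε)) ∧
            P.IsGS ε (P.candidate q a c x₀ y₀ z₀ t).1 (P.candidate q a c x₀ y₀ z₀ t).2 := by
  have hc₂0 : 0 < c₂ := hc₁.trans_le hc₂
  have h1c : 0 < 1 - c₂ := by linarith
  -- The perturbation uses up `c₂ ε` of the dual tolerance; `g` spreads the remaining `(1 - c₂) ε`
  -- over the error terms of `isGS`.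
  set g := (1 - c₂) / (8 + 4 / θ + 2 * |κ|) with hg_def
  have hden : 0 < 8 + 4 / θ + 2 * |κ| := by positivity
  have hg : 0 < g := by positivity
  have hgden : (8 + 4 / θ) * g + 2 * (|κ| * g) = 1 - c₂ := by
    rw [hg_def]
    field_simp
  obtain ⟨C, hC, H⟩ := exists_complexity κ K m hb hK hg
  refine ⟨C * √(1 / c₁), by positivity, ?_⟩
  intro n d P hP hbdd x₀ hx₀ y₀ hy₀ z₀
  have hell := hP.ell_pos
  have hD := hP.diam_pos
  obtain ⟨ε₀, hε₀, H⟩ := H n d P hP hbdd x₀ hx₀ y₀ hy₀ z₀ (c₁ / Metric.diam P.Y)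
    (c₂ / Metric.diam P.Y) (by positivity) (by positivity)
  refine ⟨min ε₀ 1, by positivity, ?_⟩
  intro ε hε hεlt q a c hq hry hry'
  rw [lt_min_iff] at hεlt
  set D := Metric.diam P.Y
  -- The window from `ρ ε²` to `ρ' ε` covers both regimes of `r_y`; here the lower end follows from
  -- `ε² ≤ ε`.
  obtain ⟨hrun, hσ, H⟩ := H ε hε hεlt.1 q θ a c hq
    (by
      refine le_trans ?_ hry
      rw [mul_div_assoc', div_mul_eq_mul_div]
      have : ε ^ 2 ≤ ε := by nlinarith
      gcongr) (by rwa [mul_div_assoc', ← div_mul_eq_mul_div] at hry')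
  obtain ⟨sx, sy, hs⟩ := hrun.exists_saddleMap
  obtain ⟨t, N, hN, hNle, hres⟩ := H sx sy hs
  have hσ0 := Real.sqrt_nonneg q.δ
  have hellσ : P.ell * √q.δ ≤ g * ε := by
    calc P.ell * √q.δ ≤ P.ell * (g * (ε / P.ell)) := by gcongr
      _ = g * ε := by field_simp
  have hcoef : 0 ≤ 8 + 4 / θ := by positivity
  have hm := mul_le_mul_of_nonneg_left hellσ hcoef
  refine ⟨t, N, hN, ?_, hrun.isGS hs hθ hq.le_a hq.a_le hq.le_c hq.c_le t ?_ ?_⟩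
  · have hry0 := hq.ry_pos
    have hM : 0 < max (P.gap q z₀) (ε ^ 2 / P.ell) :=
      lt_of_lt_of_le (by positivity) (le_max_right _ _)
    have hW : 0 ≤ Real.log (1 / ε) := Real.log_nonneg (by
      rw [le_div_iff₀ hε]
      linarith)
    have hsqrt : √(P.ell / q.ry) ≤ √(1 / c₁) * (√P.ell * √D / √ε) := by
      rw [← Real.sqrt_mul hell.le, ← Real.sqrt_div (by positivity), ← Real.sqrt_mul (by positivity)]
      apply Real.sqrt_le_sqrt
      calc P.ell / q.ry ≤ P.ell / (c₁ * (ε / D)) := by gcongr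
        _ = _ := by field_simp
    have e1 : P.ell ^ (3 / 2 : ℝ) = P.ell * √P.ell := by
      rw [show (3 / 2 : ℝ) = 1 + 1 / 2 by norm_num, Real.rpow_add hell, Real.rpow_one,
        Real.sqrt_eq_rpow]
    have e2 : ε ^ (5 / 2 : ℝ) = ε ^ 2 * √ε := by
      rw [show (5 / 2 : ℝ) = 2 + 1 / 2 by norm_num, Real.rpow_add hε, Real.rpow_two,
        Real.sqrt_eq_rpow]
    have e3 : D ^ (1 / 2 : ℝ) = √D := by rw [Real.sqrt_eq_rpow]
    rw [e1, e2, e3]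
    calc (N : ℝ) ≤ _ := hNle
      _ ≤ C * (P.ell * max (P.gap q z₀) (ε ^ 2 / P.ell) / ε ^ 2 *
          (√(1 / c₁) * (√P.ell * √D / √ε)) * Real.log (1 / ε)) := by gcongr
      _ = _ := by
        have : 0 < √ε := Real.sqrt_pos.2 hε
        field_simp
  · have hrx : q.rx * (√q.δ + ‖sx (P.iter q x₀ y₀ z₀ t).2.2 - (P.iter q x₀ y₀ z₀ t).2.2‖) ≤
        2 * (|κ| * g) * ε := by
      calc _ ≤ |κ| * P.ell * (g * (ε / P.ell) + g * (ε / P.ell)) := by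
            have := hq.rx_le.trans (mul_le_mul_of_nonneg_right (le_abs_self κ) hell.le)
            gcongr
        _ = _ := by field_simp; ring
    nlinarith
  · have hrD : q.ry * D ≤ c₂ * ε := by
      calc q.ry * D ≤ c₂ * (ε / D) * D := by gcongr
        _ = c₂ * ε := by field_simp
    have hκg : 0 ≤ |κ| * g * ε := by positivity
    nlinarith

theorem foam_os_complexity (κ K m : ℝ) {b θ c₁ c₂ : ℝ} (hb : 0 < b) (hK : 0 < K) (hθ : 0 < θ)
    (hc₁ : 0 < c₁) (hc₂ : c₁ ≤ c₂) (hlt : c₂ < 1 / 8) :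
    ∃ C : ℝ, 0 < C ∧ ∀ (n d : ℕ) (P : Problem n d), P.Assumptions →
      BddBelow (primal P.Y P.f '' P.X) → ∀ x₀ ∈ P.X, ∀ y₀ ∈ P.Y, ∀ z₀ : E n,
      ∃ ε₀ : ℝ, 0 < ε₀ ∧ ∀ ε : ℝ, 0 < ε → ε < ε₀ →
        ∀ (q : Params) (a c : ℝ), P.ParamCondition q κ b K m θ ε a c →
          c₁ * (ε ^ 2 / (P.ell * Metric.diam P.Y ^ 2)) ≤ q.ry →
          q.ry ≤ c₂ * (ε ^ 2 / (P.ell * Metric.diam P.Y ^ 2)) →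
          ∃ t N : ℕ, P.totalCost q x₀ y₀ z₀ t = (N : ℕ∞) ∧
            (N : ℝ) ≤ C * (P.ell ^ 2 * Metric.diam P.Y
              * max (P.gap q z₀) (ε ^ 2 / P.ell) / ε ^ 3 * Real.log (1 / ε)) ∧
            P.IsOS ε (P.candidate q a c x₀ y₀ z₀ t).1 := by
  have hc₂0 : 0 < c₂ := hc₁.trans_le hc₂
  -- Chosen so that `60 κ g ε / ℓ ≤ ε / (2ℓ)`, which serves both smallness conditions of `isOS`.
  set g := 1 / (120 * (|κ| + 1)) with hg_def
  have hg : 0 < g := by positivity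
  have hgκ : 120 * (|κ| * g) ≤ 1 := by
    have : 120 * ((|κ| + 1) * g) = 1 := by rw [hg_def]; field_simp
    linarith
  obtain ⟨C, hC, H⟩ := exists_complexity κ K m hb hK hg
  refine ⟨C * √(1 / c₁), by positivity, ?_⟩
  intro n d P hP hbdd x₀ hx₀ y₀ hy₀ z₀
  have hell := hP.ell_pos
  have hD := hP.diam_pos
  obtain ⟨ε₀, hε₀, H⟩ := H n d P hP hbdd x₀ hx₀ y₀ hy₀ z₀ (c₁ / (P.ell * Metric.diam P.Y ^ 2))
    (c₂ / (P.ell * Metric.diam P.Y ^ 2)) (by positivity) (by positivity)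
  refine ⟨min ε₀ 1, by positivity, ?_⟩
  intro ε hε hεlt q a c hq hry hry'
  rw [lt_min_iff] at hεlt
  set D := Metric.diam P.Y
  obtain ⟨hrun, hσ, H⟩ := H ε hε hεlt.1 q θ a c hq
    (by rwa [mul_div_assoc', ← div_mul_eq_mul_div] at hry) (by
      refine hry'.trans ?_
      rw [mul_div_assoc', div_mul_eq_mul_div]
      have : ε ^ 2 ≤ ε := by nlinarith
      gcongr)
  obtain ⟨sx, sy, hs⟩ := hrun.exists_saddleMap
  obtain ⟨t, N, hN, hNle, hres⟩ := H sx sy hs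
  have hκ : 3 < κ := lt_of_mul_lt_mul_right (hq.rx_gt.trans_le hq.rx_le) hell.le
  have hκ0 : 0 < κ := by linarith
  rw [abs_of_pos hκ0] at hgκ
  have hgκ' : 60 * κ * (g * (ε / P.ell)) ≤ ε / (2 * P.ell) := by
    calc 60 * κ * (g * (ε / P.ell)) = 120 * (κ * g) * (ε / (2 * P.ell)) := by field_simp; norm_num
      _ ≤ 1 * (ε / (2 * P.ell)) := by gcongr
      _ = _ := one_mul _
  have ha : 0 < a := lt_of_lt_of_le (by positivity) hq.le_a
  have hc : 0 < c := lt_of_lt_of_le (by positivity) hq.le_c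
  refine ⟨t, N, hN, ?_, hrun.isOS hs ha hq.a_le hc hq.c_le hκ.le hq.rx_le hε t ?_ ?_ ?_⟩
  · have hry0 := hq.ry_pos
    have hM : 0 < max (P.gap q z₀) (ε ^ 2 / P.ell) :=
      lt_of_lt_of_le (by positivity) (le_max_right _ _)
    have hW : 0 ≤ Real.log (1 / ε) := Real.log_nonneg (by
      rw [le_div_iff₀ hε]
      linarith)
    have hsqrt : √(P.ell / q.ry) ≤ √(1 / c₁) * (P.ell * D / ε) := by
      rw [← Real.sqrt_sq (show 0 ≤ P.ell * D / ε by positivity), ← Real.sqrt_mul (by positivity)]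
      apply Real.sqrt_le_sqrt
      calc P.ell / q.ry ≤ P.ell / (c₁ * (ε ^ 2 / (P.ell * D ^ 2))) := by gcongr
        _ = _ := by field_simp
    calc (N : ℝ) ≤ _ := hNle
      _ ≤ C * (P.ell * max (P.gap q z₀) (ε ^ 2 / P.ell) / ε ^ 2 *
          (√(1 / c₁) * (P.ell * D / ε)) * Real.log (1 / ε)) := by gcongr
      _ = _ := by field_simp
  · refine le_trans ?_ hgκ'
    have : 0 ≤ κ * ‖sx (P.iter q x₀ y₀ z₀ t).2.2 - (P.iter q x₀ y₀ z₀ t).2.2‖ := by positivity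
    have := mul_le_mul_of_nonneg_left hres (show 0 ≤ 60 * κ by positivity)
    linarith
  · refine le_trans ?_ hgκ'
    gcongr
  -- The condition `c₂ < 1/8` comes from `(ℓ/2)(ε / (2ℓ))² = ε² / (8ℓ)`.
  · calc q.ry * D ^ 2 ≤ c₂ * (ε ^ 2 / (P.ell * D ^ 2)) * D ^ 2 := by gcongr
      _ = c₂ * (ε ^ 2 / P.ell) := by field_simp
      _ ≤ 1 / 8 * (ε ^ 2 / P.ell) := by gcongr
      _ = _ := by field_simp; norm_num

end Main

end MinimaxFOAM

theorem mainTheorem5 (κ b K m θ c₁ c₂ : ℝ) (hb : 0 < b) (hK : 0 < K) (hθ : 0 < θ)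
    (hc₁ : 0 < c₁) (hc₂ : c₁ ≤ c₂) :
    (c₂ < 1 →
      ∃ C : ℝ, 0 < C ∧
        ∀ (n d : ℕ) (P : MinimaxFOAM.Problem n d), P.Assumptions →
          BddBelow (MinimaxFOAM.primal P.Y P.f '' P.X) →
          ∀ x₀ ∈ P.X, ∀ y₀ ∈ P.Y, ∀ z₀ : MinimaxFOAM.E n,
          ∃ ε₀ : ℝ, 0 < ε₀ ∧ ∀ ε : ℝ, 0 < ε → ε < ε₀ →
            ∀ (q : MinimaxFOAM.Params) (a c : ℝ), P.ParamCondition q κ b K m θ ε a c →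
              c₁ * (ε / Metric.diam P.Y) ≤ q.ry → q.ry ≤ c₂ * (ε / Metric.diam P.Y) →
              ∃ t N : ℕ, P.totalCost q x₀ y₀ z₀ t = (N : ℕ∞) ∧
                (N : ℝ) ≤ C * (P.ell ^ (3 / 2 : ℝ) * Metric.diam P.Y ^ (1 / 2 : ℝ)
                  * max (P.gap q z₀) (ε ^ 2 / P.ell) / ε ^ (5 / 2 : ℝ) * Real.log (1 / ε)) ∧
                P.IsGS ε (P.candidate q a c x₀ y₀ z₀ t).1 (P.candidate q a c x₀ y₀ z₀ t).2) ∧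
    (c₂ < 1 / 8 →
      ∃ C : ℝ, 0 < C ∧
        ∀ (n d : ℕ) (P : MinimaxFOAM.Problem n d), P.Assumptions →
          BddBelow (MinimaxFOAM.primal P.Y P.f '' P.X) →
          ∀ x₀ ∈ P.X, ∀ y₀ ∈ P.Y, ∀ z₀ : MinimaxFOAM.E n,
          ∃ ε₀ : ℝ, 0 < ε₀ ∧ ∀ ε : ℝ, 0 < ε → ε < ε₀ →
            ∀ (q : MinimaxFOAM.Params) (a c : ℝ), P.ParamCondition q κ b K m θ ε a c →
              c₁ * (ε ^ 2 / (P.ell * Metric.diam P.Y ^ 2)) ≤ q.ry →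
              q.ry ≤ c₂ * (ε ^ 2 / (P.ell * Metric.diam P.Y ^ 2)) →
              ∃ t N : ℕ, P.totalCost q x₀ y₀ z₀ t = (N : ℕ∞) ∧
                (N : ℝ) ≤ C * (P.ell ^ 2 * Metric.diam P.Y
                  * max (P.gap q z₀) (ε ^ 2 / P.ell) / ε ^ 3 * Real.log (1 / ε)) ∧
                P.IsOS ε (P.candidate q a c x₀ y₀ z₀ t).1) := ⟨MinimaxFOAM.foam_gs_complexity κ K m hb hK hθ hc₁ hc₂,
    MinimaxFOAM.foam_os_complexity κ K m hb hK hθ hc₁ hc₂⟩
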